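/- Let $k$ be a global function field, i.e. the function field of a smooth projective curve $C$ over a finite field, let $\infty$ be a place of $k$, and let $A$ be the ring of elements of $k$ regular away from $\infty$; thus $A$ is a Dedekind domain with fraction field $k$ whose maximal ideals $v$ correspond to the places of $k$ other than $\infty$. For such $v$ let $k_v$ be the completion of $k$ at $v$, $\mathcal O_v$ its ring of integers, and let $\mathbb A_f$ be the ring of finite adeles of $k$ (the restricted product of the $k_v$ over $v\neq\infty$). Let $r$ be a prime number, $D$ a central division algebra over $k$ with $[D:k]=r^2$, and $O_D$ a maximal $A$-order in $D$. Let $K/k$ be a field extension of degree $r$ which is imaginary (exactly one place of $K$ lies above $\infty$), $\phi:K\hookrightarrow D$ a $k$-algebra embedding, and $R$ an $A$-order of $K$. Put $K_v=K\otimes_k k_v$, $D_v=D\otimes_k k_v$, $R_v=R\otimes_A\mathcal O_v$, $O_{D,v}=O_D\otimes_A\mathcal O_v$, $\phi_v=\phi\otimes\mathrm{id}:K_v\to D_v$, and $\mathcal K=\prod_{v\ne\infty}O_{D,v}^*\subset D^*(\mathbb A_f)=(D\otimes_k\mathbb A_f)^*$, $K^*(\mathbb A_f)=(K\otimes_k\mathbb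 A_f)^*$. For $b\in D^*(\mathbb A_f)$ let $O_{D,b}=D\cap b\bigl(\prod_v O_{D,v}\bigr)b^{-1}$, and define $$\mathcal E^o_\phi(R)=\{b\in D^*(\mathbb A_f):\ \phi^{-1}(O_{D,b})=R\},\qquad \mathcal E^o_{\phi_v}(R_v)=\{b\in D_v^*:\ \phi_v^{-1}(bO_{D,v}b^{-1})=R_v\}.$$ Let $h(R)=\#\bigl(K^*\backslash K^*(\mathbb A_f)/\prod_v R_v^*\bigr)$. For $v\neq\infty$ define $\mu_v^D(R_v)$ as follows. If $D_v\cong M_r(k_v)$, it is the number of isomorphism classes of optimal $R_v$-lattices in $V=k_v^r$, that is, of $\mathcal O_v$-lattices $L\subset V$ with $\{x\in K_v: \phi_v(x)L\subset L\}=R_v$, where $L_1$ and $L_2$ are isomorphic if there is $b\in\mathrm{Aut}_{k_v}(V)$ with $bL_1=L_2$ and $b(\phi_v(\alpha)\lambda)=\phi_v(\alpha)b(\lambda)$ for all $\alpha\in K_v$, $\lambda\in L_1$ (this number does not depend on the choice of the isomorphism $D_v\cong M_r(k_v)$). If $D_v\not\cong M_r(k_v)$ (so that $D_v$ is a division algebra),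 then $\mu_v^D(R_v)$ is $r$ if $R_v$ is maximal in $K_v$ and $v$ is unramified in $K_v$, it is $1$ if $R_v$ is maximal and $v$ is ramified in $K_v$, and it is $0$ if $R_v$ is not maximal. Then $h(R)$ and all $\mu_v^D(R_v)$ are finite, $\mu_v^D(R_v)=1$ for all but finitely many $v$, and for every $v\ne\infty$ the set $\phi_v(K_v^*)\backslash\mathcal E^o_{\phi_v}(R_v)/O_{D,v}^*$ is finite of cardinality $\mu_v^D(R_v)$. Moreover, the double coset space $\phi(K^*)\backslash\mathcal E^o_\phi(R)/\mathcal K$ is finite, and its cardinality is the modified class number $$\#\bigl(\phi(K^*)\backslash\mathcal E^o_\phi(R)/\mathcal K\bigr)=h^D(R):=h(R)\cdot\prod_{v\neq\infty}\mu_v^D(R_v).$$ -/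

import Mathlib

open IsDedekindDomain
open scoped TensorProduct RatFunc

noncomputable section

namespace OptEmb

/-! ### Places, the ring `A`, orders -/

/-- The places of a global function field `k` are its nontrivial valuation subrings.
`Spec A = C ∖ {P}`, where `A` is a Dedekind domain with fraction field `k`: `P` is a place of `k`,
and the places of `k` at which all elements of `A` are regular are exactly those other than `P`. -/
structure IsAwayFrom (A : Type*) [CommRing A] [IsDedekindDomain A] {k : Type*} [Field k]
    [Algebra A k] [IsFractionRing A k] (P : ValuationSubring k) : Prop where
  ne_top : P ≠ ⊤
  regular_iff : ∀ w : ValuationSubring k, w ≠ ⊤ → ((∀ a : A, algebraMap A k a ∈ w) ↔ w ≠ P)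

/-- Under `IsAwayFrom A P`, the ring `A` consists precisely of the elements of `k` that are
regular at every place other than `P`. -/
theorem IsAwayFrom.mem_range_iff {A : Type*} [CommRing A] [IsDedekindDomain A] {k : Type*}
    [Field k] [Algebra A k] [IsFractionRing A k] {P : ValuationSubring k} (h : IsAwayFrom A P)
    (x : k) :
    x ∈ (algebraMap A k).range ↔ ∀ w : ValuationSubring k, w ≠ ⊤ → w ≠ P → x ∈ w := by
  constructor
  · rintro ⟨a, rfl⟩ w hw hwP
    exact (h.regular_iff w hw).2 hwP a
  · intro hx
    refine HeightOneSpectrum.mem_integers_of_valuation_le_one k x fun v => ?_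
    have ht : (v.valuation k).valuationSubring ≠ ⊤ := by
      rw [ne_eq, Valuation.valuationSubring_eq_top_iff, not_not]
      infer_instance
    exact hx _ ht ((h.regular_iff _ ht).1 fun a => v.valuation_le_one a)

/-- `K / k` is imaginary with respect to the place `P` of `k`: `P` does not split in `K`, that is,
there is exactly one place of `K` above `P`. -/
def IsImaginary {k : Type*} [Field k] (P : ValuationSubring k) (K : Type*) [Field K]
    [Algebra k K] : Prop :=
  ∃! w : ValuationSubring K, w.comap (algebraMap k K) = P

/-- An `R`-order in an `F`-algebra `B`: an `R`-subalgebra that is finitely generated as an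
`R`-module and spans `B` over `F`. -/
def IsOrder {R : Type*} (F : Type*) [CommRing R] [Field F] [Algebra R F] {B : Type*} [Ring B]
    [Algebra R B] [Algebra F B] [IsScalarTower R F B] (S : Subalgebra R B) : Prop :=
  (Subalgebra.toSubmodule S).IsLattice F

/-- A maximal `R`-order in an `F`-algebra `B`. -/
def IsMaximalOrder {R : Type*} (F : Type*) [CommRing R] [Field F] [Algebra R F] {B : Type*}
    [Ring B] [Algebra R B] [Algebra F B] [IsScalarTower R F B] (S : Subalgebra R B) : Prop :=
  Maximal (IsOrder F) S

/-- The double coset space `H \ E / U` of a subset `E` of a group, as the set of all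
double cosets `H b U` with `b ∈ E`. -/
def doubleCosets {G : Type*} [Group G] (H U : Subgroup G) (E : Set G) : Set (Set G) :=
  (fun b => DoubleCoset.doubleCoset b (H : Set G) (U : Set G)) '' E

section Local

variable {A : Type*} [CommRing A] [IsDedekindDomain A] {k : Type*} [Field k] [Algebra A k]
  [IsFractionRing A k]

/-- `B_v = k_v ⊗_k B` for a `k`-algebra `B` and a finite place `v`. -/
abbrev LocalAlg (k : Type*) [Field k] [Algebra A k] [IsFractionRing A k]
    (v : HeightOneSpectrum A) (B : Type*) [Ring B] [Algebra k B] : Type _ :=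
  v.adicCompletion k ⊗[k] B

/-- `S_v = S ⊗_A O_v` inside `B_v`: the `O_v`-subalgebra generated by the image of `S`. -/
def localOrder (v : HeightOneSpectrum A) {B : Type*} [Ring B] [Algebra k B] [Algebra A B]
    (S : Subalgebra A B) : Subalgebra (v.adicCompletionIntegers k) (LocalAlg k v B) :=
  Algebra.adjoin (v.adicCompletionIntegers k)
    ((Algebra.TensorProduct.includeRight : B →ₐ[k] LocalAlg k v B) '' (S : Set B))

variable {K D : Type*} [Field K] [Algebra k K] [Algebra A K]
  [DivisionRing D] [Algebra k D] [Algebra A D]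

/-- `φ_v : K_v → D_v`, the base change of `φ`. -/
def localEmb (v : HeightOneSpectrum A) (φ : K →ₐ[k] D) :
    LocalAlg k v K →ₐ[v.adicCompletion k] LocalAlg k v D :=
  Algebra.TensorProduct.map (AlgHom.id (v.adicCompletion k) (v.adicCompletion k)) φ

/-- `φ_v(K_v^*)`. -/
def localUnitsImage (v : HeightOneSpectrum A) (φ : K →ₐ[k] D) : Subgroup (LocalAlg k v D)ˣ :=
  (Units.map (localEmb v φ : LocalAlg k v K →* LocalAlg k v D)).range

/-- The set of `b ∈ D_v^*` with `φ_v⁻¹(b O_{D,v} b⁻¹) = R_v`. -/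
def localOptimal (v : HeightOneSpectrum A) (φ : K →ₐ[k] D) (OD : Subalgebra A D)
    (R : Subalgebra A K) : Set (LocalAlg k v D)ˣ :=
  {b | ∀ x : LocalAlg k v K,
    (↑b⁻¹ * localEmb v φ x * ↑b ∈ localOrder v OD ↔ x ∈ localOrder v R)}

/-- `O_{D,v}^*` as a subgroup of `D_v^*`. -/
def localUnits (v : HeightOneSpectrum A) (OD : Subalgebra A D) : Subgroup (LocalAlg k v D)ˣ :=
  (localOrder v OD).toSubring.toSubmonoid.units

variable {r : ℕ}

/-- Optimal `R_v`-lattices in `V = k_v^r`, on which `D_v` acts through an isomorphism `θ` with the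
matrix algebra: `O_v`-lattices `L` such that, for `x ∈ K_v`, the endomorphism `φ_v(x)` maps `L`
into itself if and only if `x ∈ R_v`. -/
def OptimalLattice (v : HeightOneSpectrum A) (φ : K →ₐ[k] D) (R : Subalgebra A K)
    (θ : LocalAlg k v D ≃ₐ[v.adicCompletion k] Matrix (Fin r) (Fin r) (v.adicCompletion k)) :
    Type _ :=
  {L : Submodule (v.adicCompletionIntegers k) (Fin r → v.adicCompletion k) //
    L.IsLattice (v.adicCompletion k) ∧
    ∀ x : LocalAlg k v K,
      (∀ l ∈ L, (θ (localEmb v φ x)).mulVec l ∈ L) ↔ x ∈ localOrder v R}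

/-- Two optimal lattices `L₁`, `L₂` are isomorphic if some `b ∈ Aut(V)` satisfies `b L₁ = L₂` and
`b (φ_v(α) l) = φ_v(α) (b l)` for all `α ∈ K_v` and `l ∈ L₁`. -/
def latticeSetoid (v : HeightOneSpectrum A) (φ : K →ₐ[k] D) (R : Subalgebra A K)
    (θ : LocalAlg k v D ≃ₐ[v.adicCompletion k] Matrix (Fin r) (Fin r) (v.adicCompletion k)) :
    Setoid (OptimalLattice v φ R θ) where
  r L₁ L₂ := ∃ b : (Fin r → v.adicCompletion k) ≃ₗ[v.adicCompletion k]
      (Fin r → v.adicCompletion k),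
    (∀ l, l ∈ L₁.1 ↔ b l ∈ L₂.1) ∧
    ∀ (α : LocalAlg k v K), ∀ l ∈ L₁.1,
      b ((θ (localEmb v φ α)).mulVec l) = (θ (localEmb v φ α)).mulVec (b l)
  iseqv :=
    { refl := fun _ => ⟨LinearEquiv.refl _ _, by simp, by simp⟩
      symm := by
        rintro L₁ L₂ ⟨b, hb, hc⟩
        refine ⟨b.symm, fun l => by simp [hb], fun α l hl => ?_⟩
        have := hc α (b.symm l) (by simpa [hb] using hl)
        rw [LinearEquiv.symm_apply_eq, this, LinearEquiv.apply_symm_apply]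
      trans := by
        rintro L₁ L₂ L₃ ⟨b, hb, hc⟩ ⟨b', hb', hc'⟩
        refine ⟨b.trans b', fun l => by simp [hb, hb'], fun α l hl => ?_⟩
        simp only [LinearEquiv.trans_apply]
        rw [hc α l hl, hc' α _ ((hb l).1 hl)] }

/-- `v` is unramified in `K_v`: the integral closure of `O_v` in `K_v` is unramified over `O_v`. -/
def IsUnramifiedPlace (v : HeightOneSpectrum A) (k K : Type*) [Field k] [Algebra A k]
    [IsFractionRing A k] [Field K] [Algebra k K] : Prop :=
  Algebra.FormallyUnramified (v.adicCompletionIntegers k)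
    (integralClosure (v.adicCompletionIntegers k) (LocalAlg k v K))

open Classical in
/-- The local factor `μ_v^D(R_v)`. If `D_v ≅ M_r(k_v)`, it is the number of isomorphism classes of
optimal `R_v`-lattices in `k_v^r` (the choice of the isomorphism is irrelevant, as any two differ by
an inner automorphism). Otherwise it is `r` if `R_v` is maximal and `v` is unramified in `K_v`, it
is `1` if `R_v` is maximal and `v` is ramified in `K_v`, and it is `0` if `R_v` is not maximal. -/
def localFactor (r : ℕ) (v : HeightOneSpectrum A) (φ : K →ₐ[k] D) (R : Subalgebra A K) : ℕ :=
  if h : Nonempty (LocalAlg k v D ≃ₐ[v.adicCompletion k]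
      Matrix (Fin r) (Fin r) (v.adicCompletion k)) then
    Nat.card (Quotient (latticeSetoid v φ R h.some))
  else if IsMaximalOrder (v.adicCompletion k) (localOrder (k := k) v R) then
    (if IsUnramifiedPlace v k K then r else 1)
  else 0

end Local

section Global

variable (A : Type*) [CommRing A] [IsDedekindDomain A] (k : Type*) [Field k] [Algebra A k]
  [IsFractionRing A k]

/-- `B(𝔸_f) = 𝔸_f ⊗_k B` for a `k`-algebra `B`. -/
abbrev AdelicAlg (B : Type*) [Ring B] [Algebra k B] : Type _ :=
  FiniteAdeleRing A k ⊗[k] B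

/-- The projection `𝔸_f → k_v`. -/
def adeleEval (v : HeightOneSpectrum A) : FiniteAdeleRing A k →ₐ[k] v.adicCompletion k where
  toFun a := a v
  map_one' := rfl
  map_mul' _ _ := rfl
  map_zero' := rfl
  map_add' _ _ := rfl
  commutes' _ := rfl

variable {A}

/-- The projection `B(𝔸_f) → B_v`. -/
def component (v : HeightOneSpectrum A) (B : Type*) [Ring B] [Algebra k B] :
    AdelicAlg A k B →ₐ[k] LocalAlg k v B :=
  Algebra.TensorProduct.map (adeleEval A k v) (AlgHom.id k B)

variable {k}

/-- `∏_v S_v` inside `B(𝔸_f)`, for `S` an `A`-subalgebra of `B`. -/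
def adelicOrder {B : Type*} [Ring B] [Algebra k B] [Algebra A B] (S : Subalgebra A B) :
    Subring (AdelicAlg A k B) :=
  ⨅ v : HeightOneSpectrum A,
    (localOrder (k := k) v S).toSubring.comap (component k v B).toRingHom

/-- `(∏_v S_v)^*` as a subgroup of `B(𝔸_f)^*`. -/
def adelicUnits {B : Type*} [Ring B] [Algebra k B] [Algebra A B] (S : Subalgebra A B) :
    Subgroup (AdelicAlg A k B)ˣ :=
  (adelicOrder S).toSubmonoid.units

variable {K D : Type*} [Field K] [Algebra k K] [Algebra A K]
  [DivisionRing D] [Algebra k D] [Algebra A D]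

/-- `φ : K → D` followed by the diagonal embedding `D → D(𝔸_f)`. -/
def adelicEmb (A : Type*) [CommRing A] [IsDedekindDomain A] [Algebra A k] [IsFractionRing A k]
    {B : Type*} [Ring B] [Algebra k B] (φ : K →ₐ[k] B) : K →ₐ[k] AdelicAlg A k B :=
  (Algebra.TensorProduct.includeRight : B →ₐ[k] AdelicAlg A k B).comp φ

/-- `φ(K^*)` inside `B(𝔸_f)^*`. -/
def globalUnitsImage (A : Type*) [CommRing A] [IsDedekindDomain A] [Algebra A k]
    [IsFractionRing A k] {B : Type*} [Ring B] [Algebra k B] (φ : K →ₐ[k] B) :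
    Subgroup (AdelicAlg A k B)ˣ :=
  (Units.map (adelicEmb A φ : K →* AdelicAlg A k B)).range

/-- The set of `b ∈ D^*(𝔸_f)` with `φ⁻¹(O_{D,b}) = R`, where `O_{D,b} = D ∩ b (∏_v O_{D,v}) b⁻¹`. -/
def optimalEmbeddings (φ : K →ₐ[k] D) (OD : Subalgebra A D) (R : Subalgebra A K) :
    Set (AdelicAlg A k D)ˣ :=
  {b | ∀ x : K, (↑b⁻¹ * adelicEmb A φ x * ↑b ∈ adelicOrder OD ↔ x ∈ R)}

/-- The double coset space `K^* \ K^*(𝔸_f) / (∏_v R_v)^*`. -/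
def classSet (k : Type*) [Field k] [Algebra A k] [IsFractionRing A k] [Algebra k K]
    (R : Subalgebra A K) : Set (Set (AdelicAlg A k K)ˣ) :=
  doubleCosets (globalUnitsImage A (AlgHom.id k K)) (adelicUnits R) Set.univ

/-- The class number `h(R)`. -/
def classNumber (k : Type*) [Field k] [Algebra A k] [IsFractionRing A k] [Algebra k K]
    (R : Subalgebra A K) : ℕ :=
  (classSet k R).ncard

/-- The modified class number `h^D(R) = h(R) ∏_v μ_v^D(R_v)`. -/
def modifiedClassNumber (r : ℕ) (φ : K →ₐ[k] D) (R : Subalgebra A K) : ℕ :=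
  classNumber k R * ∏ᶠ v : HeightOneSpectrum A, localFactor r v φ R

end Global

end OptEmb

end

open IsDedekindDomain
open scoped TensorProduct RatFunc

noncomputable section

namespace OptEmb

set_option linter.unusedSectionVars false

/-! Optimality is a local condition: a lattice in $K$ is the intersection of its localisations, so
$b$ is optimal iff every component $b_v$ is (`mem_optimalEmbeddings_iff`). Hence $K^*(\mathbb A_f)$
acts on the optimal elements from the left, and the stabiliser of each $b\mathcal K$ is $\prod_v
R_v^*$. All fibres of $K^*\backslash\mathcal E^o_\phi(R)/\mathcal K\to K^*(\mathbb
A_f)\backslash\mathcal E^o_\phi(R)/\mathcal K$ are therefore copies of $K^*\backslash K^*(\mathbb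
A_f)/\prod_v R_v^*$, which gives the factor $h(R)$ (`card_doubleCosets_map`). The base is the
product of the local double coset spaces, almost all of which are single points
(`adelicCosets_equiv`).

If $D_v$ is a matrix algebra, $O_{D,v}$ is the stabiliser of a lattice $L$ in $V$, and $b\mapsto bL$
turns local double cosets into isomorphism classes of optimal lattices, because the commutant of
$K_v$ in $D_v$ is $K_v$ (`card_localCosets_of_split`). If $D_v$ is a division algebra, the valuation
of the norm is a valuation on $D_v$ whose ring is the unique maximal order. It is invariant under
conjugation, so either all $b$ are optimal or none is. In the first case the double cosets form
$\mathbb Z/g$, where $g$ generates the orders of norms from $K_v^*$; this $g$ is $r$ or $1$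
according to ramification (`card_localCosets_of_division`).

Finiteness rests on $A$ being finite over a polynomial ring $\mathbb F_q[t]$
(`IsAwayFrom.exists_finite_polynomial`). This yields the Jordan–Zassenhaus theorem for $R$-lattices
in $K$ (`exists_finite_lattices`), with a finite set of representatives that serves all $v$ at once
(`exists_finite_lattices_local`). The class number and the split local factors are thus finite. The
factors are $1$ wherever $D$ splits and $R$ and all the representatives have standard localisations,
and $D$ splits almost everywhere (`finite_isDomain_localAlg`). The extension $K/k$ may be
inseparable, so the arguments about $K_v$ use primitive elements, cyclic vectors and flatness
instead of separability. -/

/-! ### The ring $A$ is finite over a polynomial ring. -/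

open IntermediateField in
/-- A function field in one variable over a perfect field has a separating element in any subring
of which it is the field of fractions. -/
theorem exists_separating_element (F k A : Type*) [Field F] [PerfectField F] [Field k] [CommRing A]
    [Algebra F k] [Algebra F A] [Algebra A k] [IsScalarTower F A k] [IsFractionRing A k]
    [Algebra.EssFiniteType F k] (htr : Algebra.trdeg F k = 1) :
    ∃ u : A, Transcendental F (algebraMap A k u) ∧
      Algebra.IsSeparable (adjoin F {algebraMap A k u}) k ∧
      FiniteDimensional (adjoin F {algebraMap A k u}) k := by
  classical
  have hbasis {ι : Type} [Unique ι] (x : ι → k) (hx : Transcendental F (x default)) :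
      IsTranscendenceBasis F x := by
    refine AlgebraicIndependent.isTranscendenceBasis_of_lift_trdeg_le_of_finite
      (algebraicIndependent_unique_type_iff.2 hx) ?_
    simp [htr]
  have hfin (x : k) (hx : Transcendental F x) : FiniteDimensional (adjoin F {x}) k := by
    have hb := hbasis (fun _ : Unit => x) hx
    have h1 : Algebra.EssFiniteType (adjoin F {x}) k := .of_comp F _ _
    have h2 : Algebra.IsAlgebraic (adjoin F {x}) k := by
      convert! hb.isAlgebraic_field <;> simp
    exact Algebra.finite_of_essFiniteType_of_isAlgebraic
  have hex : ∃ u : A, Transcendental F (algebraMap A k u) := by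
    by_contra! hcon
    have : Algebra.IsAlgebraic F k := ⟨fun x => by
      obtain ⟨a, b, hb, rfl⟩ := IsFractionRing.div_surjective (A := A) x
      rw [div_eq_mul_inv]
      exact IsAlgebraic.mul (not_not.1 (hcon a)) (IsAlgebraic.inv (not_not.1 (hcon b)))⟩
    rw [trdeg_eq_zero_iff.2 this] at htr
    simp at htr
  -- Among the transcendental elements of $A$, the one of least inseparable degree is separating:
  -- otherwise the exchange below finds a better one.
  let d (u : A) := Field.finInsepDegree (adjoin F {algebraMap A k u}) k
  let s := d.argminOn {u | Transcendental F (algebraMap A k u)} hex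
  have hs : Transcendental F (algebraMap A k s) := d.argminOn_mem _ hex
  have := hfin _ hs
  refine ⟨s, hs, ?_, this⟩
  obtain hz | ⟨p, hp, hpk⟩ := CharP.exists' F
  · infer_instance
  have : ExpChar F p := .prime hp.out
  have : CharP k p := .of_ringHom_of_ne_zero (algebraMap F k) p hp.out.ne_zero
  have H : ∀ a : A, algebraMap A k a ∈ separableClosure (adjoin F {algebraMap A k s}) k := by
    intro a
    by_contra ha
    let f : Bool → k := fun b => if b then algebraMap A k s else algebraMap A k a
    have hf : IsTranscendenceBasis F (fun i : {i : Bool // i ≠ false} => f i) := by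
      let _ : Unique {i : Bool // i ≠ false} := ⟨⟨⟨true, by simp⟩⟩, by rintro ⟨_ | _, h⟩ <;> simp_all⟩
      exact hbasis (fun i : {i : Bool // i ≠ false} => f i) hs
    -- Frobenius is bijective on the perfect field `F`, so $p$-th powers preserve linear
    -- independence over `F`. Hence one of $a$, $s$ is separable over the field generated by the
    -- other. If it is $a$, this contradicts `ha`. If it is $s$, the separable closure of $F(a)$
    -- contains that of $F(s)$ and also $a$, so `d a < d s`.
    obtain ⟨i, hi1, hi2⟩ := exists_isTranscendenceBasis_and_isSeparable_of_linearIndepOn_pow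
      (k := F) (K := k) p hp.out (a := f) (fun s hs ↦ by
        refine hs.map_of_injective_injective (frobeniusEquiv F p).symm
          (frobenius k p).toAddMonoidHom (by simp) (fun x hx => ?_) (fun c x => ?_)
        · exact (frobenius_inj k p) (by simpa using hx)
        · have h1 : (frobeniusEquiv F p).symm c ^ p = c := frobenius_apply_frobeniusEquiv_symm F p c
          change frobenius k p ((frobeniusEquiv F p).symm c • x) = c • frobenius k p x
          rw [frobenius_def, frobenius_def, Algebra.smul_def, Algebra.smul_def, mul_pow, ← map_pow,
            h1])
      false hf
    rcases i with _ | _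
    · have : f '' {false}ᶜ = {algebraMap A k s} := by ext; simp [f]
      rw [this] at hi2
      exact ha (mem_separableClosure_iff.2 hi2)
    · have hfa : f '' {true}ᶜ = {algebraMap A k a} := by ext; simp [f]
      rw [hfa] at hi2
      have hta : Transcendental F (algebraMap A k a) := by
        let _ : Unique {i : Bool // i ≠ true} :=
          ⟨⟨⟨false, by simp⟩⟩, by rintro ⟨_ | _, h⟩ <;> simp_all⟩
        exact (algebraicIndependent_unique_type_iff).1 hi1.1
      have := hfin _ hta
      refine d.not_lt_argminOn _ hta (?_ : d a < d s)
      have : Module.Finite ((separableClosure (adjoin F {algebraMap A k s}) k).restrictScalars F) k :=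
        inferInstanceAs <| Module.Finite (separableClosure (adjoin F {algebraMap A k s}) k) k
      refine finrank_lt_of_gt (K := F) (L := k)
        (F := (separableClosure (adjoin F {algebraMap A k s}) k).restrictScalars F)
        (E := (separableClosure (adjoin F {algebraMap A k a}) k).restrictScalars F) ?_
      refine SetLike.lt_iff_le_and_exists.mpr ⟨?_, algebraMap A k a, ?_, ha⟩
      · rw [separableClosure_le_separableClosure_iff, adjoin_le_iff]
        rintro x rfl
        exact mem_separableClosure_iff.2 hi2
      · exact le_restrictScalars_separableClosure _ (subset_adjoin _ _ rfl)
  rw [← separableClosure.eq_top_iff, eq_top_iff]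
  intro x _
  obtain ⟨a, b, hb, rfl⟩ := IsFractionRing.div_surjective (A := A) x
  exact div_mem (H a) (H b)

/-- A nonzero element of a finite field is a power of its inverse, and one of the two lies in the
valuation ring. -/
theorem mem_valuationSubring_of_finite {F k : Type*} [Field F] [Finite F] [Field k] (f : F →+* k)
    (w : ValuationSubring k) (a : F) : f a ∈ w := by
  rcases eq_or_ne a 0 with rfl | ha
  · simp
  rcases w.mem_or_inv_mem (f a) with h | h
  · exact h
  have h1 : f a = (f a)⁻¹ ^ (Nat.card Fˣ - 1) := by
    have h2 : f a ^ (Nat.card Fˣ) = 1 := by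
      rw [← map_pow]
      have := congrArg (Units.val) (pow_card_eq_one' (x := Units.mk0 a ha))
      simp only [Units.val_pow_eq_pow_val, Units.val_mk0, Units.val_one] at this
      rw [this, map_one]
    have h3 : Nat.card Fˣ - 1 + 1 = Nat.card Fˣ := Nat.sub_add_cancel Nat.card_pos
    have h4 : f a ≠ 0 := by simpa using ha
    rw [← h3, pow_succ] at h2
    rw [inv_pow]
    exact eq_inv_of_mul_eq_one_right h2
  rw [h1]
  exact pow_mem h _

theorem trdeg_functionField (F k : Type*) [Field F] [Field k] [Algebra F⟮X⟯ k] [FunctionField F k]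
    [Algebra F k] [IsScalarTower F F⟮X⟯ k] : Algebra.trdeg F k = 1 := by
  have h1 : Algebra.trdeg F F⟮X⟯ = 1 := by
    have h := trdeg_add_eq F (Polynomial F) (A := F⟮X⟯)
    have : Algebra.IsAlgebraic (Polynomial F) F⟮X⟯ :=
      IsLocalization.isAlgebraic _ (nonZeroDivisors (Polynomial F))
    rw [trdeg_eq_zero (R := Polynomial F), add_zero, Polynomial.trdeg_of_isDomain] at h
    exact h.symm
  have h := lift_trdeg_add_eq F F⟮X⟯ k
  rw [trdeg_eq_zero (R := F⟮X⟯), h1] at h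
  simpa using h.symm

/-- The integral closure of a subring of a field is the intersection of the valuation rings
containing it. -/
theorem isIntegral_of_forall_mem_valuationSubring {F k : Type*} [Field F] [Field k] [Algebra F k]
    (S : Subalgebra F k) {x : k} (h : ∀ w : ValuationSubring k, (∀ y ∈ S, y ∈ w) → x ∈ w) :
    IsIntegral S x := by
  have key : x ∈ (integralClosure (Subring.closure (S.toSubring : Set k)) k).toSubring := by
    rw [← iInf_valuationSubring_superset]
    simp only [Subring.mem_iInf, Subtype.forall]
    exact fun w hw => h w hw
  have key2 : ∀ S' : Subring k, S' = S.toSubring → x ∈ (integralClosure S' k).toSubring →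
      IsIntegral S.toSubring x := by
    rintro _ rfl h
    exact h
  exact key2 _ (Subring.closure_eq _) key

-- $A$ is the integral closure of the principal ideal domain $F[t]$ in $k$, a finite separable
-- extension of $F(t)$, and is therefore a finite module. The subalgebra `Algebra.adjoin F {t}` of
-- $k$ stands in for the polynomial ring.
open IntermediateField IntermediateField.algebraAdjoinAdjoin in
theorem finite_aeval_of_isSeparable {F k A : Type*} [Field F] [Field k] [CommRing A]
    [IsIntegrallyClosed A] [Algebra F k] [Algebra F A] [Algebra A k] [IsScalarTower F A k]
    [IsFractionRing A k] (u : A) (t : k) (ht : t = algebraMap A k u) (hu : Transcendental F t)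
    [Algebra.IsSeparable (adjoin F {t}) k] [FiniteDimensional (adjoin F {t}) k]
    (hint : ∀ y : A, IsIntegral (Algebra.adjoin F {t}) (algebraMap A k y)) :
    (Polynomial.aeval (R := F) u).toRingHom.Finite := by
  have hfr : IsFractionRing (Algebra.adjoin F {t}) (adjoin F {t}) := inferInstance
  let ep : Polynomial F ≃ₐ[F] Algebra.adjoin F {t} :=
    (AlgEquiv.ofInjective (Polynomial.aeval t) (transcendental_iff_injective.1 hu)).trans
      (Subalgebra.equivOfEq _ _ (Algebra.adjoin_singleton_eq_range_aeval F t).symm)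
  have hep (p) : (ep p : k) = Polynomial.aeval t p := rfl
  let g : Algebra.adjoin F {t} →+* A :=
    (Polynomial.aeval (R := F) u).toRingHom.comp ep.symm.toRingEquiv.toRingHom
  have hg (x) : algebraMap A k (g x) = x := by
    obtain ⟨p, rfl⟩ := ep.surjective x
    have : g (ep p) = Polynomial.aeval u p := congrArg (Polynomial.aeval u) (ep.symm_apply_apply p)
    rw [this, hep, ht, Polynomial.aeval_algebraMap_apply]
  let _ : Algebra (Algebra.adjoin F {t}) A := g.toAlgebra
  have : IsScalarTower (Algebra.adjoin F {t}) A k := .of_algebraMap_eq fun a => (hg a).symm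
  have : IsPrincipalIdealRing (Algebra.adjoin F {t}) :=
    .of_surjective ep.toRingEquiv.toRingHom ep.surjective
  have hint : IsIntegralClosure A (Algebra.adjoin F {t}) k := by
    refine ⟨IsFractionRing.injective A k, fun {x} => ⟨fun hx => ?_, ?_⟩⟩
    · obtain ⟨y, hy⟩ := IsIntegrallyClosed.isIntegral_iff (R := A).1 (hx.tower_top (A := A))
      exact ⟨y, hy⟩
    · rintro ⟨y, rfl⟩
      exact hint y
  have hfin : Module.Finite (Algebra.adjoin F {t}) A :=
    IsIntegralClosure.finite _ (adjoin F {t}) k A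
  have h2 := RingHom.Finite.comp (g := g) hfin
    (RingHom.Finite.of_surjective ep.toRingEquiv.toRingHom ep.surjective)
  convert! h2 using 1
  ext p
  · simp [g]
  · simp [g]

/-- The affine ring `A` of a global function field is finite over a polynomial ring. -/
theorem IsAwayFrom.exists_finite_polynomial {Fq : Type*} [Field Fq] [Finite Fq]
    {k : Type*} [Field k] [Algebra Fq⟮X⟯ k] [FunctionField Fq k]
    {A : Type*} [CommRing A] [IsDedekindDomain A] [Algebra A k] [IsFractionRing A k]
    {P : ValuationSubring k} (hP : IsAwayFrom A P) :
    ∃ f : Polynomial Fq →+* A, Function.Injective f ∧ f.Finite := by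
  let _ : Algebra Fq k := Algebra.compHom k (algebraMap Fq Fq⟮X⟯)
  have : IsScalarTower Fq Fq⟮X⟯ k := .of_algebraMap_eq fun _ => rfl
  -- Constants are regular at every place, so they lie in $A$ and make it an $\mathbb F_q$-algebra.
  have hmem (a : Fq) : algebraMap Fq k a ∈ (algebraMap A k).range :=
    (hP.mem_range_iff _).2 fun w _ _ => mem_valuationSubring_of_finite _ w a
  let e := RingEquiv.ofBijective (algebraMap A k).rangeRestrict
    ⟨fun x y h => IsFractionRing.injective A k (congrArg Subtype.val h),
      (algebraMap A k).rangeRestrict_surjective⟩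
  let _ : Algebra Fq A := (e.symm.toRingHom.comp ((algebraMap Fq k).codRestrict _ hmem)).toAlgebra
  have : IsScalarTower Fq A k := .of_algebraMap_eq fun a => by
    have := congrArg Subtype.val (e.apply_symm_apply ((algebraMap Fq k).codRestrict _ hmem a))
    exact this.symm
  have : Algebra.EssFiniteType Fq Fq⟮X⟯ :=
    have : Algebra.EssFiniteType (Polynomial Fq) Fq⟮X⟯ :=
      .of_isLocalization _ (nonZeroDivisors (Polynomial Fq))
    .comp Fq (Polynomial Fq) _
  have : Algebra.EssFiniteType Fq k := .comp Fq Fq⟮X⟯ k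
  obtain ⟨u, hu, hsep, hfd⟩ := exists_separating_element Fq k A (trdeg_functionField Fq k)
  set t := algebraMap A k u with ht
  refine ⟨(Polynomial.aeval (R := Fq) u).toRingHom, ?_, ?_⟩
  · exact transcendental_iff_injective.1 fun h => hu h.algebraMap
  refine finite_aeval_of_isSeparable (k := k) u t ht hu fun y => ?_
  refine isIntegral_of_forall_mem_valuationSubring _ fun w hw => ?_
  by_cases hwt : w = ⊤
  · rw [hwt]; trivial
  refine (hP.regular_iff w hwt).2 ?_ y
  -- The case in which the valuation ring is that of the excluded place: `hw` then makes $t$ regular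
  -- there, and it is regular at all other places as an element of $A$. So $t$ lies in every
  -- valuation ring of $k$ and is integral over the constants, contrary to transcendence.
  rintro rfl
  refine hu (IsIntegral.isAlgebraic ?_)
  have h1 : IsIntegral (⊥ : Subalgebra Fq k) t := by
    refine isIntegral_of_forall_mem_valuationSubring _ fun w' _ => ?_
    by_cases hw't : w' = ⊤
    · rw [hw't]; trivial
    by_cases hww : w' = w
    · rw [hww]
      exact hw t (Algebra.self_mem_adjoin_singleton Fq t)
    · exact (hP.regular_iff w' hw't).2 hww u
  have : Algebra.IsIntegral Fq (⊥ : Subalgebra Fq k) :=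
    Algebra.IsIntegral.of_surjective (Algebra.ofId Fq _)
      (fun x => (Algebra.mem_bot.1 x.2).imp fun _ h => Subtype.ext h)
  exact isIntegral_trans (A := (⊥ : Subalgebra Fq k)) t h1

instance hasFiniteQuotients_polynomial (F : Type*) [Field F] [Finite F] :
    Ring.HasFiniteQuotients (Polynomial F) where
  finiteQuotient {I} hI := by
    obtain ⟨m, hm⟩ := (IsPrincipalIdealRing.principal I).principal
    have hm0 : m ≠ 0 := by
      rintro rfl
      exact hI (by rw [hm]; simp)
    have h1 : Finite (Polynomial.degreeLT F m.natDegree) :=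
      .of_equiv _ (Polynomial.degreeLTEquiv F m.natDegree).symm.toEquiv
    refine .of_surjective (fun p : Polynomial.degreeLT F m.natDegree => Ideal.Quotient.mk I p) ?_
    intro x
    obtain ⟨p, rfl⟩ := Ideal.Quotient.mk_surjective x
    refine ⟨⟨p % m, ?_⟩, ?_⟩
    · rw [Polynomial.mem_degreeLT, ← Polynomial.degree_eq_natDegree hm0]
      exact Polynomial.degree_mod_lt p hm0
    · rw [Ideal.Quotient.eq, hm]
      refine Ideal.mem_span_singleton.2 ⟨- (p / m), ?_⟩
      linear_combination EuclideanDomain.mod_add_div p m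

/-! ### Density, residue fields and compactness for the completions. -/

section Completion

variable {A : Type*} [CommRing A] [IsDedekindDomain A] {k : Type*} [Field k] [Algebra A k]
  [IsFractionRing A k] (v : HeightOneSpectrum A)

open HeightOneSpectrum
open scoped WithZero

theorem exists_valued_lt_subset {s : Set (v.adicCompletion k)} (hs : s ∈ nhds 0) :
    ∃ γ : ℤᵐ⁰, γ ≠ 0 ∧ {x | Valued.v x < γ} ⊆ s := by
  obtain ⟨γ, hγ⟩ := Valued.mem_nhds_zero.1 hs
  refine ⟨MonoidWithZeroHom.ValueGroup₀.embedding γ.1, by simp, fun x hx => hγ ?_⟩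
  exact (Valuation.restrict_lt_iff_lt_embedding _).2 hx

theorem isOpen_valued_lt (γ : ℤᵐ⁰) : IsOpen {x : v.adicCompletion k | Valued.v x < γ} := by
  obtain ⟨a, rfl⟩ := valuedAdicCompletion_surjective k v γ
  convert! Valued.isOpen_ball (v.adicCompletion k) (Valued.v.restrict a) using 3
  rw [Valuation.restrict_lt_iff]

theorem exists_valued_sub_algebraMap_lt (y : v.adicCompletion k) {γ : ℤᵐ⁰} (hγ : γ ≠ 0) :
    ∃ x : k, Valued.v (y - algebraMap k (v.adicCompletion k) x) < γ := by
  have h1 : IsOpen {z : v.adicCompletion k | Valued.v (y - z) < γ} :=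
    (isOpen_valued_lt v γ).preimage (continuous_const.sub continuous_id)
  obtain ⟨x, hx⟩ := (denseRange_algebraMap k v).exists_mem_open h1
    ⟨y, by simpa [zero_lt_iff] using hγ⟩
  exact ⟨x, hx⟩

theorem valued_algebraMap (x : k) :
    Valued.v (algebraMap k (v.adicCompletion k) x) = v.valuation k x :=
  valuedAdicCompletion_eq_valuation' v x

theorem exists_valued_sub_algebraMap_algebraMap_lt {y : v.adicCompletion k} (hy : Valued.v y ≤ 1)
    {γ : ℤᵐ⁰} (hγ : γ ≠ 0) :
    ∃ a : A, Valued.v (y - algebraMap k (v.adicCompletion k) (algebraMap A k a)) < γ := by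
  -- An error of at most $1$ keeps $x$ integral at $v$, so that $x$ can in turn be approximated by
  -- $A$.
  obtain ⟨x, hx⟩ := exists_valued_sub_algebraMap_lt v y (γ := min γ 1) (by
    rcases min_choice γ 1 with h | h <;> simp [h, hγ])
  rw [lt_min_iff] at hx
  have hx1 : v.valuation k x ≤ 1 := by
    rw [← valued_algebraMap, ← sub_sub_cancel y (algebraMap k _ x)]
    exact Valuation.map_sub_le _ hy hx.2.le
  obtain ⟨a, ha⟩ := v.exists_valuation_sub_lt_of_integer hx1 (Units.mk0 γ hγ)
  refine ⟨a, ?_⟩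
  rw [← sub_add_sub_cancel y (algebraMap k _ x), ← map_sub]
  refine Valuation.map_add_lt _ hx.1 ?_
  rw [valued_algebraMap, Valuation.map_sub_swap]
  exact ha

/-- By density of $A$ in $\mathcal O_v$, the finite ring $A/v$ surjects onto the residue field. -/
theorem finite_residueField_adicCompletionIntegers [Ring.HasFiniteQuotients A] :
    Finite (IsLocalRing.ResidueField (v.adicCompletionIntegers k)) := by
  have := Ring.HasFiniteQuotients.finiteQuotient (I := v.asIdeal) v.ne_bot
  let f : A →+* IsLocalRing.ResidueField (v.adicCompletionIntegers k) :=
    (IsLocalRing.residue _).comp (algebraMap A _)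
  have hmem (x : v.adicCompletionIntegers k) (hx : Valued.v (x : v.adicCompletion k) < 1) :
      IsLocalRing.residue _ x = 0 := by
    rw [IsLocalRing.residue_eq_zero_iff, IsLocalRing.mem_maximalIdeal, mem_nonunits_iff,
      adicCompletionIntegers.isUnit_iff_valued_eq_one]
    exact hx.ne
  have hf : ∀ a ∈ v.asIdeal, f a = 0 := fun a ha => hmem _ <| by
    change Valued.v (algebraMap k (v.adicCompletion k) (algebraMap A k a)) < 1
    rw [valued_algebraMap]
    exact (v.valuation_lt_one_iff_mem a).2 ha
  refine .of_surjective (Ideal.Quotient.lift v.asIdeal f hf) fun x => ?_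
  obtain ⟨x, rfl⟩ := IsLocalRing.residue_surjective x
  obtain ⟨a, ha⟩ := exists_valued_sub_algebraMap_algebraMap_lt v x.2 one_ne_zero
  refine ⟨Ideal.Quotient.mk _ a, ?_⟩
  rw [Ideal.Quotient.lift_mk]
  refine (sub_eq_zero.1 ?_).symm
  rw [RingHom.comp_apply, ← map_sub]
  exact hmem _ ha

open Valuation.IsRankOneDiscrete in
theorem isCompact_adicCompletionIntegers [Ring.HasFiniteQuotients A] :
    IsCompact (v.adicCompletionIntegers k : Set (v.adicCompletion k)) := by
  have h0 := finite_residueField_adicCompletionIntegers (k := k) v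
  let _ : (Valued.v : Valuation (v.adicCompletion k) ℤᵐ⁰).RankOne := rankOne _ one_lt_two
  have h : CompactSpace (Valued.integer (v.adicCompletion k)) := by
    rw [Valued.integer.compactSpace_iff_completeSpace_and_isDiscreteValuationRing_and_finite_residueField]
    refine ⟨?_, ?_, ?_⟩
    · exact (Valued.isClosed_integer (v.adicCompletion k)).isComplete.completeSpace_coe
    · exact inferInstanceAs (IsDiscreteValuationRing (v.adicCompletionIntegers k))
    · exact h0
  exact isCompact_iff_compactSpace.2 h

end Completion

/-! ### Chinese remainders and approximation in $A$. -/

section Lattices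

open HeightOneSpectrum Module
open scoped WithZero

variable {A : Type*} [CommRing A] [IsDedekindDomain A] {k : Type*} [Field k] [Algebra A k]
  [IsFractionRing A k]

theorem exists_intValuation_eq_exp (w : HeightOneSpectrum A) {m : A} (hm : m ≠ 0) :
    ∃ n : ℕ, w.intValuation m = WithZero.exp (-(n : ℤ)) :=
  ⟨_, w.intValuation_if_neg hm⟩

theorem finite_valuation_ne_one {m : A} (hm : m ≠ 0) :
    {w : HeightOneSpectrum A | w.intValuation m ≠ 1}.Finite := by
  have h : Ideal.span {m} ≠ 0 := by simpa using hm
  refine (Ideal.finite_factors h).subset fun w hw => ?_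
  rw [Set.mem_ofPred_eq, ← w.intValuation_lt_one_iff_dvd]
  exact lt_of_le_of_ne (w.intValuation_le_one m) hw

/-- A Chinese remainder statement for one place against all the others. -/
theorem exists_intValuation_sub_one_le (v : HeightOneSpectrum A) {m : A} (hm : m ≠ 0) :
    ∃ u : A, v.intValuation (u - 1) ≤ v.intValuation m ∧
      ∀ w : HeightOneSpectrum A, w ≠ v → w.intValuation u ≤ w.intValuation m := by
  classical
  choose e he using fun w : HeightOneSpectrum A => exists_intValuation_eq_exp w hm
  -- Outside this finite set `m` is a unit, and no congruence is needed there.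
  let s : Finset (HeightOneSpectrum A) := insert v (finite_valuation_ne_one hm).toFinset
  obtain ⟨u, hu⟩ := IsDedekindDomain.exists_forall_sub_mem_ideal (s := s)
    (fun w => w.asIdeal) e (fun w _ => w.prime) (fun w _ w' _ hww h => hww (HeightOneSpectrum.ext h))
    (fun w => if w.1 = v then 1 else 0)
  refine ⟨u, ?_, fun w hw => ?_⟩
  · rw [he, intValuation_le_pow_iff_mem]
    simpa using hu v (Finset.mem_insert_self _ _)
  · by_cases hws : w ∈ s
    · rw [he, intValuation_le_pow_iff_mem]
      simpa [hw] using hu w hws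
    · have : w.intValuation m = 1 := by
        by_contra h
        exact hws (Finset.mem_insert_of_mem (by simpa using h))
      rw [this]
      exact w.intValuation_le_one u

/-- Approximation at one place, with control at all the others. -/
theorem exists_approx (v : HeightOneSpectrum A) (y : v.adicCompletion k) {c : A} (hc : c ≠ 0) :
    ∃ x : k, Valued.v (y - algebraMap k (v.adicCompletion k) x) ≤ v.intValuation c ∧
      ∀ w : HeightOneSpectrum A, w ≠ v → w.valuation k x ≤ w.intValuation c := by
  obtain ⟨z, hz⟩ := exists_valued_sub_algebraMap_lt v y (v.intValuation_ne_zero c hc)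
  obtain ⟨a, s, hs, rfl⟩ := IsFractionRing.div_surjective (A := A) z
  have hs0 : s ≠ 0 := nonZeroDivisors.ne_zero hs
  -- The factor `u` is $1$ modulo `c * s` at $v$ and divisible by `c * s` elsewhere. Multiplying `a
  -- / s` by it changes little at $v$ and cancels the denominator at all other places.
  obtain ⟨u, hu1, hu2⟩ := exists_intValuation_sub_one_le v (mul_ne_zero hc hs0)
  have key (w : HeightOneSpectrum A) (t : A) (ht : w.intValuation t ≤ w.intValuation (c * s)) :
      w.valuation k (algebraMap A k a / algebraMap A k s * algebraMap A k t) ≤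
        w.intValuation c := by
    rw [map_mul, map_div₀, valuation_of_algebraMap, valuation_of_algebraMap,
      valuation_of_algebraMap]
    have h1 : w.intValuation s ≠ 0 := w.intValuation_ne_zero s hs0
    calc w.intValuation a / w.intValuation s * w.intValuation t
        ≤ 1 / w.intValuation s * w.intValuation (c * s) := by
          gcongr
          · exact zero_le
          · exact w.intValuation_le_one a
      _ = w.intValuation c := by
          rw [map_mul]
          field_simp
  refine ⟨algebraMap A k a / algebraMap A k s * algebraMap A k u, ?_, fun w hw => key w u (hu2 w hw)⟩
  rw [← sub_add_sub_cancel y (algebraMap k _ (algebraMap A k a / algebraMap A k s))]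
  refine Valuation.map_add_le _ hz.le ?_
  rw [← map_sub, valued_algebraMap, Valuation.map_sub_swap, ← mul_sub_one, ← map_one (algebraMap A k),
    ← map_sub]
  exact key v _ hu1

/-- An element of `A` that is divisible by prescribed powers of finitely many primes. -/
theorem exists_forall_intValuation_le (γ : HeightOneSpectrum A → ℤᵐ⁰) (h0 : ∀ v, γ v ≠ 0)
    (h1 : {v | γ v < 1}.Finite) : ∃ c : A, c ≠ 0 ∧ ∀ v, v.intValuation c ≤ γ v := by
  classical
  have (v : HeightOneSpectrum A) : ∃ c : A, c ≠ 0 ∧ v.intValuation c ≤ γ v := by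
    obtain ⟨ϖ, hϖ⟩ := v.intValuation_exists_uniformizer
    have hϖ0 : ϖ ≠ 0 := by
      rintro rfl
      simp at hϖ
      exact absurd hϖ.symm WithZero.exp_ne_zero
    refine ⟨ϖ ^ (WithZero.log (γ v)).natAbs, pow_ne_zero _ hϖ0, ?_⟩
    rw [map_pow, hϖ, ← WithZero.exp_nsmul, ← WithZero.exp_log (h0 v), WithZero.exp_le_exp]
    simp only [WithZero.log_exp, nsmul_eq_mul]
    omega
  choose c hc0 hc using this
  refine ⟨∏ v ∈ h1.toFinset, c v, Finset.prod_ne_zero_iff.2 fun v _ => hc0 v, fun v => ?_⟩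
  by_cases hv : γ v < 1
  · rw [← Finset.mul_prod_erase _ _ (h1.mem_toFinset.2 hv), map_mul]
    calc _ ≤ v.intValuation (c v) * 1 := by
          gcongr
          exact v.intValuation_le_one _
      _ ≤ _ := by rw [mul_one]; exact hc v
  · exact (v.intValuation_le_one _).trans (not_lt.1 hv)

end Lattices

/-! ### Lattices in $B_v$ as submodules between two coordinate boxes. -/

section Box

open HeightOneSpectrum Module
open scoped WithZero

variable {A : Type*} [CommRing A] [IsDedekindDomain A] {k : Type*} [Field k] [Algebra A k]
  [IsFractionRing A k] {B : Type*} [Ring B] [Algebra k B] {ι : Type*}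

theorem valued_smul_le (v : HeightOneSpectrum A) (a : v.adicCompletionIntegers k)
    (x : v.adicCompletion k) : Valued.v ((a : v.adicCompletion k) * x) ≤ Valued.v x := by
  rw [map_mul]
  exact mul_le_of_le_one_left' a.2

/-- The elements of `B_v` all of whose coordinates have valuation at most `γ`. -/
def box (v : HeightOneSpectrum A) (b : Basis ι k B) (γ : ℤᵐ⁰) :
    Submodule (v.adicCompletionIntegers k) (LocalAlg k v B) where
  carrier := {y | ∀ i, Valued.v ((Algebra.TensorProduct.basis (v.adicCompletion k) b).repr y i) ≤ γ}
  add_mem' hx hy i := by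
    rw [map_add, Finsupp.add_apply]
    exact Valuation.map_add_le _ (hx i) (hy i)
  zero_mem' i := by simp
  smul_mem' a x hx i := by
    have : a • x = (a : v.adicCompletion k) • x := rfl
    rw [this, map_smul, Finsupp.smul_apply, smul_eq_mul]
    exact (valued_smul_le v a _).trans (hx i)

variable (v : HeightOneSpectrum A) (b : Basis ι k B)

theorem mem_box {γ : ℤᵐ⁰} {y : LocalAlg k v B} : y ∈ box v b γ ↔
    ∀ i, Valued.v ((Algebra.TensorProduct.basis (v.adicCompletion k) b).repr y i) ≤ γ := Iff.rfl

theorem one_tmul_mem_box {γ : ℤᵐ⁰} {x : B} :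
    (1 ⊗ₜ[k] x : LocalAlg k v B) ∈ box v b γ ↔ ∀ i, v.valuation k (b.repr x i) ≤ γ := by
  simp [mem_box, Algebra.TensorProduct.basis_repr_tmul, ← valued_algebraMap]

theorem box_mono {γ γ' : ℤᵐ⁰} (h : γ ≤ γ') : box v b γ ≤ box v b γ' :=
  fun _ hy i => (hy i).trans h

theorem smul_mem_box {γ : ℤᵐ⁰} {y : LocalAlg k v B} (a : v.adicCompletion k) (hy : y ∈ box v b γ) :
    a • y ∈ box v b (Valued.v a * γ) := fun i => by
  rw [map_smul, Finsupp.smul_apply, smul_eq_mul, map_mul]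
  exact mul_le_mul_right (hy i) _

variable [Finite ι]

theorem exists_mem_box (y : LocalAlg k v B) : ∃ γ : ℤᵐ⁰, γ ≠ 0 ∧ y ∈ box v b γ := by
  cases nonempty_fintype ι
  let c := fun i => Valued.v ((Algebra.TensorProduct.basis (v.adicCompletion k) b).repr y i)
  refine ⟨Finset.univ.sup c ⊔ 1, ?_, fun i => ?_⟩
  · exact (lt_of_lt_of_le zero_lt_one le_sup_right).ne'
  · exact le_sup_of_le_left (Finset.le_sup (f := c) (Finset.mem_univ i))

theorem exists_le_box {N : Submodule (v.adicCompletionIntegers k) (LocalAlg k v B)} (hN : N.FG) :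
    ∃ γ : ℤᵐ⁰, γ ≠ 0 ∧ N ≤ box v b γ := by
  obtain ⟨s, rfl⟩ := hN
  choose γ h0 h using exists_mem_box v b
  refine ⟨s.sup γ ⊔ 1, (lt_of_lt_of_le zero_lt_one le_sup_right).ne', ?_⟩
  rw [Submodule.span_le]
  intro y hy
  exact box_mono v b (le_sup_of_le_left (Finset.le_sup hy)) (h y)

theorem mk_smul_eq {V : Type*} [AddCommGroup V] [Module (v.adicCompletion k) V]
    [Module (v.adicCompletionIntegers k) V]
    [IsScalarTower (v.adicCompletionIntegers k) (v.adicCompletion k) V] {x : v.adicCompletion k}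
    (hx : x ∈ v.adicCompletionIntegers k) (y : V) :
    (⟨x, hx⟩ : v.adicCompletionIntegers k) • y = x • y :=
  (algebraMap_smul (v.adicCompletion k) (⟨x, hx⟩ : v.adicCompletionIntegers k) y).symm

theorem exists_smul_mem_of_mem_span {A k V : Type*} [CommRing A] [IsDomain A] [Field k]
    [Algebra A k] [IsFractionRing A k] [AddCommGroup V] [Module k V] [Module A V]
    [IsScalarTower A k V] {N : Submodule A V} {y : V} (hy : y ∈ Submodule.span k (N : Set V)) :
    ∃ a : A, a ≠ 0 ∧ a • y ∈ N := by
  induction hy using Submodule.span_induction with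
  | mem x hx => exact ⟨1, one_ne_zero, by simpa using hx⟩
  | zero => exact ⟨1, one_ne_zero, by simp⟩
  | add x y _ _ hx hy =>
    obtain ⟨a, ha, hax⟩ := hx
    obtain ⟨c, hc, hcy⟩ := hy
    refine ⟨a * c, mul_ne_zero ha hc, ?_⟩
    rw [smul_add]
    refine N.add_mem ?_ ?_
    · rw [mul_comm, mul_smul]; exact N.smul_mem _ hax
    · rw [mul_smul]; exact N.smul_mem _ hcy
  | smul t x _ hx =>
    obtain ⟨a, ha, hax⟩ := hx
    obtain ⟨p, s, hs, rfl⟩ := IsFractionRing.div_surjective (A := A) t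
    have hs0 := nonZeroDivisors.ne_zero hs
    refine ⟨s * a, mul_ne_zero hs0 ha, ?_⟩
    have : (s * a) • (algebraMap A k p / algebraMap A k s) • x = p • a • x := by
      have hs1 : algebraMap A k s ≠ 0 := by simpa using hs0
      rw [← algebraMap_smul k (s * a), ← algebraMap_smul k p, ← algebraMap_smul k a, smul_smul,
        smul_smul, map_mul]
      congr 1
      field_simp
    rw [this]
    exact N.smul_mem _ hax

theorem exists_smul_mem_of_span_eq_top {V : Type*} [AddCommGroup V] [Module (v.adicCompletion k) V]
    [Module (v.adicCompletionIntegers k) V]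
    [IsScalarTower (v.adicCompletionIntegers k) (v.adicCompletion k) V]
    {N : Submodule (v.adicCompletionIntegers k) V}
    (hN : Submodule.span (v.adicCompletion k) (N : Set V) = ⊤) (y : V) :
    ∃ a : v.adicCompletion k, a ≠ 0 ∧ a • y ∈ N := by
  obtain ⟨a, ha, h⟩ := exists_smul_mem_of_mem_span (A := v.adicCompletionIntegers k)
    (hN ▸ Submodule.mem_top : y ∈ Submodule.span (v.adicCompletion k) (N : Set V))
  refine ⟨a, by simpa using ha, ?_⟩
  rwa [← algebraMap_smul (v.adicCompletion k) a y] at h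

theorem exists_box_le {N : Submodule (v.adicCompletionIntegers k) (LocalAlg k v B)}
    (hN : Submodule.span (v.adicCompletion k) (N : Set (LocalAlg k v B)) = ⊤) :
    ∃ γ : ℤᵐ⁰, γ ≠ 0 ∧ box v b γ ≤ N := by
  cases nonempty_fintype ι
  let bv := Algebra.TensorProduct.basis (v.adicCompletion k) b
  choose a ha0 ha using fun i => exists_smul_mem_of_span_eq_top v hN (bv i)
  obtain ⟨γ, hγ0, hγ⟩ : ∃ γ : ℤᵐ⁰, γ ≠ 0 ∧ ∀ i, γ ≤ Valued.v (a i) := by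
    rcases isEmpty_or_nonempty ι with h | h
    · exact ⟨1, one_ne_zero, fun i => h.elim i⟩
    · refine ⟨Finset.univ.inf' Finset.univ_nonempty fun i => Valued.v (a i), ?_, fun i =>
        Finset.inf'_le _ (Finset.mem_univ i)⟩
      obtain ⟨i, -, hi⟩ := Finset.exists_mem_eq_inf' Finset.univ_nonempty fun i => Valued.v (a i)
      rw [hi]
      simpa using ha0 i
  refine ⟨γ, hγ0, fun y hy => ?_⟩
  rw [← bv.sum_repr y]
  refine N.sum_mem fun i _ => ?_
  have h1 : bv.repr y i / a i ∈ v.adicCompletionIntegers k := by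
    rw [mem_adicCompletionIntegers, map_div₀]
    exact div_le_one_of_le₀ ((hy i).trans (hγ i)) zero_le
  have h2 : bv.repr y i • bv i = (⟨_, h1⟩ : v.adicCompletionIntegers k) • a i • bv i := by
    rw [mk_smul_eq, smul_smul, div_mul_cancel₀ _ (ha0 i)]
  rw [h2]
  exact N.smul_mem _ (ha i)

/-- The outer box is contained in a finitely generated module over the noetherian ring $\mathcal
O_v$, which bounds `N` above; the inner box contains a multiple of each basis vector, which makes
`N` span. -/
theorem isLattice_of_box_le {N : Submodule (v.adicCompletionIntegers k) (LocalAlg k v B)}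
    {γ γ' : ℤᵐ⁰} (hγ0 : γ ≠ 0) (hγ : box v b γ ≤ N) (hγ' : N ≤ box v b γ') :
    N.IsLattice (v.adicCompletion k) := by
  cases nonempty_fintype ι
  classical
  let bv := Algebra.TensorProduct.basis (v.adicCompletion k) b
  constructor
  · obtain ⟨a, ha⟩ := valuedAdicCompletion_surjective k v (γ' ⊔ 1)
    have ha0 : a ≠ 0 := by
      rintro rfl
      rw [map_zero] at ha
      exact (lt_of_lt_of_le zero_lt_one (le_sup_right (a := γ'))).ne ha
    let M := Submodule.span (v.adicCompletionIntegers k) (Set.range fun i => a • bv i)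
    have hM : box v b γ' ≤ M := by
      intro y hy
      rw [← bv.sum_repr y]
      refine M.sum_mem fun i _ => ?_
      have h1 : bv.repr y i / a ∈ v.adicCompletionIntegers k := by
        rw [mem_adicCompletionIntegers, map_div₀, ha]
        exact div_le_one_of_le₀ ((hy i).trans le_sup_left) zero_le
      have h2 : bv.repr y i • bv i = (⟨_, h1⟩ : v.adicCompletionIntegers k) • a • bv i := by
        rw [mk_smul_eq, smul_smul, div_mul_cancel₀ _ ha0]
      rw [h2]
      exact M.smul_mem _ (Submodule.subset_span ⟨i, rfl⟩)
    have : IsNoetherian (v.adicCompletionIntegers k) M :=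
      isNoetherian_of_fg_of_noetherian _ (Submodule.fg_span (Set.finite_range _))
    exact isNoetherian_submodule.1 this N (hγ'.trans hM)
  · rw [eq_top_iff, ← bv.span_eq, Submodule.span_le]
    rintro _ ⟨i, rfl⟩
    obtain ⟨a, ha⟩ := valuedAdicCompletion_surjective k v γ
    have ha0 : a ≠ 0 := by
      rintro rfl
      rw [map_zero] at ha
      exact hγ0 ha.symm
    have h1 : a • bv i ∈ N := hγ fun j => by
      simp only [map_smul, Finsupp.smul_apply, smul_eq_mul, map_mul]
      rw [show (Algebra.TensorProduct.basis (v.adicCompletion k) b).repr (bv i) j =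
        Finsupp.single i 1 j from DFunLike.congr_fun (bv.repr_self i) j, ha, Finsupp.single_apply]
      split_ifs <;> simp
    have h2 : bv i = a⁻¹ • a • bv i := by rw [smul_smul, inv_mul_cancel₀ ha0, one_smul]
    rw [h2]
    exact Submodule.smul_mem _ _ (Submodule.subset_span h1)

theorem isLattice_iff_box {N : Submodule (v.adicCompletionIntegers k) (LocalAlg k v B)} :
    N.IsLattice (v.adicCompletion k) ↔
      ∃ γ γ' : ℤᵐ⁰, γ ≠ 0 ∧ γ' ≠ 0 ∧ box v b γ ≤ N ∧ N ≤ box v b γ' := by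
  constructor
  · intro h
    obtain ⟨γ, h0, h1⟩ := exists_box_le v b h.span_eq_top
    obtain ⟨γ', h0', h1'⟩ := exists_le_box v b h.fg
    exact ⟨γ, γ', h0, h0', h1, h1'⟩
  · rintro ⟨γ, γ', h0, -, h1, h2⟩
    exact isLattice_of_box_le v b h0 h1 h2

end Box

/-! ### The correspondence between lattices in $B$ and families of local lattices. -/

section LocalGlobal

open HeightOneSpectrum Module
open scoped WithZero

variable {A : Type*} [CommRing A] [IsDedekindDomain A] {k : Type*} [Field k] [Algebra A k]
  [IsFractionRing A k] {B : Type*} [Ring B] [Algebra k B] [Algebra A B]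

/-- The `O_v`-submodule of `B_v` generated by an `A`-submodule of `B`. -/
def locSpan (v : HeightOneSpectrum A) (M : Submodule A B) :
    Submodule (v.adicCompletionIntegers k) (LocalAlg k v B) :=
  Submodule.span _ ((fun x : B => (1 ⊗ₜ[k] x : LocalAlg k v B)) '' (M : Set B))

theorem tmul_mem_locSpan (v : HeightOneSpectrum A) {M : Submodule A B} {x : B} (hx : x ∈ M) :
    (1 ⊗ₜ[k] x : LocalAlg k v B) ∈ locSpan v M := Submodule.subset_span ⟨x, hx, rfl⟩

theorem locSpan_mono (v : HeightOneSpectrum A) {M M' : Submodule A B} (h : M ≤ M') :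
    (locSpan v M : Submodule _ (LocalAlg k v B)) ≤ locSpan v M' :=
  Submodule.span_mono (Set.image_mono h)

/-- The image of `S` is already closed under multiplication, so the generated algebra is just the
span. -/
theorem toSubmodule_localOrder (v : HeightOneSpectrum A) (S : Subalgebra A B) :
    Subalgebra.toSubmodule (localOrder (k := k) v S) = locSpan v (Subalgebra.toSubmodule S) := by
  rw [localOrder, Algebra.adjoin_eq_span]
  have h : (Submonoid.closure ((Algebra.TensorProduct.includeRight : B →ₐ[k] LocalAlg k v B) ''
      (S : Set B)) : Set (LocalAlg k v B)) = (fun x : B => (1 ⊗ₜ[k] x : LocalAlg k v B)) '' S := by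
    have : ((Algebra.TensorProduct.includeRight : B →ₐ[k] LocalAlg k v B) '' (S : Set B)) =
        (S.toSubmonoid.map
          (Algebra.TensorProduct.includeRight : B →ₐ[k] LocalAlg k v B) : Set (LocalAlg k v B)) := rfl
    rw [this, Submonoid.closure_eq]
    rfl
  rw [h]
  rfl

theorem mem_localOrder_iff (v : HeightOneSpectrum A) (S : Subalgebra A B) (x : LocalAlg k v B) :
    x ∈ localOrder v S ↔ x ∈ locSpan v (Subalgebra.toSubmodule S) := by
  rw [← toSubmodule_localOrder, Subalgebra.mem_toSubmodule]

theorem one_tmul_smul [IsScalarTower A k B] (v : HeightOneSpectrum A) (a : A) (x : B) :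
    (1 ⊗ₜ[k] (a • x) : LocalAlg k v B) =
      algebraMap A (v.adicCompletionIntegers k) a • (1 ⊗ₜ[k] x : LocalAlg k v B) := by
  rw [← algebraMap_smul k a x, TensorProduct.tmul_smul, TensorProduct.smul_tmul',
    TensorProduct.smul_tmul']
  congr 1
  rw [Algebra.smul_def, Algebra.smul_def]
  rfl

/-- The elements of `B` that are locally in all the `N v`. -/
def globLat [IsScalarTower A k B]
    (N : ∀ v : HeightOneSpectrum A, Submodule (v.adicCompletionIntegers k) (LocalAlg k v B)) :
    Submodule A B where
  carrier := {x | ∀ v, (1 ⊗ₜ[k] x : LocalAlg k v B) ∈ N v}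
  add_mem' hx hy v := by
    rw [TensorProduct.tmul_add]
    exact (N v).add_mem (hx v) (hy v)
  zero_mem' v := by
    rw [TensorProduct.tmul_zero]
    exact (N v).zero_mem
  smul_mem' a x hx v := by
    rw [one_tmul_smul]
    exact (N v).smul_mem _ (hx v)

variable [IsScalarTower A k B]

theorem mem_globLat
    {N : ∀ v : HeightOneSpectrum A, Submodule (v.adicCompletionIntegers k) (LocalAlg k v B)}
    {x : B} : x ∈ globLat N ↔ ∀ v, (1 ⊗ₜ[k] x : LocalAlg k v B) ∈ N v := Iff.rfl

variable {ι : Type*} [Finite ι] (b : Basis ι k B)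

theorem exists_smul_mem_of_isLattice (M : Submodule A B) [M.IsLattice k] (x : B) :
    ∃ a : A, a ≠ 0 ∧ a • x ∈ M :=
  exists_smul_mem_of_mem_span (k := k)
    (Submodule.IsLattice.span_eq_top (A := k) (M := M) ▸ Submodule.mem_top)

theorem exists_common_smul_mem (M : Submodule A B) [M.IsLattice k] :
    ∃ a : A, a ≠ 0 ∧ ∀ i, a • b i ∈ M := by
  cases nonempty_fintype ι
  choose a h0 h using fun i => exists_smul_mem_of_isLattice (k := k) M (b i)
  classical
  refine ⟨∏ i, a i, Finset.prod_ne_zero_iff.2 fun i _ => h0 i, fun i => ?_⟩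
  rw [← Finset.prod_erase_mul _ _ (Finset.mem_univ i), mul_smul]
  exact M.smul_mem _ (h i)

theorem exists_common_denominator (M : Submodule A B) (hM : M.FG) :
    ∃ d : A, d ≠ 0 ∧ ∀ x ∈ M, ∀ i, ∃ a : A, algebraMap A k d * b.repr x i = algebraMap A k a := by
  cases nonempty_fintype ι
  obtain ⟨s, rfl⟩ := hM
  obtain ⟨d, hd⟩ := IsLocalization.exist_integer_multiples (nonZeroDivisors A)
    (s ×ˢ (Finset.univ : Finset ι)) (fun p => b.repr p.1 p.2)
  refine ⟨d, nonZeroDivisors.ne_zero d.2, fun x hx i => ?_⟩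
  induction hx using Submodule.span_induction with
  | mem x hx =>
    obtain ⟨a, ha⟩ := hd (x, i) (Finset.mem_product.2 ⟨hx, Finset.mem_univ i⟩)
    refine ⟨a, ?_⟩
    rw [ha, Algebra.smul_def]
  | zero => exact ⟨0, by simp⟩
  | add x y _ _ hx hy =>
    obtain ⟨a, ha⟩ := hx
    obtain ⟨c, hc⟩ := hy
    exact ⟨a + c, by simp [mul_add, ha, hc]⟩
  | smul t x _ hx =>
    obtain ⟨a, ha⟩ := hx
    refine ⟨t * a, ?_⟩
    rw [← algebraMap_smul k t x, map_smul, Finsupp.smul_apply, smul_eq_mul, mul_left_comm, ha,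
      map_mul]

/-- The point is uniformity: one global `c` gives the inner radius at every place, so this radius is
$1$ at almost all of them. `locSpan_le_box` is the matching outer bound. -/
theorem box_le_locSpan {M : Submodule A B} {c : A} (hc0 : c ≠ 0) (hc : ∀ i, c • b i ∈ M)
    (v : HeightOneSpectrum A) :
    box v b (v.intValuation c) ≤ locSpan v M := by
  cases nonempty_fintype ι
  intro y hy
  let bv := Algebra.TensorProduct.basis (v.adicCompletion k) b
  let c' := algebraMap k (v.adicCompletion k) (algebraMap A k c)
  have hc' : c' ≠ 0 := by simpa [c'] using hc0
  have hvc : Valued.v c' = v.intValuation c := by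
    rw [valued_algebraMap, valuation_of_algebraMap]
  rw [← bv.sum_repr y]
  refine Submodule.sum_mem _ fun i _ => ?_
  have h1 : bv.repr y i / c' ∈ v.adicCompletionIntegers k := by
    rw [mem_adicCompletionIntegers, map_div₀, hvc]
    exact div_le_one_of_le₀ (hy i) zero_le
  have h2 : bv.repr y i • bv i =
      (⟨_, h1⟩ : v.adicCompletionIntegers k) • (1 ⊗ₜ[k] (c • b i) : LocalAlg k v B) := by
    have h3 : (1 ⊗ₜ[k] (c • b i) : LocalAlg k v B) = c' • bv i := by
      rw [one_tmul_smul, Algebra.TensorProduct.basis_apply]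
      exact mk_smul_eq v _ _
    rw [h3, mk_smul_eq, smul_smul, div_mul_cancel₀ _ hc']
  rw [h2]
  exact Submodule.smul_mem _ _ (tmul_mem_locSpan v (hc i))

theorem locSpan_le_box {M : Submodule A B} {d : A} (hd0 : d ≠ 0)
    (hd : ∀ x ∈ M, ∀ i, ∃ a : A, algebraMap A k d * b.repr x i = algebraMap A k a)
    (v : HeightOneSpectrum A) :
    locSpan v M ≤ box v b (v.intValuation d)⁻¹ := by
  rw [locSpan, Submodule.span_le]
  rintro _ ⟨x, hx, rfl⟩
  refine (one_tmul_mem_box v b).2 fun i => ?_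
  obtain ⟨a, ha⟩ := hd x hx i
  have h := congrArg (v.valuation k) ha
  rw [map_mul, valuation_of_algebraMap, valuation_of_algebraMap] at h
  have hdv := v.intValuation_ne_zero d hd0
  rw [← inv_mul_cancel_left₀ hdv (v.valuation k (b.repr x i)), h]
  exact mul_le_of_le_one_right zero_le (v.intValuation_le_one a)

theorem isLattice_locSpan [FiniteDimensional k B] (v : HeightOneSpectrum A) (M : Submodule A B)
    [M.IsLattice k] :
    (locSpan v M : Submodule _ (LocalAlg k v B)).IsLattice (v.adicCompletion k) := by
  let b := Module.finBasis k B
  obtain ⟨c, hc0, hc⟩ := exists_common_smul_mem b M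
  obtain ⟨d, hd0, hd⟩ := exists_common_denominator b M Submodule.IsLattice.fg
  exact isLattice_of_box_le v b (v.intValuation_ne_zero c hc0) (box_le_locSpan b hc0 hc v)
    (locSpan_le_box b hd0 hd v)

theorem finite_locSpan_ne_box (M : Submodule A B) [M.IsLattice k] :
    {v : HeightOneSpectrum A | locSpan v M ≠ box v b 1}.Finite := by
  obtain ⟨c, hc0, hc⟩ := exists_common_smul_mem b M
  obtain ⟨d, hd0, hd⟩ := exists_common_denominator b M Submodule.IsLattice.fg
  refine ((finite_valuation_ne_one hc0).union (finite_valuation_ne_one hd0)).subset fun v hv => ?_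
  by_contra h
  simp only [Set.mem_union, Set.mem_ofPred_eq, not_or, not_not] at h
  have h1 := box_le_locSpan b hc0 hc v
  have h2 := locSpan_le_box b hd0 hd v
  rw [h.1] at h1
  rw [h.2, inv_one] at h2
  exact hv (le_antisymm h2 h1)

theorem exists_approx_box (v : HeightOneSpectrum A) (y : LocalAlg k v B) {c : A} (hc : c ≠ 0) :
    ∃ x : B, y - 1 ⊗ₜ x ∈ box v b (v.intValuation c) ∧
      ∀ w, w ≠ v → (1 ⊗ₜ[k] x : LocalAlg k w B) ∈ box w b (w.intValuation c) := by
  cases nonempty_fintype ι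
  choose x hx1 hx2 using fun i => exists_approx v
    ((Algebra.TensorProduct.basis (v.adicCompletion k) b).repr y i) hc
  have hr : ⇑(b.repr (∑ i, x i • b i)) = x := b.repr_sum_self x
  refine ⟨∑ i, x i • b i, fun i => ?_, fun w hw => ?_⟩
  · rw [map_sub, Finsupp.sub_apply, Algebra.TensorProduct.basis_repr_tmul, one_smul,
      Finsupp.mapRange_apply, hr]
    exact hx1 i
  · rw [one_tmul_mem_box, hr]
    exact fun i => hx2 i w hw

/-- A family of local lattices, almost all standard, comes from a global lattice. -/
theorem globLat_spec
    (N : ∀ v : HeightOneSpectrum A, Submodule (v.adicCompletionIntegers k) (LocalAlg k v B))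
    (hN : ∀ v, (N v).IsLattice (v.adicCompletion k)) (hfin : {v | N v ≠ box v b 1}.Finite) :
    (globLat N).IsLattice k ∧ ∀ v, locSpan v (globLat N) = N v := by
  classical
  choose γ γ' h0 h0' h1 h1' using fun v => (isLattice_iff_box v b).1 (hN v)
  -- Only finitely many `N v` differ from the box of radius one, so a single element of $A$ bounds
  -- all inner radii. The element `d` does the same for the outer radii.
  obtain ⟨c, hc0, hc⟩ : ∃ c : A, c ≠ 0 ∧ ∀ v, box v b (v.intValuation c) ≤ N v := by
    obtain ⟨c, hc0, hc⟩ := exists_forall_intValuation_le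
      (fun v => if N v = box v b 1 then 1 else γ v)
      (fun v => by split_ifs <;> simp [h0 v])
      (hfin.subset fun v hv => by
        intro h
        simp [h] at hv)
    refine ⟨c, hc0, fun v => ?_⟩
    have := hc v
    split_ifs at this with h
    · rw [h]; exact box_mono v b this
    · exact (box_mono v b this).trans (h1 v)
  obtain ⟨d, hd0, hd⟩ : ∃ d : A, d ≠ 0 ∧ ∀ v, N v ≤ box v b (v.intValuation d)⁻¹ := by
    obtain ⟨d, hd0, hd⟩ := exists_forall_intValuation_le
      (fun v => if N v = box v b 1 then 1 else (γ' v)⁻¹)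
      (fun v => by split_ifs <;> simp [h0' v])
      (hfin.subset fun v hv => by
        intro h
        simp [h] at hv)
    refine ⟨d, hd0, fun v => ?_⟩
    have := hd v
    have hdv := v.intValuation_ne_zero d hd0
    split_ifs at this with h
    · rw [h]; exact box_mono v b (by rwa [le_inv_comm₀ zero_lt_one (zero_lt_iff.2 hdv), inv_one])
    · exact (h1' v).trans (box_mono v b (by
        rwa [le_inv_comm₀ (zero_lt_iff.2 (h0' v)) (zero_lt_iff.2 hdv)]))
  have hcb (i : ι) : c • b i ∈ globLat N := fun v => hc v <| by
    rw [one_tmul_mem_box, ← algebraMap_smul k c]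
    intro j
    simp only [map_smul, Basis.repr_self, Finsupp.smul_apply, smul_eq_mul, map_mul,
      valuation_of_algebraMap, Finsupp.single_apply]
    split_ifs <;> simp
  refine ⟨⟨?_, ?_⟩, fun v => le_antisymm ?_ fun y hy => ?_⟩
  · cases nonempty_fintype ι
    have hd1 : algebraMap A k d ≠ 0 := by simpa using hd0
    -- By the outer bound, `d` clears the denominators of all coordinates at all places at once, so
    -- the global lattice lies in this finitely generated module.
    let M := Submodule.span A (Set.range fun i => (algebraMap A k d)⁻¹ • b i)
    have hM : globLat N ≤ M := by
      intro x hx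
      have h1 (i : ι) : ∃ a : A, algebraMap A k a = algebraMap A k d * b.repr x i := by
        refine mem_integers_of_valuation_le_one k _ fun v => ?_
        have h2 := (one_tmul_mem_box v b).1 (hd v (hx v)) i
        rw [map_mul, valuation_of_algebraMap]
        exact (mul_le_mul_right h2 _).trans_eq (mul_inv_cancel₀ (v.intValuation_ne_zero d hd0))
      rw [← b.sum_repr x]
      refine M.sum_mem fun i _ => ?_
      obtain ⟨a, ha⟩ := h1 i
      have h3 : b.repr x i • b i = a • (algebraMap A k d)⁻¹ • b i := by
        rw [← algebraMap_smul k a, smul_smul, ha, mul_right_comm, mul_inv_cancel₀ hd1, one_mul]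
      rw [h3]
      exact M.smul_mem _ (Submodule.subset_span ⟨i, rfl⟩)
    have : IsNoetherian A M :=
      isNoetherian_of_fg_of_noetherian _ (Submodule.fg_span (Set.finite_range _))
    exact isNoetherian_submodule.1 this _ hM
  · rw [eq_top_iff, ← b.span_eq, Submodule.span_le]
    rintro _ ⟨i, rfl⟩
    have hc1 : algebraMap A k c ≠ 0 := by simpa using hc0
    have h2 : b i = (algebraMap A k c)⁻¹ • c • b i := by
      rw [← algebraMap_smul k c, smul_smul, inv_mul_cancel₀ hc1, one_smul]
    rw [h2]
    exact Submodule.smul_mem _ _ (Submodule.subset_span (hcb i))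
  · rw [locSpan, Submodule.span_le]
    rintro _ ⟨x, hx, rfl⟩
    exact hx v
  -- The approximation errs by the inner box at $v$ and is itself in the inner box at every other
  -- place, so `x` belongs to all the `N w`.
  · obtain ⟨x, hx1, hx2⟩ := exists_approx_box b v y hc0
    have hx : x ∈ globLat N := fun w => by
      by_cases hw : w = v
      · subst hw
        have := (N w).sub_mem hy (hc w hx1)
        rwa [sub_sub_cancel] at this
      · exact hc w (hx2 w hw)
    rw [← sub_add_cancel y (1 ⊗ₜ x)]
    exact Submodule.add_mem _ (box_le_locSpan b hc0 hcb v hx1) (tmul_mem_locSpan v hx)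

/-- Elements of `M_v` are approximated by elements of `M`. -/
theorem exists_sub_mem_box_of_mem_locSpan (v : HeightOneSpectrum A) (M : Submodule A B)
    {y : LocalAlg k v B} (hy : y ∈ locSpan v M) {γ : ℤᵐ⁰} (hγ : γ ≠ 0) :
    ∃ x ∈ M, y - 1 ⊗ₜ x ∈ box v b γ := by
  induction hy using Submodule.span_induction with
  | mem y hy =>
    obtain ⟨x, hx, rfl⟩ := hy
    exact ⟨x, hx, by simp⟩
  | zero => exact ⟨0, M.zero_mem, by simp⟩
  | add y z _ _ hy hz =>
    obtain ⟨x, hx, h⟩ := hy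
    obtain ⟨x', hx', h'⟩ := hz
    refine ⟨x + x', M.add_mem hx hx', ?_⟩
    rw [TensorProduct.tmul_add, add_sub_add_comm]
    exact Submodule.add_mem _ h h'
  | smul t y _ hy =>
    obtain ⟨x, hx, h⟩ := hy
    -- An error `γ / δ` in the scalar is multiplied by `x`, of size `δ`, and stays within `γ`.
    obtain ⟨δ, hδ0, hδ⟩ := exists_mem_box v b (1 ⊗ₜ x)
    obtain ⟨a, ha⟩ := exists_valued_sub_algebraMap_algebraMap_lt v t.2
      (γ := γ / δ) (div_ne_zero hγ hδ0)
    refine ⟨a • x, M.smul_mem _ hx, ?_⟩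
    have : t • y - 1 ⊗ₜ (a • x) =
        t • (y - 1 ⊗ₜ x) + (t - algebraMap A (v.adicCompletionIntegers k) a) • (1 ⊗ₜ x) := by
      rw [one_tmul_smul, smul_sub, sub_smul]
      abel
    rw [this]
    refine Submodule.add_mem _ (Submodule.smul_mem _ _ h) ?_
    refine box_mono v b ?_ (smul_mem_box v b (Subtype.val
      (t - algebraMap A (v.adicCompletionIntegers k) a)) hδ)
    rw [← le_div_iff₀ (zero_lt_iff.2 hδ0)]
    exact ha.le

/-- A lattice is determined by its localisations. -/
theorem globLat_locSpan [FiniteDimensional k B] (M : Submodule A B) [M.IsLattice k] :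
    globLat (fun v => locSpan (k := k) v M) = M := by
  refine le_antisymm (fun x hx => ?_) fun x hx v => tmul_mem_locSpan v hx
  let b := Module.finBasis k B
  obtain ⟨c, hc0, hc⟩ := exists_common_smul_mem b M
  -- The ideal of all $a$ with $ax\in M$ is contained in no maximal ideal $p$: approximate $x$ at
  -- $p$ by some $y\in M$ so closely that the coordinates of $x-y$ lie in $cA_p$, then multiply by
  -- denominators outside $p$.
  let I : Ideal A := M.comap (LinearMap.toSpanSingleton A B x)
  suffices h : I = ⊤ by
    have : (1 : A) ∈ I := h ▸ Submodule.mem_top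
    simpa [I] using this
  by_contra hI
  obtain ⟨p, hp, hIp⟩ := Ideal.exists_le_maximal I hI
  have hp0 : p ≠ ⊥ := by
    obtain ⟨a, ha0, ha⟩ := exists_smul_mem_of_isLattice (k := k) M x
    exact fun h => ha0 (by simpa [h] using hIp ha)
  let v : HeightOneSpectrum A := ⟨p, hp.isPrime, hp0⟩
  obtain ⟨y, hy, hxy⟩ := exists_sub_mem_box_of_mem_locSpan b v M (hx v)
    (v.intValuation_ne_zero c hc0)
  rw [← TensorProduct.tmul_sub, one_tmul_mem_box] at hxy
  have hc1 : algebraMap A k c ≠ 0 := by simpa using hc0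
  have key (i) : ∃ s ∉ p, ∃ a : A, algebraMap A k s * b.repr (x - y) i = algebraMap A k (a * c) := by
    have h1 : v.valuation k (b.repr (x - y) i / algebraMap A k c) ≤ 1 := by
      rw [map_div₀, valuation_of_algebraMap]
      exact div_le_one_of_le₀ (hxy i) zero_le
    obtain ⟨n, d, hd⟩ := v.exists_primeCompl_mul_eq_of_integer _ h1
    refine ⟨d, d.2, n, ?_⟩
    rw [map_mul, ← hd]
    field_simp
  choose s hs a ha using key
  have hsx : (∏ i, s i) • x ∈ M := by
    rw [← sub_add_cancel x y, smul_add]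
    refine M.add_mem ?_ (M.smul_mem _ hy)
    rw [← b.sum_repr (x - y), Finset.smul_sum]
    refine M.sum_mem fun i _ => ?_
    rw [← Finset.prod_erase_mul _ _ (Finset.mem_univ i), mul_smul]
    refine M.smul_mem _ ?_
    rw [← algebraMap_smul k (s i), smul_smul, ha, algebraMap_smul, mul_smul]
    exact M.smul_mem _ (hc i)
  have hsI : (∏ i, s i) ∈ I := hsx
  obtain ⟨i, -, hi⟩ := hp.isPrime.prod_mem_iff.1 (hIp hsI)
  exact hs i hi

end LocalGlobal

/-! ### Jordan–Zassenhaus for lattices over $R$ in $K$. -/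

section JordanZassenhaus

open Module
open scoped Polynomial nonZeroDivisors

/-- Up to the factor `m`, every ideal is principal. -/
theorem exists_forall_dvd_mul {F S : Type*} [Field F] [Finite F] [CommRing S] [IsDomain S]
    [Algebra F[X] S] [Module.Finite F[X] S] (hinj : Function.Injective (algebraMap F[X] S)) :
    ∃ m : S, m ≠ 0 ∧ ∀ I : Ideal S, I ≠ ⊥ → ∃ b ∈ I, b ≠ 0 ∧ ∀ a ∈ I, b ∣ m * a := by
  classical
  have := Fintype.ofFinite F
  have : FaithfulSMul F[X] S := (faithfulSMul_iff_algebraMap_injective _ _).2 hinj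
  let bS := Module.Free.chooseBasis F[X] S
  let adm := Polynomial.cardPowDegreeIsAdmissible (Fq := F)
  refine ⟨_, ClassGroup.prod_finsetApprox_ne_zero bS adm, fun I hI => ?_⟩
  -- Take $b\in I$ nonzero of least norm. For $a\in I$, some $r$ in a fixed finite set and some $q$
  -- make the norm of $ra-qb$ smaller than that of $b$, so $ra=qb$. The product of the finite set
  -- serves as `m`.
  obtain ⟨b, b_mem, b_ne_zero, b_min⟩ := ClassGroup.exists_min (R := F[X]) Polynomial.cardPowDegree
    (⟨I, mem_nonZeroDivisors_iff_ne_zero.2 hI⟩ : (Ideal S)⁰)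
  refine ⟨b, b_mem, b_ne_zero, fun a ha => ?_⟩
  obtain ⟨q, r, r_mem, lt⟩ := ClassGroup.exists_mem_finset_approx' bS adm a b_ne_zero
  apply @dvd_of_mul_left_dvd _ _ q
  simp only [Algebra.smul_def] at lt
  rw [← sub_eq_zero.mp
    (b_min _ (I.sub_mem (I.mul_mem_left _ ha) (I.mul_mem_left _ b_mem)) lt)]
  exact mul_dvd_mul_right (map_dvd _ (Finset.dvd_prod_of_mem _ r_mem)) _

/-- The translate `u M` of a submodule of an algebra by a unit. -/
def lmul {R B : Type*} [CommRing R] [Ring B] [Algebra R B] (u : Bˣ) (M : Submodule R B) :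
    Submodule R B := M.comap (LinearMap.mulLeft R (↑u⁻¹ : B))

section lmul

variable {R B : Type*} [CommRing R] [Ring B] [Algebra R B] {u : Bˣ} {M : Submodule R B}

theorem mem_lmul {x : B} : x ∈ lmul u M ↔ ↑u⁻¹ * x ∈ M := Iff.rfl

theorem mul_mem_lmul {x : B} : ↑u * x ∈ lmul u M ↔ x ∈ M := by
  rw [mem_lmul, Units.inv_mul_cancel_left]

theorem lmul_mul (u w : Bˣ) (M : Submodule R B) : lmul (u * w) M = lmul u (lmul w M) := by
  ext x
  simp [mem_lmul, mul_assoc]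

theorem lmul_one (M : Submodule R B) : lmul 1 M = M := by
  ext x
  simp [mem_lmul]

theorem lmul_eq_map (u : Bˣ) (M : Submodule R B) :
    lmul u M = M.map (LinearMap.mulLeft R (u : B)) := by
  ext x
  rw [mem_lmul, Submodule.mem_map]
  exact ⟨fun h => ⟨_, h, by simp⟩, fun ⟨y, hy, h⟩ => by simpa [← h] using hy⟩

theorem isLattice_lmul {F : Type*} [Field F] [Algebra R F] [Algebra F B] [IsScalarTower R F B]
    (u : Bˣ) (M : Submodule R B) (hM : M.IsLattice F) : (lmul u M).IsLattice F := by
  rw [lmul_eq_map]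
  refine ⟨hM.fg.map _, ?_⟩
  rw [Submodule.map_coe]
  have h : (LinearMap.mulLeft R (u : B)) '' (M : Set B) =
    (LinearMap.mulLeft F (u : B)) '' (M : Set B) := rfl
  rw [h, Submodule.span_image, hM.span_eq_top, Submodule.map_top, LinearMap.range_eq_top]
  exact fun y => ⟨↑u⁻¹ * y, by simp⟩

end lmul

/-- Such ideals are pulled back from the finite ring $S/(m)$. -/
theorem finite_ideals_mem {S : Type*} [CommRing S] [Ring.HasFiniteQuotients S] {m : S}
    (hm : m ≠ 0) : {J : Ideal S | m ∈ J}.Finite := by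
  have : Finite (S ⧸ Ideal.span {m}) :=
    Ring.HasFiniteQuotients.finiteQuotient (by simpa using hm)
  refine (Set.finite_range (Ideal.comap (Ideal.Quotient.mk (Ideal.span {m})))).subset
    fun J hJ => ?_
  refine ⟨J.map (Ideal.Quotient.mk (Ideal.span {m})), ?_⟩
  rw [Ideal.comap_map_of_surjective _ Ideal.Quotient.mk_surjective, ← RingHom.ker_eq_comap_bot,
    Ideal.mk_ker, sup_eq_left]
  simpa using hJ

variable {F A k K : Type*} [Field F] [Finite F] [CommRing A] [IsDedekindDomain A] [Field k]
  [Algebra A k] [IsFractionRing A k] [Field K] [Algebra k K] [Algebra A K] [IsScalarTower A k K]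

/-- The Jordan–Zassenhaus theorem for rank one lattices over an order of a function field. -/
theorem exists_finite_lattices {f : F[X] →+* A} (hfi : Function.Injective f) (hff : f.Finite)
    (R : Subalgebra A K) (hR : IsOrder k R) :
    ∃ T : Set (Submodule A K), T.Finite ∧ (∀ M ∈ T, M.IsLattice k) ∧
      ∀ M : Submodule A K, M.IsLattice k → (∀ x ∈ R, ∀ y ∈ M, x * y ∈ M) →
        ∃ u : Kˣ, ∃ M' ∈ T, M = lmul u M' := by
  have hAK : Function.Injective (algebraMap A K) := by
    rw [IsScalarTower.algebraMap_eq A k K]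
    exact (algebraMap k K).injective.comp (IsFractionRing.injective A k)
  have hAR : Function.Injective (algebraMap A R) := fun x y h => hAK (congrArg Subtype.val h)
  let : Algebra F[X] R := ((algebraMap A R).comp f).toAlgebra
  have hfin : Module.Finite A R := Module.Finite.iff_fg.2 hR.fg
  have hfg : ((algebraMap A R).comp f).Finite :=
    RingHom.Finite.comp (RingHom.finite_algebraMap.2 hfin) hff
  have : Module.Finite F[X] R := hfg
  have hinj : Function.Injective (algebraMap F[X] R) := hAR.comp hfi
  obtain ⟨m, hm0, hm⟩ := exists_forall_dvd_mul (F := F) (S := R) hinj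
  have : Ring.HasFiniteQuotients R := Ring.HasFiniteQuotients.of_module_finite (R := F[X]) R
  refine ⟨{M | M.IsLattice k} ∩ (fun J : Ideal R => Submodule.map
    (Subalgebra.toSubmodule R).subtype (J.restrictScalars A)) '' {J : Ideal R | m ∈ J},
    ((finite_ideals_mem hm0).image _).inter_of_right _, fun M hM => hM.1, fun M hM hMR => ?_⟩
  have hRl : (Subalgebra.toSubmodule R).IsLattice k := hR
  obtain ⟨a, ha0, ha⟩ : ∃ a : A, a ≠ 0 ∧ ∀ y ∈ M, a • y ∈ R := by
    obtain ⟨s, hs⟩ := hM.fg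
    choose a ha0 ha using fun y : K =>
      exists_smul_mem_of_isLattice (k := k) (Subalgebra.toSubmodule R) y
    classical
    refine ⟨∏ y ∈ s, a y, Finset.prod_ne_zero_iff.2 fun y _ => ha0 y, fun y hy => ?_⟩
    suffices M ≤ (Subalgebra.toSubmodule R).comap
      (LinearMap.lsmul A K (∏ y ∈ s, a y)) from this hy
    rw [← hs, Submodule.span_le]
    intro z hz
    change (∏ y ∈ s, a y) • z ∈ R
    rw [← Finset.prod_erase_mul _ _ hz, mul_smul]
    exact R.smul_mem (ha z) _
  -- The ideal $aM$ of $R$.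
  let I : Ideal R :=
    { carrier := {s | ∃ y ∈ M, (s : K) = a • y}
      add_mem' := by
        rintro s t ⟨y, hy, hs⟩ ⟨z, hz, ht⟩
        exact ⟨y + z, M.add_mem hy hz, by simp [hs, ht]⟩
      zero_mem' := ⟨0, M.zero_mem, by simp⟩
      smul_mem' := by
        rintro c s ⟨y, hy, hs⟩
        exact ⟨c * y, hMR _ c.2 _ hy, by simp [hs]⟩ }
  have haK : algebraMap A K a ≠ 0 := by simpa using (map_ne_zero_iff _ hAK).2 ha0
  have hI : I ≠ ⊥ := by
    intro h
    obtain ⟨c, hc0, hc⟩ := exists_smul_mem_of_isLattice (k := k) M (1 : K)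
    have h1 : (⟨a • c • 1, ha _ hc⟩ : R) ∈ I := ⟨_, hc, rfl⟩
    rw [h, Ideal.mem_bot, Subtype.ext_iff] at h1
    have hcK : algebraMap A K c ≠ 0 := by simpa using (map_ne_zero_iff _ hAK).2 hc0
    simp [Algebra.smul_def, haK, hcK] at h1
  obtain ⟨b, ⟨y, hy, hby⟩, hb0, hb⟩ := hm I hI
  have hbK : (b : K) ≠ 0 := by simpa using hb0
  have hmK : (m : K) ≠ 0 := by simpa using hm0
  -- With $I=aM$ and $b\in I$ such that $b$ divides $mI$, the lattice $u^{-1}M$ is $(m/b)I$. It lies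
  -- in $R$ because $b\mid mI$ and contains $m$ because $b\in I$, so it is one of finitely many
  -- ideals.
  let u : Kˣ := Units.mk0 (b / (m * algebraMap A K a)) (div_ne_zero hbK (mul_ne_zero hmK haK))
  refine ⟨u, lmul u⁻¹ M, ⟨isLattice_lmul u⁻¹ M hM, ?_⟩, by rw [← lmul_mul, mul_inv_cancel, lmul_one]⟩
  have key (s : K) : s ∈ lmul u⁻¹ M ↔ b / (m * algebraMap A K a) * s ∈ M := by
    rw [mem_lmul, inv_inv]
    rfl
  refine ⟨{ carrier := {s | (s : K) ∈ lmul u⁻¹ M}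
            add_mem' := fun hs ht => Submodule.add_mem (lmul u⁻¹ M) hs ht
            zero_mem' := Submodule.zero_mem (lmul u⁻¹ M)
            smul_mem' := ?_ }, ?_, ?_⟩
  · intro c s hs
    simp only [Set.mem_ofPred_eq, key] at hs ⊢
    have := hMR _ c.2 _ hs
    convert this using 1
    simp only [smul_eq_mul, MulMemClass.coe_mul]
    ring
  · change (m : K) ∈ lmul u⁻¹ M
    rw [key, hby, Algebra.smul_def]
    convert hy using 1
    field_simp
  · ext s
    simp only [Submodule.mem_map, Submodule.restrictScalars_mem]
    constructor
    · rintro ⟨s, hs, rfl⟩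
      exact hs
    · intro hs
      refine ⟨⟨s, ?_⟩, hs, rfl⟩
      rw [key] at hs
      obtain ⟨c, hc⟩ := hb ⟨_, ha _ hs⟩ ⟨_, hs, rfl⟩
      have h1 := congrArg Subtype.val hc
      simp only [MulMemClass.coe_mul, Algebra.smul_def] at h1
      have : s = c := by
        field_simp at h1
        exact h1
      exact this ▸ c.2

end JordanZassenhaus

/-! ### Adelic algebras and their units, place by place. -/

section Adelic

open HeightOneSpectrum Module
open scoped WithZero

variable {A : Type*} [CommRing A] [IsDedekindDomain A] {k : Type*} [Field k] [Algebra A k]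
  [IsFractionRing A k] {B : Type*} [DivisionRing B] [Algebra k B] [Algebra A B]

theorem repr_component {ι : Type*} (b : Basis ι k B) (v : HeightOneSpectrum A)
    (y : AdelicAlg A k B) (i : ι) :
    (Algebra.TensorProduct.basis (v.adicCompletion k) b).repr (component k v B y) i =
      (Algebra.TensorProduct.basis (FiniteAdeleRing A k) b).repr y i v := by
  induction y using TensorProduct.induction_on with
  | zero =>
    simp only [map_zero, Finsupp.zero_apply]
    rfl
  | add y z hy hz =>
    rw [map_add, map_add, map_add, Finsupp.add_apply, Finsupp.add_apply, hy, hz]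
    rfl
  | tmul a x =>
    rw [component, Algebra.TensorProduct.map_tmul, Algebra.TensorProduct.basis_repr_tmul,
      Algebra.TensorProduct.basis_repr_tmul]
    rfl

/-- In coordinates an adelic element is a finite tuple of finite adeles, and each adele is
determined by its components. -/
theorem component_ext {y z : AdelicAlg A k B} (h : ∀ v, component k v B y = component k v B z) :
    y = z := by
  let b := Basis.ofVectorSpace k B
  refine (Algebra.TensorProduct.basis (FiniteAdeleRing A k) b).repr.injective (Finsupp.ext fun i => ?_)
  refine FiniteAdeleRing.ext k fun v => ?_
  rw [← repr_component, ← repr_component, h v]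

theorem finite_component_notMem_box {ι : Type*} [Finite ι] (b : Basis ι k B)
    (y : AdelicAlg A k B) : {v | component k v B y ∉ box v b 1}.Finite := by
  have h (i : ι) := ((Algebra.TensorProduct.basis (FiniteAdeleRing A k) b).repr y i).2
  have h2 := Filter.eventually_all.2 h
  refine Set.Finite.subset (Filter.eventually_cofinite.1 h2) fun v hv hv' => hv fun i => ?_
  rw [repr_component]
  exact hv' i

theorem exists_component_eq {ι : Type*} [Finite ι] (b : Basis ι k B)
    (y : ∀ v : HeightOneSpectrum A, LocalAlg k v B) (h : {v | y v ∉ box v b 1}.Finite) :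
    ∃ z : AdelicAlg A k B, ∀ v, component k v B z = y v := by
  cases nonempty_fintype ι
  let c (i : ι) : FiniteAdeleRing A k :=
    ⟨fun v => (Algebra.TensorProduct.basis (v.adicCompletion k) b).repr (y v) i,
      Filter.eventually_cofinite.2 (h.subset fun v hv hv' => hv (hv' i))⟩
  refine ⟨∑ i, c i • Algebra.TensorProduct.basis (FiniteAdeleRing A k) b i, fun v => ?_⟩
  refine (Algebra.TensorProduct.basis (v.adicCompletion k) b).repr.injective
    (Finsupp.ext fun i => ?_)
  rw [repr_component, Basis.repr_sum_self]
  rfl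

theorem mem_localUnits {v : HeightOneSpectrum A} {S : Subalgebra A B} {u : (LocalAlg k v B)ˣ} :
    u ∈ localUnits v S ↔ (u : LocalAlg k v B) ∈ localOrder v S ∧
      (↑u⁻¹ : LocalAlg k v B) ∈ localOrder v S := Submonoid.mem_units_iff _ _

/-- The component of an adelic unit. -/
def unitComponent (v : HeightOneSpectrum A) : (AdelicAlg A k B)ˣ →* (LocalAlg k v B)ˣ :=
  Units.map (component k v B : AdelicAlg A k B →* LocalAlg k v B)

theorem coe_unitComponent (v : HeightOneSpectrum A) (u : (AdelicAlg A k B)ˣ) :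
    (unitComponent v u : LocalAlg k v B) = component k v B u := rfl

theorem coe_inv_unitComponent (v : HeightOneSpectrum A) (u : (AdelicAlg A k B)ˣ) :
    (↑(unitComponent v u)⁻¹ : LocalAlg k v B) = component k v B ↑u⁻¹ := by
  rw [← map_inv, coe_unitComponent]

theorem mem_adelicOrder {S : Subalgebra A B} {y : AdelicAlg A k B} :
    y ∈ adelicOrder S ↔ ∀ v, component k v B y ∈ localOrder v S := by
  simp only [adelicOrder, Subring.mem_iInf]
  rfl

theorem mem_adelicUnits {S : Subalgebra A B} {u : (AdelicAlg A k B)ˣ} :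
    u ∈ adelicUnits S ↔ ∀ v, unitComponent v u ∈ localUnits v S := by
  simp only [mem_localUnits, coe_unitComponent, coe_inv_unitComponent, forall_and,
    ← mem_adelicOrder]
  exact Submonoid.mem_units_iff _ _

variable [IsScalarTower A k B] [FiniteDimensional k B]

theorem finite_unitComponent_notMem (S : Subalgebra A B) (hS : IsOrder k S)
    (u : (AdelicAlg A k B)ˣ) : {v | unitComponent v u ∉ localUnits v S}.Finite := by
  let b := Module.finBasis k B
  have : (Subalgebra.toSubmodule S).IsLattice k := hS
  refine (((finite_component_notMem_box b (u : AdelicAlg A k B)).union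
    (finite_component_notMem_box b (↑u⁻¹ : AdelicAlg A k B))).union
    (finite_locSpan_ne_box b (Subalgebra.toSubmodule S))).subset fun v hv => ?_
  by_contra h
  simp only [Set.mem_union, Set.mem_ofPred_eq, not_or, not_not] at h
  refine hv (mem_localUnits.2 ?_)
  rw [mem_localOrder_iff, mem_localOrder_iff, h.2, coe_unitComponent, coe_inv_unitComponent]
  exact h.1

/-- The family and the family of inverses are assembled separately: both are integral almost
everywhere because $S_v$ is almost always the box of radius one. -/
theorem exists_unitComponent_eq (S : Subalgebra A B) (hS : IsOrder k S)
    (u : ∀ v : HeightOneSpectrum A, (LocalAlg k v B)ˣ) (hu : {v | u v ∉ localUnits v S}.Finite) :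
    ∃ w : (AdelicAlg A k B)ˣ, ∀ v, unitComponent v w = u v := by
  let b := Module.finBasis k B
  have : (Subalgebra.toSubmodule S).IsLattice k := hS
  have hf := hu.union (finite_locSpan_ne_box b (Subalgebra.toSubmodule S))
  obtain ⟨y, hy⟩ := exists_component_eq b (fun v => (u v : LocalAlg k v B)) <|
    hf.subset fun v hv => by
      by_contra h
      simp only [Set.mem_union, Set.mem_ofPred_eq, not_or, not_not] at h
      exact hv (h.2 ▸ (mem_localOrder_iff _ _ _).1 (mem_localUnits.1 h.1).1)
  obtain ⟨z, hz⟩ := exists_component_eq b (fun v => (↑(u v)⁻¹ : LocalAlg k v B)) <|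
    hf.subset fun v hv => by
      by_contra h
      simp only [Set.mem_union, Set.mem_ofPred_eq, not_or, not_not] at h
      exact hv (h.2 ▸ (mem_localOrder_iff _ _ _).1 (mem_localUnits.1 h.1).2)
  refine ⟨⟨y, z, component_ext fun v => ?_, component_ext fun v => ?_⟩, fun v => Units.ext (hy v)⟩
  · rw [map_mul, hy, hz, map_one, Units.mul_inv]
  · rw [map_mul, hy, hz, map_one, Units.inv_mul]

end Adelic

/-! ### Jordan–Zassenhaus at the places $v$. -/

section LocalJZ

open HeightOneSpectrum Module
open scoped WithZero

variable {A : Type*} [CommRing A] [IsDedekindDomain A] {k : Type*} [Field k] [Algebra A k]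
  [IsFractionRing A k] {B : Type*} [Ring B] [Algebra k B] [Algebra A B] [IsScalarTower A k B]
  [FiniteDimensional k B]

theorem mul_mem_globLat {R : Subalgebra A B}
    {N : ∀ v : HeightOneSpectrum A, Submodule (v.adicCompletionIntegers k) (LocalAlg k v B)}
    (hN : ∀ v, ∀ x ∈ localOrder v R, ∀ y ∈ N v, x * y ∈ N v) {x y : B} (hx : x ∈ R)
    (hy : y ∈ globLat N) : x * y ∈ globLat N := fun v => by
  have h := hN v (1 ⊗ₜ x) ((mem_localOrder_iff _ _ _).2 (tmul_mem_locSpan v hx)) _ (hy v)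
  rwa [Algebra.TensorProduct.tmul_mul_tmul, one_mul] at h

/-- The image of a global unit in `B_v`. -/
def localUnit (v : HeightOneSpectrum A) : Bˣ →* (LocalAlg k v B)ˣ :=
  Units.map ((Algebra.TensorProduct.includeRight : B →ₐ[k] LocalAlg k v B) : B →* LocalAlg k v B)

theorem locSpan_lmul (v : HeightOneSpectrum A) (u : Bˣ) (M : Submodule A B) :
    locSpan (k := k) v (lmul u M) = lmul (localUnit v u) (locSpan v M) := by
  rw [lmul_eq_map, lmul_eq_map, locSpan, locSpan, Submodule.map_span, Submodule.map_coe,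
    Set.image_image, Set.image_image]
  congr 1
  refine Set.image_congr fun x _ => ?_
  change (1 ⊗ₜ[k] (↑u * x) : LocalAlg k v B) = (1 ⊗ₜ[k] (u : B)) * (1 ⊗ₜ x)
  rw [Algebra.TensorProduct.tmul_mul_tmul, one_mul]

/-- Local lattices stable under an order, almost all of them standard, come from a stable global
lattice. -/
theorem exists_globLat (R : Subalgebra A B) (hR : IsOrder k R)
    (N : ∀ v : HeightOneSpectrum A, Submodule (v.adicCompletionIntegers k) (LocalAlg k v B))
    (hN : ∀ v, (N v).IsLattice (v.adicCompletion k))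
    (hfin : {v | N v ≠ locSpan v (Subalgebra.toSubmodule R)}.Finite) :
    (globLat N).IsLattice k ∧ ∀ v, locSpan v (globLat N) = N v := by
  let b := Module.finBasis k B
  have : (Subalgebra.toSubmodule R).IsLattice k := hR
  refine globLat_spec b N hN ((hfin.union
    (finite_locSpan_ne_box b (Subalgebra.toSubmodule R))).subset fun v hv => ?_)
  by_contra h
  simp only [Set.mem_union, Set.mem_ofPred_eq, not_or, not_not] at h
  exact hv (h.1.trans h.2)

-- Globalises a lattice at one place by filling in with the order elsewhere. The last clause exposes
-- `M` as a `globLat`, so that multiplicative properties can be checked place by place.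
open scoped Classical in
theorem exists_globLat_single (R : Subalgebra A B) (hR : IsOrder k R) (v : HeightOneSpectrum A)
    (N : Submodule (v.adicCompletionIntegers k) (LocalAlg k v B))
    (hN : N.IsLattice (v.adicCompletion k)) :
    ∃ M : Submodule A B, M.IsLattice k ∧ locSpan v M = N ∧
      (∀ w ≠ v, locSpan (k := k) w M = locSpan w (Subalgebra.toSubmodule R)) ∧
      M = globLat (Function.update (fun w => locSpan (k := k) w (Subalgebra.toSubmodule R)) v N) := by
  have : (Subalgebra.toSubmodule R).IsLattice k := hR
  obtain ⟨h1, h2⟩ := exists_globLat R hR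
    (Function.update (fun w => locSpan w (Subalgebra.toSubmodule R)) v N)
    (fun w => by
      by_cases hw : w = v
      · subst hw
        simpa using hN
      · rw [Function.update_of_ne hw]
        exact isLattice_locSpan w _)
    ((Set.finite_singleton v).subset fun w hw => by
      by_contra h
      exact hw (Function.update_of_ne h _ _))
  refine ⟨_, h1, ?_, fun w hw => ?_, rfl⟩
  · rw [h2, Function.update_self]
  · rw [h2, Function.update_of_ne hw]

theorem mul_mem_locSpan_toSubmodule {v : HeightOneSpectrum A} {R : Subalgebra A B}
    {x y : LocalAlg k v B} (hx : x ∈ localOrder v R)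
    (hy : y ∈ locSpan v (Subalgebra.toSubmodule R)) :
    x * y ∈ locSpan v (Subalgebra.toSubmodule R) := by
  rw [← mem_localOrder_iff] at hy ⊢
  exact mul_mem hx hy

end LocalJZ

section LocalJZ

open HeightOneSpectrum Module
open scoped WithZero Polynomial

variable {F A k K : Type*} [Field F] [Finite F] [CommRing A] [IsDedekindDomain A] [Field k]
  [Algebra A k] [IsFractionRing A k] [Field K] [Algebra k K] [Algebra A K] [IsScalarTower A k K]
  [FiniteDimensional k K]

/-- Extend `N` by $R_w$ at $w\ne v$ to a global $R$-lattice and apply `exists_finite_lattices`. That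
`T` does not depend on `v` is what makes almost all local factors equal to $1$. -/
theorem exists_finite_lattices_local {f : F[X] →+* A} (hfi : Function.Injective f)
    (hff : f.Finite) (R : Subalgebra A K) (hR : IsOrder k R) :
    ∃ T : Set (Submodule A K), T.Finite ∧ (∀ M ∈ T, M.IsLattice k) ∧
      ∀ (v : HeightOneSpectrum A) (N : Submodule (v.adicCompletionIntegers k) (LocalAlg k v K)),
        N.IsLattice (v.adicCompletion k) → (∀ x ∈ localOrder v R, ∀ y ∈ N, x * y ∈ N) →
        ∃ u : (LocalAlg k v K)ˣ, ∃ M' ∈ T, N = lmul u (locSpan v M') := by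
  classical
  obtain ⟨T, hT, hTl, h⟩ := exists_finite_lattices hfi hff R hR
  refine ⟨T, hT, hTl, fun v N hN hRN => ?_⟩
  obtain ⟨M, hM, hMv, -, hMg⟩ := exists_globLat_single R hR v N hN
  obtain ⟨u, M', hM', rfl⟩ := h M hM fun x hx y hy => by
    rw [hMg] at hy ⊢
    refine mul_mem_globLat (R := R) (fun w x hx y hy => ?_) hx hy
    by_cases hw : w = v
    · subst hw
      rw [Function.update_self] at hy ⊢
      exact hRN x hx y hy
    · rw [Function.update_of_ne hw] at hy ⊢
      exact mul_mem_locSpan_toSubmodule hx hy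
  exact ⟨localUnit v u, M', hM', by rw [← locSpan_lmul, hMv]⟩

end LocalJZ

/-- A counting device: `P a t` says that `t` is a possible label of `a`, and elements sharing a
label have the same image. One representative per label in use covers the image. -/
theorem finite_image_of_factor {α β γ : Type*} {F : α → β} {E : Set α} {T : Set γ} (hT : T.Finite)
    (P : α → γ → Prop) (hg : ∀ a ∈ E, ∃ t ∈ T, P a t)
    (h : ∀ a ∈ E, ∀ b ∈ E, ∀ t, P a t → P b t → F a = F b) : (F '' E).Finite := by
  classical
  let T' := {t ∈ T | ∃ a ∈ E, P a t}
  have hT' : T'.Finite := hT.sep _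
  have hs : ∀ t : T', ∃ a ∈ E, P a t := fun t => t.2.2
  choose s hsE hs using hs
  have := hT'.to_subtype
  refine (Set.finite_range fun t => F (s t)).subset ?_
  rintro _ ⟨a, ha, rfl⟩
  obtain ⟨t, ht, hat⟩ := hg a ha
  exact ⟨⟨t, ht, a, ha, hat⟩, h _ (hsE _) _ ha t (hs _) hat⟩

theorem doubleCoset_eq_of_eq {G : Type*} [Group G] {H U : Subgroup G} {a b h u : G} (hh : h ∈ H)
    (hu : u ∈ U) (hab : a = h * b * u) :
    DoubleCoset.doubleCoset a (H : Set G) U = DoubleCoset.doubleCoset b H U :=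
  (DoubleCoset.doubleCoset_eq_of_mem (DoubleCoset.mem_doubleCoset.2 ⟨h, hh, u, hu, hab⟩)).symm.symm

/-! ### Finiteness of the class number. -/

section ClassNumber

open HeightOneSpectrum Module
open scoped WithZero Polynomial

theorem lmul_toSubmodule_eq_iff {R B : Type*} [CommRing R] [Ring B] [Algebra R B]
    (S : Subalgebra R B) (u w : Bˣ) :
    lmul u (Subalgebra.toSubmodule S) = lmul w (Subalgebra.toSubmodule S) ↔
      u⁻¹ * w ∈ S.toSubring.toSubmonoid.units := by
  rw [Submonoid.mem_units_iff]
  constructor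
  · intro h
    constructor
    · have h1 : (w : B) * 1 ∈ lmul w (Subalgebra.toSubmodule S) := mul_mem_lmul.2 S.one_mem
      rw [← h, mem_lmul, mul_one] at h1
      exact h1
    · have h1 : (u : B) * 1 ∈ lmul u (Subalgebra.toSubmodule S) := mul_mem_lmul.2 S.one_mem
      rw [h, mem_lmul, mul_one] at h1
      rw [mul_inv_rev, inv_inv]
      exact h1
  · rintro ⟨h1, h2⟩
    have h3 : lmul (u⁻¹ * w) (Subalgebra.toSubmodule S) = Subalgebra.toSubmodule S := by
      ext x
      rw [mem_lmul]
      refine ⟨fun h => ?_, fun h => S.mul_mem h2 h⟩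
      have := S.mul_mem (show (↑(u⁻¹ * w) : B) ∈ S from h1) h
      rwa [Units.mul_inv_cancel_left] at this
    calc _ = lmul u (lmul (u⁻¹ * w) (Subalgebra.toSubmodule S)) := by rw [h3]
      _ = _ := by rw [← lmul_mul, mul_inv_cancel_left]

theorem lmul_localOrder_eq_iff {A k B : Type*} [CommRing A] [IsDedekindDomain A] [Field k]
    [Algebra A k] [IsFractionRing A k] [DivisionRing B] [Algebra k B] [Algebra A B]
    (v : HeightOneSpectrum A) (S : Subalgebra A B) (u w : (LocalAlg k v B)ˣ) :
    lmul u (locSpan v (Subalgebra.toSubmodule S)) = lmul w (locSpan v (Subalgebra.toSubmodule S)) ↔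
      u⁻¹ * w ∈ localUnits v S := by
  rw [← toSubmodule_localOrder, lmul_toSubmodule_eq_iff]
  rfl

variable {F A k K : Type*} [Field F] [Finite F] [CommRing A] [IsDedekindDomain A] [Field k]
  [Algebra A k] [IsFractionRing A k] [Field K] [Algebra k K] [Algebra A K] [IsScalarTower A k K]
  [FiniteDimensional k K]

/-- Attach to $b$ the global lattice with localisations $b_vR_v$. If those of $b$ and $b'$ differ by
a global unit $x$, then $(xb')^{-1}b$ stabilises every $R_v$, so the double cosets agree;
Jordan–Zassenhaus leaves finitely many lattices up to units. -/
theorem finite_classSet {f : F[X] →+* A} (hfi : Function.Injective f)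
    (hff : f.Finite) (R : Subalgebra A K) (hR : IsOrder k R) : (classSet k R).Finite := by
  obtain ⟨T, hT, -, h⟩ := exists_finite_lattices hfi hff R hR
  have hRl : (Subalgebra.toSubmodule R).IsLattice k := hR
  let N (b : (AdelicAlg A k K)ˣ) (v : HeightOneSpectrum A) :=
    lmul (unitComponent v b) (locSpan (k := k) v (Subalgebra.toSubmodule R))
  have hN (b) := exists_globLat R hR (N b) (fun v => isLattice_lmul _ _ (isLattice_locSpan v _))
    ((finite_unitComponent_notMem R hR b).subset fun v hv => by
      refine fun hb => hv ?_
      have := (lmul_localOrder_eq_iff v R (unitComponent v b) 1).2 (by simpa using hb)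
      rwa [lmul_one] at this)
  refine finite_image_of_factor hT (fun b M' => ∃ u : Kˣ, globLat (N b) = lmul u M')
    (fun b _ => ?_) ?_
  · obtain ⟨u, M', hM', hu⟩ := h _ (hN b).1 fun x hx y hy => mul_mem_globLat (R := R)
      (fun v x hx y hy => by
        rw [mem_lmul] at hy ⊢
        rw [mul_left_comm]
        exact mul_mem_locSpan_toSubmodule hx hy) hx hy
    exact ⟨M', hM', u, hu⟩
  · rintro b - b' - M' ⟨u, hu⟩ ⟨u', hu'⟩
    have h1 : globLat (N b) = lmul (u * u'⁻¹) (globLat (N b')) := by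
      rw [hu, hu', ← lmul_mul, inv_mul_cancel_right]
    let x : (AdelicAlg A k K)ˣ := Units.map (adelicEmb A (AlgHom.id k K) : K →* _) (u * u'⁻¹)
    have hx (v : HeightOneSpectrum A) : unitComponent v x = localUnit v (u * u'⁻¹) :=
      Units.ext (by
        rw [coe_unitComponent]
        change component k v K (1 ⊗ₜ _) = 1 ⊗ₜ _
        rw [component, Algebra.TensorProduct.map_tmul, map_one]
        rfl)
    refine doubleCoset_eq_of_eq (h := x) (u := (x * b')⁻¹ * b) ⟨_, rfl⟩ ?_ (by group)
    refine mem_adelicUnits.2 fun v => ?_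
    rw [map_mul, map_inv, map_mul, ← lmul_localOrder_eq_iff, hx]
    rw [lmul_mul]
    change lmul _ (N b' v) = N b v
    rw [← (hN b).2 v, ← (hN b').2 v, ← locSpan_lmul, h1]

end ClassNumber

/-! ### Optimality as a local condition. -/

section Optimal

open HeightOneSpectrum Module
open scoped WithZero

theorem isLattice_comap {A k V W : Type*} [CommRing A] [IsDomain A] [IsNoetherianRing A] [Field k]
    [Algebra A k] [IsFractionRing A k] [AddCommGroup V] [Module k V] [Module A V]
    [IsScalarTower A k V] [AddCommGroup W] [Module k W] [Module A W] [IsScalarTower A k W]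
    (f : V →ₗ[k] W) (hf : Function.Injective f) (L : Submodule A W) (hL : L.IsLattice k) :
    (L.comap (f.restrictScalars A)).IsLattice k := by
  constructor
  · have := hL.finite
    have : IsNoetherian A L := inferInstance
    have h : Function.Injective ((f.restrictScalars A).restrict
        (p := L.comap (f.restrictScalars A)) (q := L) fun x hx => hx) :=
      fun x y h => Subtype.ext (hf (congrArg Subtype.val h))
    exact Module.Finite.iff_fg.1 (Module.Finite.of_injective _ h)
  · rw [eq_top_iff]
    intro x _
    obtain ⟨a, ha0, ha⟩ := exists_smul_mem_of_mem_span (k := k) (N := L) (y := f x)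
      (by rw [hL.span_eq_top]; trivial)
    have ha1 : algebraMap A k a ≠ 0 := by simpa using ha0
    have h1 : a • x ∈ L.comap (f.restrictScalars A) := by
      rw [Submodule.mem_comap, map_smul]
      exact ha
    have h2 : x = (algebraMap A k a)⁻¹ • a • x := by
      rw [← algebraMap_smul k a, smul_smul, inv_mul_cancel₀ ha1, one_smul]
    rw [h2]
    exact Submodule.smul_mem _ _ (Submodule.subset_span h1)

variable {A k K D : Type*} [CommRing A] [IsDedekindDomain A] [Field k]
  [Algebra A k] [IsFractionRing A k] [Field K] [Algebra k K] [Algebra A K] [IsScalarTower A k K]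
  [FiniteDimensional k K] [DivisionRing D] [Algebra k D] [Algebra A D] [IsScalarTower A k D]
  [FiniteDimensional k D]

theorem isOrder_localOrder (v : HeightOneSpectrum A) (OD : Subalgebra A D) (hOD : IsOrder k OD) :
    IsOrder (v.adicCompletion k) (localOrder (k := k) v OD) := by
  have : (Subalgebra.toSubmodule OD).IsLattice k := hOD
  rw [IsOrder, toSubmodule_localOrder]
  exact isLattice_locSpan v _

theorem localEmb_injective (v : HeightOneSpectrum A) (φ : K →ₐ[k] D) :
    Function.Injective (localEmb v φ) :=
  Module.Flat.lTensor_preserves_injective_linearMap (M := v.adicCompletion k) φ.toLinearMap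
    φ.toRingHom.injective

/-- `x ↦ b⁻¹ φ_v(x) b`. -/
def conjEmb (v : HeightOneSpectrum A) (φ : K →ₐ[k] D) (b : (LocalAlg k v D)ˣ) :
    LocalAlg k v K →ₗ[v.adicCompletion k] LocalAlg k v D :=
  (LinearMap.mulRight _ (b : LocalAlg k v D)).comp
    ((LinearMap.mulLeft _ (↑b⁻¹ : LocalAlg k v D)).comp (localEmb v φ).toLinearMap)

theorem conjEmb_apply (v : HeightOneSpectrum A) (φ : K →ₐ[k] D) (b : (LocalAlg k v D)ˣ)
    (x : LocalAlg k v K) : conjEmb v φ b x = ↑b⁻¹ * localEmb v φ x * ↑b := rfl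

theorem conjEmb_injective (v : HeightOneSpectrum A) (φ : K →ₐ[k] D) (b : (LocalAlg k v D)ˣ) :
    Function.Injective (conjEmb v φ b) := fun x y h => by
  rw [conjEmb_apply, conjEmb_apply, Units.mul_left_inj, Units.mul_right_inj] at h
  exact localEmb_injective v φ h

/-- `φ_v⁻¹(b O_{D,v} b⁻¹)`. -/
def pullbackOrder (v : HeightOneSpectrum A) (φ : K →ₐ[k] D) (OD : Subalgebra A D)
    (b : (LocalAlg k v D)ˣ) : Submodule (v.adicCompletionIntegers k) (LocalAlg k v K) :=
  (locSpan v (Subalgebra.toSubmodule OD)).comap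
    ((conjEmb v φ b).restrictScalars (v.adicCompletionIntegers k))

theorem mem_pullbackOrder {v : HeightOneSpectrum A} {φ : K →ₐ[k] D} {OD : Subalgebra A D}
    {b : (LocalAlg k v D)ˣ} {x : LocalAlg k v K} :
    x ∈ pullbackOrder v φ OD b ↔ ↑b⁻¹ * localEmb v φ x * ↑b ∈ localOrder v OD := by
  rw [mem_localOrder_iff]
  rfl

theorem pullbackOrder_of_mem {v : HeightOneSpectrum A} {φ : K →ₐ[k] D} {OD : Subalgebra A D}
    {b : (LocalAlg k v D)ˣ} (hb : b ∈ localUnits v OD) :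
    pullbackOrder v φ OD b = pullbackOrder v φ OD 1 := by
  ext x
  obtain ⟨h1, h2⟩ := mem_localUnits.1 hb
  rw [mem_pullbackOrder, mem_pullbackOrder, inv_one, Units.val_one, one_mul, mul_one]
  refine ⟨fun h => ?_, fun h => mul_mem (mul_mem h2 h) h1⟩
  have := mul_mem (mul_mem h1 h) h2
  rwa [mul_assoc, mul_assoc, mul_assoc, Units.mul_inv, mul_one, Units.mul_inv_cancel_left] at this

theorem mem_localOptimal_iff {v : HeightOneSpectrum A} {φ : K →ₐ[k] D} {OD : Subalgebra A D}
    {R : Subalgebra A K} {b : (LocalAlg k v D)ˣ} :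
    b ∈ localOptimal v φ OD R ↔
      pullbackOrder v φ OD b = locSpan v (Subalgebra.toSubmodule R) := by
  rw [SetLike.ext_iff]
  simp only [mem_pullbackOrder, ← mem_localOrder_iff]
  rfl

/-- Extend the image under $\phi$ of a basis of $K$ to a basis of $D$. In these coordinates the unit
box of $D_v$ meets $\phi_v(K_v)$ in the unit box of $K_v$, and both orders are unit boxes at almost
all places. -/
theorem finite_pullbackOrder_ne (φ : K →ₐ[k] D) (OD : Subalgebra A D) (hOD : IsOrder k OD)
    (R : Subalgebra A K) (hR : IsOrder k R) :
    {v : HeightOneSpectrum A | pullbackOrder v φ OD 1 ≠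
      locSpan v (Subalgebra.toSubmodule R)}.Finite := by
  let bK := Module.finBasis k K
  have hli : LinearIndependent k fun i => φ (bK i) :=
    bK.linearIndependent.map' φ.toLinearMap (LinearMap.ker_eq_bot.2 φ.toRingHom.injective)
  let bD := Basis.sumExtend hli
  have := bD.linearIndependent.finite
  have h1 : (Subalgebra.toSubmodule OD).IsLattice k := hOD
  have h2 : (Subalgebra.toSubmodule R).IsLattice k := hR
  refine ((finite_locSpan_ne_box bD (Subalgebra.toSubmodule OD)).union
    (finite_locSpan_ne_box bK (Subalgebra.toSubmodule R))).subset fun v hv => ?_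
  by_contra h
  simp only [Set.mem_union, Set.mem_ofPred_eq, not_or, not_not] at h
  refine hv ?_
  rw [h.2]
  ext y
  rw [mem_pullbackOrder, mem_localOrder_iff, h.1, inv_one, Units.val_one, one_mul, mul_one]
  have key : (Algebra.TensorProduct.basis (v.adicCompletion k) bD).repr (localEmb v φ y) =
      Finsupp.mapDomain Sum.inl
        ((Algebra.TensorProduct.basis (v.adicCompletion k) bK).repr y) := by
    have : ((Algebra.TensorProduct.basis (v.adicCompletion k) bD).repr.toLinearMap.comp
        (localEmb v φ).toLinearMap) = (Finsupp.lmapDomain _ _ Sum.inl).comp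
        (Algebra.TensorProduct.basis (v.adicCompletion k) bK).repr.toLinearMap := by
      refine (Algebra.TensorProduct.basis (v.adicCompletion k) bK).ext fun i => ?_
      have h3 : localEmb v φ (Algebra.TensorProduct.basis (v.adicCompletion k) bK i) =
          Algebra.TensorProduct.basis (v.adicCompletion k) bD (Sum.inl i) := by
        rw [Algebra.TensorProduct.basis_apply, Algebra.TensorProduct.basis_apply, localEmb,
          Algebra.TensorProduct.map_tmul]
        congr 1
        simp only [bD, Basis.sumExtend, Basis.reindex_apply, Basis.extend_apply_self]
        rfl
      simp only [LinearMap.comp_apply, AlgHom.toLinearMap_apply, LinearEquiv.coe_coe, h3,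
        Basis.repr_self, Finsupp.lmapDomain_apply, Finsupp.mapDomain_single]
    exact LinearMap.congr_fun this y
  rw [mem_box, mem_box, key, Sum.forall]
  constructor
  · rintro ⟨h, -⟩ i
    simpa [Finsupp.mapDomain_apply Sum.inl_injective] using h i
  · refine fun h => ⟨fun i => by simpa [Finsupp.mapDomain_apply Sum.inl_injective] using h i,
      fun j => ?_⟩
    rw [Finsupp.mapDomain_of_notMem_range _ _ (by simp)]
    simp

/-- Optimality is a local condition. -/
theorem mem_optimalEmbeddings_iff (φ : K →ₐ[k] D) (OD : Subalgebra A D) (hOD : IsOrder k OD)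
    (R : Subalgebra A K) (hR : IsOrder k R) (b : (AdelicAlg A k D)ˣ) :
    b ∈ optimalEmbeddings φ OD R ↔ ∀ v, unitComponent v b ∈ localOptimal v φ OD R := by
  have h1 : (Subalgebra.toSubmodule OD).IsLattice k := hOD
  have h2 : (Subalgebra.toSubmodule R).IsLattice k := hR
  -- These pullbacks are the localisations of $\phi^{-1}(O_{D,b})$. Global and local optimality are
  -- thus equality of two lattices and equality of all their localisations.
  let N (v : HeightOneSpectrum A) := pullbackOrder v φ OD (unitComponent v b)
  have hN (v) : (N v).IsLattice (v.adicCompletion k) :=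
    isLattice_comap (A := v.adicCompletionIntegers k) (conjEmb v φ (unitComponent v b))
      (conjEmb_injective v φ _) _ (isLattice_locSpan v _)
  obtain ⟨-, h3⟩ := exists_globLat R hR N hN
    (((finite_unitComponent_notMem OD hOD b).union (finite_pullbackOrder_ne φ OD hOD R hR)).subset
      fun v hv => by
        by_contra h
        simp only [Set.mem_union, Set.mem_ofPred_eq, not_or, not_not] at h
        exact hv ((pullbackOrder_of_mem h.1).trans h.2))
  have h4 (x : K) : ↑b⁻¹ * adelicEmb A φ x * ↑b ∈ adelicOrder OD ↔ x ∈ globLat N := by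
    rw [mem_adelicOrder, mem_globLat]
    refine forall_congr' fun v => ?_
    rw [mem_pullbackOrder, map_mul, map_mul, coe_inv_unitComponent, coe_unitComponent]
    have h5 : component k v D (adelicEmb A φ x) = localEmb v φ (1 ⊗ₜ x) := by
      rw [localEmb, Algebra.TensorProduct.map_tmul]
      change component k v D (1 ⊗ₜ (φ x)) = _
      rw [component, Algebra.TensorProduct.map_tmul, map_one]
      rfl
    rw [h5]
  have h6 : b ∈ optimalEmbeddings φ OD R ↔ globLat N = Subalgebra.toSubmodule R := by
    rw [SetLike.ext_iff]
    simp only [← h4]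
    rfl
  simp only [mem_localOptimal_iff, h6]
  refine ⟨fun h v => by rw [← h, h3], fun h => ?_⟩
  rw [← globLat_locSpan (k := k) (Subalgebra.toSubmodule R)]
  exact congrArg globLat (funext h)

end Optimal

/-! ### Counting double cosets through a fibration. -/

section DoubleCosets

theorem doubleCoset_eq_iff {G : Type*} [Group G] {H U : Subgroup G} {a b : G} :
    DoubleCoset.doubleCoset a (H : Set G) U = DoubleCoset.doubleCoset b H U ↔
      ∃ h ∈ H, ∃ u ∈ U, a = h * b * u := by
  refine ⟨fun h => ?_, fun ⟨h, hh, u, hu, e⟩ => doubleCoset_eq_of_eq hh hu e⟩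
  have := DoubleCoset.mem_doubleCoset_self H U a
  rw [h] at this
  exact DoubleCoset.mem_doubleCoset.1 this

/-- The map to the double cosets of the full image of `T` has, over the class of `b`, the fibre
$H_0\backslash T/(T\cap bUb^{-1})$ via $t\mapsto\iota(t)b$. Hypothesis `h` identifies this
intersection with `T₀` for every `b`, so all fibres are alike; the bijection depends on chosen
representatives. -/
theorem card_doubleCosets_map {T G : Type*} [CommGroup T] [Group G] (ι : T →* G)
    (H₀ T₀ : Subgroup T) (U : Subgroup G) (E : Set G) (hE : ∀ t, ∀ b ∈ E, ι t * b ∈ E)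
    (h : ∀ b ∈ E, ∀ t, b⁻¹ * ι t * b ∈ U ↔ t ∈ T₀) :
    Nonempty (doubleCosets (H₀.map ι) U E ≃
      doubleCosets H₀ T₀ Set.univ × doubleCosets ι.range U E) := by
  have hr₁ : ∀ X : doubleCosets H₀ T₀ Set.univ, ∃ t : T, DoubleCoset.doubleCoset t H₀ T₀ = X.1 := by
    rintro ⟨_, t, -, rfl⟩
    exact ⟨t, rfl⟩
  have hr₂ : ∀ C : doubleCosets ι.range U E, ∃ b ∈ E,
      DoubleCoset.doubleCoset b (ι.range : Set G) U = C.1 := by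
    rintro ⟨_, b, hb, rfl⟩
    exact ⟨b, hb, rfl⟩
  choose t ht using hr₁
  choose b hbE hb using hr₂
  refine ⟨(Equiv.ofBijective (fun p : doubleCosets H₀ T₀ Set.univ × doubleCosets ι.range U E =>
    (⟨_, ι (t p.1) * b p.2, hE _ _ (hbE _), rfl⟩ : doubleCosets (H₀.map ι) U E)) ⟨?_, ?_⟩).symm⟩
  · rintro ⟨X, C⟩ ⟨X', C'⟩ he
    obtain ⟨_, ⟨h₀, hh₀, rfl⟩, u, hu, e⟩ := doubleCoset_eq_iff.1 (congrArg Subtype.val he)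
    obtain rfl : C = C' := by
      rw [Subtype.ext_iff, ← hb, ← hb, doubleCoset_eq_iff]
      refine ⟨ι ((t X)⁻¹ * h₀ * t X'), ⟨_, rfl⟩, u, hu, ?_⟩
      rw [map_mul, map_mul, map_inv, mul_assoc, mul_assoc, mul_assoc, eq_inv_mul_iff_mul_eq, e]
      simp only [mul_assoc]
    refine Prod.ext (Subtype.ext ?_) rfl
    change X.1 = X'.1
    rw [← ht, ← ht, doubleCoset_eq_iff]
    refine ⟨h₀, hh₀, (t X')⁻¹ * h₀⁻¹ * t X, ?_, by group⟩
    rw [← h _ (hbE C)]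
    have : (b C)⁻¹ * ι ((t X')⁻¹ * h₀⁻¹ * t X) * b C = u := by
      simp only [map_mul, map_inv, mul_assoc]
      change ι (t X) * b C = _ at e
      rw [e]
      group
    rwa [this]
  · rintro ⟨_, a, ha, rfl⟩
    let C : doubleCosets ι.range U E := ⟨_, a, ha, rfl⟩
    obtain ⟨_, ⟨s, rfl⟩, u, hu, e⟩ := doubleCoset_eq_iff.1 (hb C).symm
    let X : doubleCosets H₀ T₀ Set.univ := ⟨_, s, trivial, rfl⟩
    obtain ⟨h₀, hh₀, t₀, ht₀, e'⟩ := doubleCoset_eq_iff.1 (ht X).symm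
    refine ⟨(X, C), Subtype.ext (Eq.symm (doubleCoset_eq_iff.2
      ⟨ι h₀, ⟨_, hh₀, rfl⟩, (b C)⁻¹ * ι t₀ * b C * u, U.mul_mem ((h _ (hbE C) _).2 ht₀) hu, ?_⟩))⟩
    rw [e, e']
    simp only [map_mul]
    group

theorem card_pi_of_finite {ι : Type*} (X : ι → Type*) (hX : ∀ i, Finite (X i))
    (h : {i | Nat.card (X i) ≠ 1}.Finite) :
    Finite (∀ i, X i) ∧ Nat.card (∀ i, X i) = ∏ᶠ i, Nat.card (X i) := by
  classical
  let p : ι → Prop := fun i => Nat.card (X i) ≠ 1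
  have hu : ∀ i : {i // ¬p i}, Subsingleton (X i) ∧ Nonempty (X i) :=
    fun i => Nat.card_eq_one_iff_unique.1 (not_not.1 i.2)
  have hs : ∀ i : {i // ¬p i}, Subsingleton (X i) := fun i => (hu i).1
  have hn : ∀ i : {i // ¬p i}, Nonempty (X i) := fun i => (hu i).2
  have : Finite {i // p i} := h.to_subtype
  have := Fintype.ofFinite {i // p i}
  let e := Equiv.piEquivPiSubtypeProd p X
  refine ⟨Finite.of_equiv _ e.symm, ?_⟩
  rw [Nat.card_congr e, Nat.card_prod, Nat.card_pi, Nat.card_of_subsingleton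
    (fun i => (hn i).some), mul_one, finprod_eq_prod_of_mulSupport_subset (s := h.toFinset) _
      (by intro i hi; simpa using hi)]
  exact (Finset.prod_subtype h.toFinset (by simp [p]) fun i => Nat.card (X i)).symm

end DoubleCosets

/-! ### From adelic double cosets to local ones. -/

section AdelicDoubleCosets

open HeightOneSpectrum Module

variable {A k K D : Type*} [CommRing A] [IsDedekindDomain A] [Field k]
  [Algebra A k] [IsFractionRing A k] [Field K] [Algebra k K] [Algebra A K] [IsScalarTower A k K]
  [FiniteDimensional k K] [DivisionRing D] [Algebra k D] [Algebra A D] [IsScalarTower A k D]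
  [FiniteDimensional k D]

/-- The double cosets of local optimal embeddings. -/
abbrev localCosets (v : HeightOneSpectrum A) (φ : K →ₐ[k] D) (OD : Subalgebra A D)
    (R : Subalgebra A K) : Set (Set (LocalAlg k v D)ˣ) :=
  doubleCosets (localUnitsImage v φ) (localUnits v OD) (localOptimal v φ OD R)

/-- The base change of `φ` to the adeles, on units. -/
def adelicUnitsEmb (φ : K →ₐ[k] D) : (AdelicAlg A k K)ˣ →* (AdelicAlg A k D)ˣ :=
  Units.map (Algebra.TensorProduct.map (AlgHom.id k (FiniteAdeleRing A k)) φ :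
    AdelicAlg A k K →* AdelicAlg A k D)

/-- The base change of `φ` to `k_v`, on units. -/
def localUnitsEmb (v : HeightOneSpectrum A) (φ : K →ₐ[k] D) :
    (LocalAlg k v K)ˣ →* (LocalAlg k v D)ˣ :=
  Units.map (localEmb v φ : LocalAlg k v K →* LocalAlg k v D)

theorem unitComponent_adelicUnitsEmb (v : HeightOneSpectrum A) (φ : K →ₐ[k] D)
    (t : (AdelicAlg A k K)ˣ) :
    unitComponent v (adelicUnitsEmb φ t) = localUnitsEmb v φ (unitComponent v t) := by
  refine Units.ext ?_
  have h : (component k v D).comp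
      (Algebra.TensorProduct.map (AlgHom.id k (FiniteAdeleRing A k)) φ) =
      ((localEmb v φ).restrictScalars k).comp (component k v K) := by
    refine Algebra.TensorProduct.ext' fun a x => ?_
    simp [component, localEmb]
  exact AlgHom.congr_fun h t

/-- For optimal $b$, the stabiliser of $bO_{D,v}^*$ in $K_v^*$ is $R_v^*$; place by place this is
the hypothesis `h` of `card_doubleCosets_map`. -/
theorem localUnitsEmb_mem_iff (v : HeightOneSpectrum A) {φ : K →ₐ[k] D} {OD : Subalgebra A D}
    {R : Subalgebra A K} {b : (LocalAlg k v D)ˣ} (hb : b ∈ localOptimal v φ OD R)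
    (t : (LocalAlg k v K)ˣ) :
    b⁻¹ * localUnitsEmb v φ t * b ∈ localUnits v OD ↔ t ∈ localUnits v R := by
  rw [mem_localUnits, mem_localUnits, ← hb, ← hb]
  simp only [mul_inv_rev, inv_inv, ← map_inv, Units.val_mul, mul_assoc]
  rfl

/-- Conjugation by $\phi_v(t)$ is trivial on $\phi_v(K_v)$, as $K_v$ is commutative. -/
theorem localUnitsEmb_mul_mem (v : HeightOneSpectrum A) {φ : K →ₐ[k] D} {OD : Subalgebra A D}
    {R : Subalgebra A K} {b : (LocalAlg k v D)ˣ} (hb : b ∈ localOptimal v φ OD R)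
    (t : (LocalAlg k v K)ˣ) : localUnitsEmb v φ t * b ∈ localOptimal v φ OD R := fun x => by
  rw [← hb x, mul_inv_rev, ← map_inv]
  have : ((b⁻¹ * localUnitsEmb v φ t⁻¹ : (LocalAlg k v D)ˣ) : LocalAlg k v D) * localEmb v φ x *
      ((localUnitsEmb v φ t * b : (LocalAlg k v D)ˣ) : LocalAlg k v D) =
      ↑b⁻¹ * localEmb v φ x * ↑b := by
    have h : localEmb v φ ↑t⁻¹ * (localEmb v φ x * localEmb v φ ↑t) = localEmb v φ x := by
      rw [← map_mul, ← map_mul, mul_comm x, Units.inv_mul_cancel_left]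
    calc _ = ↑b⁻¹ * (localEmb v φ ↑t⁻¹ * (localEmb v φ x * localEmb v φ ↑t)) * ↑b := by
          simp only [Units.val_mul, mul_assoc]
          rfl
      _ = _ := by rw [h]
  rw [this]

/-- An adelic double coset is the same as a family of local double cosets. -/
theorem adelicCosets_equiv (φ : K →ₐ[k] D) (OD : Subalgebra A D) (hOD : IsOrder k OD)
    (R : Subalgebra A K) (hR : IsOrder k R)
    (h1 : {v : HeightOneSpectrum A | (localCosets v φ OD R).ncard ≠ 1}.Finite) :
    Nonempty (doubleCosets (adelicUnitsEmb φ).range (adelicUnits OD) (optimalEmbeddings φ OD R) ≃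
      ∀ v : HeightOneSpectrum A, localCosets v φ OD R) := by
  classical
  have hr : ∀ C : doubleCosets (adelicUnitsEmb φ).range (adelicUnits OD) (optimalEmbeddings φ OD R),
      ∃ b ∈ optimalEmbeddings φ OD R, DoubleCoset.doubleCoset b
        ((adelicUnitsEmb (A := A) φ).range : Set (AdelicAlg A k D)ˣ) (adelicUnits (k := k) OD) = C.1 := by
    rintro ⟨_, b, hb, rfl⟩
    exact ⟨b, hb, rfl⟩
  have hfin := finite_pullbackOrder_ne φ OD hOD R hR
  choose b hbE hb using hr
  have hbv (C) := (mem_optimalEmbeddings_iff φ OD hOD R hR _).1 (hbE C)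
  refine ⟨Equiv.ofBijective (fun C v => ⟨_, unitComponent v (b C), hbv C v, rfl⟩) ⟨?_, ?_⟩⟩
  · intro C C' he
    have h2 (v) := doubleCoset_eq_iff.1 (congrArg Subtype.val (congrFun he v))
    choose h' hh' u hu e using h2
    choose t ht using hh'
    have hfin' := ((finite_unitComponent_notMem OD hOD (b C)).union
      (finite_unitComponent_notMem OD hOD (b C'))).union hfin
    -- The local elements `t v` form an adelic unit: where both representatives are units of
    -- $O_{D,v}$, so is $\phi_v(t_v)$, and where moreover $1$ is optimal this means $t_v\in R_v^*$.
    obtain ⟨s, hs⟩ := exists_unitComponent_eq R hR t (hfin'.subset fun v hv => by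
      by_contra hv'
      simp only [Set.mem_union, Set.mem_ofPred_eq, not_or, not_not] at hv'
      refine hv ?_
      have h3 : (1 : (LocalAlg k v D)ˣ) ∈ localOptimal v φ OD R := mem_localOptimal_iff.2 hv'.2
      rw [← localUnitsEmb_mem_iff v h3, inv_one, one_mul, mul_one]
      have h4 : localUnitsEmb v φ (t v) =
          unitComponent v (b C) * (u v)⁻¹ * (unitComponent v (b C'))⁻¹ := by
        rw [e v]
        change _ = h' v * _ * _ * _ * _
        rw [← ht v, mul_inv_cancel_right, mul_inv_cancel_right]
        rfl
      rw [h4]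
      exact mul_mem (mul_mem hv'.1.1 (inv_mem (hu v))) (inv_mem hv'.1.2))
    rw [Subtype.ext_iff, ← hb, ← hb, doubleCoset_eq_iff]
    refine ⟨_, ⟨s, rfl⟩, (adelicUnitsEmb φ s * b C')⁻¹ * b C, ?_, by group⟩
    refine mem_adelicUnits.2 fun v => ?_
    have h5 : unitComponent v ((adelicUnitsEmb φ s * b C')⁻¹ * b C) = u v := by
      rw [map_mul, map_inv, map_mul, unitComponent_adelicUnitsEmb, hs, e v]
      change _ * (h' v * _ * _) = _
      rw [← ht v]
      change (localUnitsEmb v φ (t v) * _)⁻¹ * (localUnitsEmb v φ (t v) * _ * _) = _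
      group
    rw [h5]
    exact hu v
  · intro Y
    -- The representatives must assemble to an adelic unit, so $1$ is taken wherever it is optimal
    -- and there is only one double coset, which is almost everywhere.
    have hr' : ∀ v, ∃ c ∈ localOptimal v φ OD R, DoubleCoset.doubleCoset c
        (localUnitsImage v φ : Set (LocalAlg k v D)ˣ) (localUnits (k := k) v OD) = (Y v).1 ∧
        (pullbackOrder v φ OD 1 = locSpan v (Subalgebra.toSubmodule R) →
          (localCosets v φ OD R).ncard = 1 → c = 1) := by
      intro v
      by_cases hv : pullbackOrder v φ OD 1 = locSpan v (Subalgebra.toSubmodule R) ∧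
          (localCosets v φ OD R).ncard = 1
      · have h3 : (1 : (LocalAlg k v D)ˣ) ∈ localOptimal v φ OD R := mem_localOptimal_iff.2 hv.1
        refine ⟨1, h3, ?_, fun _ _ => rfl⟩
        obtain ⟨Z, hZ⟩ := Set.ncard_eq_one.1 hv.2
        have h4 : (Y v).1 ∈ localCosets v φ OD R := (Y v).2
        have h5 : DoubleCoset.doubleCoset 1 (localUnitsImage v φ : Set (LocalAlg k v D)ˣ) (localUnits (k := k) v OD) ∈
          localCosets v φ OD R := ⟨1, h3, rfl⟩
        exact (hZ.le h5).trans (hZ.le h4).symm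
      · obtain ⟨_, c, hc, hc'⟩ := Y v
        exact ⟨c, hc, hc', fun h h' => (hv ⟨h, h'⟩).elim⟩
    choose c hc hcY hc1 using hr'
    obtain ⟨a, ha⟩ := exists_unitComponent_eq OD hOD c ((hfin.union h1).subset fun v hv => by
      by_contra hv'
      simp only [Set.mem_union, Set.mem_ofPred_eq, not_or, not_not] at hv'
      exact hv (hc1 v hv'.1 hv'.2 ▸ one_mem _))
    have haE : a ∈ optimalEmbeddings φ OD R :=
      (mem_optimalEmbeddings_iff φ OD hOD R hR _).2 fun v => ha v ▸ hc v
    refine ⟨⟨_, a, haE, rfl⟩, funext fun v => Subtype.ext ?_⟩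
    change DoubleCoset.doubleCoset _ _ _ = _
    rw [← hcY v, ← ha v]
    obtain ⟨_, ⟨s, rfl⟩, u, hu, e⟩ := doubleCoset_eq_iff.1 (hb ⟨_, a, haE, rfl⟩)
    rw [e, map_mul, map_mul, unitComponent_adelicUnitsEmb]
    exact doubleCoset_eq_of_eq ⟨_, rfl⟩ (mem_adelicUnits.1 hu v) rfl

theorem finite_optimalCosets (φ : K →ₐ[k] D) (OD : Subalgebra A D) (hOD : IsOrder k OD)
    (R : Subalgebra A K) (hR : IsOrder k R) (hcl : (classSet k R).Finite)
    (hloc : ∀ v : HeightOneSpectrum A, (localCosets v φ OD R).Finite)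
    (h1 : {v : HeightOneSpectrum A | (localCosets v φ OD R).ncard ≠ 1}.Finite) :
    (doubleCosets (globalUnitsImage A φ) (adelicUnits OD) (optimalEmbeddings φ OD R)).Finite ∧
    (doubleCosets (globalUnitsImage A φ) (adelicUnits OD) (optimalEmbeddings φ OD R)).ncard =
      classNumber k R * ∏ᶠ v : HeightOneSpectrum A, (localCosets v φ OD R).ncard := by
  have hH : globalUnitsImage A φ =
      (globalUnitsImage A (AlgHom.id k K)).map (adelicUnitsEmb (A := A) φ) := by
    rw [globalUnitsImage, globalUnitsImage, MonoidHom.map_range]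
    congr 1
  have hopt := mem_optimalEmbeddings_iff φ OD hOD R hR
  obtain ⟨e⟩ := card_doubleCosets_map (T := (AdelicAlg A k K)ˣ) (adelicUnitsEmb (A := A) φ)
    (globalUnitsImage A (AlgHom.id k K)) (adelicUnits R) (adelicUnits OD)
    (optimalEmbeddings φ OD R)
    (fun t b hb => (hopt _).2 fun v => by
      rw [map_mul, unitComponent_adelicUnitsEmb]
      exact localUnitsEmb_mul_mem v ((hopt _).1 hb v) _)
    (fun b hb t => by
      rw [mem_adelicUnits, mem_adelicUnits]
      refine forall_congr' fun v => ?_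
      rw [map_mul, map_mul, map_inv, unitComponent_adelicUnitsEmb,
        localUnitsEmb_mem_iff v ((hopt _).1 hb v)])
  obtain ⟨e'⟩ := adelicCosets_equiv φ OD hOD R hR h1
  obtain ⟨hf, hc⟩ := card_pi_of_finite (fun v : HeightOneSpectrum A => localCosets v φ OD R)
    (fun v => (hloc v).to_subtype) h1
  rw [← hH] at e
  have e'' := e.trans ((Equiv.refl _).prodCongr e')
  have hcl' : Finite (doubleCosets (globalUnitsImage A (AlgHom.id k K)) (adelicUnits R)
    Set.univ) := hcl.to_subtype
  refine ⟨Set.finite_coe_iff.1 (Finite.of_equiv _ e''.symm), ?_⟩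
  rw [← Nat.card_coe_set_eq, Nat.card_congr e'', Nat.card_prod, hc]
  rfl

end AdelicDoubleCosets

/-! ### The commutant of $K$ and of $K_v$, and cyclic vectors. -/

section Centralizer

open Module Polynomial

variable {k K D : Type*} [Field k] [Field K] [Algebra k K] [DivisionRing D] [Algebra k D]
  {r : ℕ}

/-- In prime degree there are no intermediate fields, so any element outside $k$ generates,
separable or not. -/
theorem exists_primitive (hr : r.Prime) (hK : finrank k K = r) :
    ∃ α : K, ∀ x : K, ∃ p : k[X], aeval α p = x := by
  have hp : (finrank k K).Prime := hK ▸ hr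
  have : FiniteDimensional k K := FiniteDimensional.of_finrank_pos hp.pos
  have hs := IntermediateField.isSimpleOrder_of_finrank_prime k K hp
  obtain ⟨α, hα⟩ : ∃ α : K, α ∉ (⊥ : IntermediateField k K) := by
    by_contra! h
    exact bot_ne_top (α := IntermediateField k K) (eq_top_iff.2 fun x (_ : x ∈ ⊤) => h x)
  refine ⟨α, fun x => ?_⟩
  have h1 : IntermediateField.adjoin k {α} = ⊤ :=
    (hs.eq_bot_or_eq_top _).resolve_left fun h =>
      hα (h ▸ IntermediateField.mem_adjoin_simple_self k α)
  have h2 : x ∈ (IntermediateField.adjoin k {α}).toSubalgebra := by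
    rw [h1]; trivial
  rw [IntermediateField.adjoin_simple_toSubalgebra_of_isAlgebraic
    (Algebra.IsAlgebraic.isAlgebraic α)] at h2
  rwa [Algebra.adjoin_singleton_eq_range_aeval] at h2

/-- The commutant is a division algebra over $k$ containing $K$; its dimension is a multiple of $r$
and divides $r^2$. Dimension $r^2$ would put $\phi(K)$ in the centre $k$, so the dimension is $r$.
-/
theorem centralizer_le_range [Algebra.IsCentral k D] (hr : r.Prime) (hD : finrank k D = r ^ 2)
    (hK : finrank k K = r) (φ : K →ₐ[k] D) (y : D) (hy : ∀ x : K, φ x * y = y * φ x) :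
    y ∈ φ.range := by
  have hfD : FiniteDimensional k D := FiniteDimensional.of_finrank_pos (by
    rw [hD]; exact pow_pos hr.pos 2)
  let C := Subalgebra.centralizer k (φ.range : Set D)
  have hC (x : K) : φ x ∈ C := by
    rw [Subalgebra.mem_centralizer_iff]
    rintro _ ⟨z, rfl⟩
    change φ z * φ x = φ x * φ z
    rw [← map_mul, ← map_mul, mul_comm]
  have hyC : y ∈ C := by
    rw [Subalgebra.mem_centralizer_iff]
    rintro _ ⟨z, rfl⟩
    exact hy z
  let φ' : K →ₐ[k] C := φ.codRestrict C hC
  let _ : Module K C := Module.compHom C φ'.toRingHom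
  have : IsScalarTower k K C := ⟨fun a b c => by
    change φ' (a • b) * c = a • (φ' b * c)
    rw [map_smul, smul_mul_assoc]⟩
  have h1 := finrank_mul_finrank k K C
  let _ : DivisionRing C := divisionRingOfFiniteDimensional k C
  have h2 := finrank_mul_finrank k C D
  rw [hD] at h2
  rw [hK] at h1
  obtain ⟨i, hi, hi'⟩ := (Nat.dvd_prime_pow hr).1 (Dvd.intro _ h2)
  have hi0 : i ≠ 0 := by
    rintro rfl
    rw [pow_zero] at hi'
    rw [hi'] at h1
    exact hr.one_lt.ne' (Nat.eq_one_of_mul_eq_one_right h1)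
  obtain rfl | rfl : i = 1 ∨ i = 2 := by omega
  · have h3 : φ.range.toSubmodule = C.toSubmodule := by
      refine Submodule.eq_of_le_of_finrank_eq ?_ ?_
      · rintro _ ⟨x, rfl⟩
        exact hC x
      · have h4 : finrank k φ.range = r :=
          hK ▸ (AlgEquiv.ofInjectiveField φ).toLinearEquiv.finrank_eq.symm
        rw [pow_one] at hi'
        exact h4.trans hi'.symm
    have : y ∈ C.toSubmodule := hyC
    rwa [← h3] at this
  · have h3 : C.toSubmodule = ⊤ := Submodule.eq_top_of_finrank_eq (hi'.trans hD.symm)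
    have h4 (x : K) : φ x ∈ (⊥ : Subalgebra k D) := by
      rw [← Algebra.IsCentral.center_eq_bot k D, Subalgebra.mem_center_iff]
      intro d
      have hd : d ∈ C.toSubmodule := h3 ▸ Submodule.mem_top
      exact ((Subalgebra.mem_centralizer_iff k).1 hd _ ⟨x, rfl⟩).symm
    have h5 : finrank k K ≤ finrank k (⊥ : Subalgebra k D) :=
      LinearMap.finrank_le_finrank_of_injective
        (f := (φ.codRestrict (⊥ : Subalgebra k D) h4).toLinearMap)
        fun a b h => φ.toRingHom.injective (congrArg Subtype.val h)
    rw [Subalgebra.finrank_bot, hK] at h5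
    exact absurd hr.one_lt (not_lt.2 h5)

theorem commute_of_primitive {α : K} (hα : ∀ x : K, ∃ p : k[X], aeval α p = x) (φ : K →ₐ[k] D)
    {y : D} (hy : φ α * y = y * φ α) (x : K) : φ x * y = y * φ x := by
  obtain ⟨p, rfl⟩ := hα x
  rw [← aeval_algHom_apply]
  have h : Commute y (φ α) := hy.symm
  have h2 : y ∈ Subalgebra.centralizer k {φ α} := by
    rw [Subalgebra.mem_centralizer_iff]
    rintro _ rfl
    exact hy
  have h3 : aeval (φ α) p ∈ Algebra.adjoin k {φ α} := aeval_mem_adjoin_singleton k _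
  have h4 : Algebra.adjoin k {φ α} ≤ Subalgebra.centralizer k {y} :=
    Algebra.adjoin_le (by
      rintro _ rfl
      rw [SetLike.mem_coe, Subalgebra.mem_centralizer_iff]
      rintro _ rfl
      exact hy.symm)
  exact ((Subalgebra.mem_centralizer_iff k).1 (h4 h3) y rfl).symm

/-- Over $k$, the image of $K$ is the kernel of the commutator with $\phi(\alpha)$. This exact
sequence stays exact after the flat base change to `F`. -/
theorem mem_range_map_of_commute [Algebra.IsCentral k D] (hr : r.Prime)
    (hD : finrank k D = r ^ 2) (hK : finrank k K = r) (φ : K →ₐ[k] D) (F : Type*) [Field F]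
    [Algebra k F] {α : K} (hα : ∀ x : K, ∃ p : k[X], aeval α p = x) (y : F ⊗[k] D)
    (hy : (1 ⊗ₜ φ α) * y = y * (1 ⊗ₜ φ α)) :
    y ∈ (Algebra.TensorProduct.map (AlgHom.id F F) φ).range := by
  let δ : D →ₗ[k] D := LinearMap.mulLeft k (φ α) - LinearMap.mulRight k (φ α)
  have hex : Function.Exact φ.toLinearMap δ := fun d => by
    have : δ d = φ α * d - d * φ α := rfl
    rw [this, sub_eq_zero]
    constructor
    · exact fun h => centralizer_le_range hr hD hK φ d (commute_of_primitive hα φ h)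
    · rintro ⟨x, rfl⟩
      change φ α * φ x = φ x * φ α
      rw [← map_mul, ← map_mul, mul_comm]
  have h1 : ∀ z : F ⊗[k] D, δ.lTensor F z = (1 ⊗ₜ φ α) * z - z * (1 ⊗ₜ φ α) := by
    intro z
    induction z using TensorProduct.induction_on with
    | zero => simp
    | add z w hz hw => rw [map_add, hz, hw]; noncomm_ring
    | tmul c d =>
      rw [LinearMap.lTensor_tmul, Algebra.TensorProduct.tmul_mul_tmul,
        Algebra.TensorProduct.tmul_mul_tmul, one_mul, mul_one, ← TensorProduct.tmul_sub]
      rfl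
  obtain ⟨x, hx⟩ := (Module.Flat.lTensor_exact F hex y).1 (by rw [h1, hy, sub_self])
  exact ⟨x, hx⟩

theorem exists_aeval_tmul (F : Type*) [Field F] [Algebra k F] {α : K}
    (hα : ∀ x : K, ∃ p : k[X], aeval α p = x) (y : F ⊗[k] K) :
    ∃ p : F[X], aeval (1 ⊗ₜ[k] α : F ⊗[k] K) p = y := by
  induction y using TensorProduct.induction_on with
  | zero => exact ⟨0, by simp⟩
  | add z w hz hw =>
    obtain ⟨p, rfl⟩ := hz
    obtain ⟨q, rfl⟩ := hw
    exact ⟨p + q, map_add _ _ _⟩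
  | tmul c x =>
    obtain ⟨p, rfl⟩ := hα x
    refine ⟨C c * p.map (algebraMap k F), ?_⟩
    rw [map_mul, aeval_C, aeval_map_algebraMap]
    have : (1 ⊗ₜ[k] α : F ⊗[k] K) = (Algebra.TensorProduct.includeRight : K →ₐ[k] F ⊗[k] K) α := rfl
    rw [this, aeval_algHom_apply, Algebra.TensorProduct.algebraMap_apply,
      Algebra.TensorProduct.includeRight_apply, Algebra.TensorProduct.tmul_mul_tmul]
    simp

/-- If `x` generates a commutative algebra `E` acting faithfully on `V`, there is a vector on which
`E` acts freely. -/
theorem exists_cyclic_vector {F E V : Type*} [Field F] [CommRing E] [Algebra F E]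
    [AddCommGroup V] [Module F V] [FiniteDimensional F V] (ρ : E →ₐ[F] Module.End F V)
    (hρ : Function.Injective ρ) {x : E} (hx : ∀ y : E, ∃ p : F[X], aeval x p = y) :
    ∃ e : V, ∀ y : E, ρ y e = 0 → y = 0 := by
  let M := Module.AEval' (ρ x)
  have : Module.Finite F[X] M := inferInstance
  -- View `V` as a module over `F[X]` with `X` acting by `x`: some vector has the same annihilator
  -- as the whole module. Semisimplicity is not needed.
  obtain ⟨e', he⟩ := Module.exists_ker_toSpanSingleton_eq_annihilator F[X] M
  obtain ⟨e, rfl⟩ := (AEval'.of (ρ x)).surjective e'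
  refine ⟨e, fun y hy => ?_⟩
  obtain ⟨p, rfl⟩ := hx y
  rw [← aeval_algHom_apply] at hy
  have h1 : p ∈ LinearMap.ker (LinearMap.toSpanSingleton F[X] M (AEval'.of (ρ x) e)) := by
    rw [LinearMap.mem_ker, LinearMap.toSpanSingleton_apply, ← AEval.of_aeval_smul,
      Module.End.smul_def, hy, map_zero]
  rw [he, AEval.annihilator_eq_ker_aeval] at h1
  refine (map_eq_zero_iff ρ hρ).1 ?_
  rw [← aeval_algHom_apply]
  exact h1

end Centralizer

/-! ### Maximal orders as stabilisers of lattices. -/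

section Lattices

open Module

variable {O F V : Type*} [CommRing O] [IsDomain O] [Field F] [Algebra O F]
  [IsFractionRing O F] [AddCommGroup V] [Module F V] [Module O V] [IsScalarTower O F V]
  [FiniteDimensional F V]

/-- A maximal order acting on `V` is the stabiliser of a lattice. -/
theorem exists_stable_lattice [IsNoetherianRing O] {E : Type*} [Ring E] [Algebra O E] [Algebra F E]
    [IsScalarTower O F E] (ρ : E →ₐ[F] Module.End F V) (hρ : Function.Injective ρ)
    (S : Subalgebra O E) (hS : IsMaximalOrder F S) :
    ∃ L : Submodule O V, L.IsLattice F ∧ ∀ x, x ∈ S ↔ ∀ l ∈ L, ρ x l ∈ L := by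
  let b := Module.finBasis F V
  have hSl : (Subalgebra.toSubmodule S).IsLattice F := hS.1
  let e (i) : E →ₗ[O] V :=
    { toFun := fun x => ρ x (b i)
      map_add' := by simp
      map_smul' := fun a x => by
        rw [← algebraMap_smul F a x, map_smul, LinearMap.smul_apply, algebraMap_smul]
        rfl }
  let L : Submodule O V := ⨆ i, (Subalgebra.toSubmodule S).map (e i)
  have hbL (i) : b i ∈ L := Submodule.mem_iSup_of_mem i ⟨1, S.one_mem, by simp [e]⟩
  have hLfg : L.FG := Submodule.fg_iSup _ fun i => hSl.fg.map _
  have hSL (x) (hx : x ∈ S) : ∀ l ∈ L, ρ x l ∈ L := by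
    have : L ≤ L.comap ((ρ x).restrictScalars O) := by
      refine iSup_le fun i => ?_
      rw [Submodule.map_le_iff_le_comap]
      intro y hy
      refine Submodule.mem_iSup_of_mem i ⟨x * y, S.mul_mem hx hy, ?_⟩
      simp [e]
    exact this
  have hL : L.IsLattice F := ⟨hLfg, by
    rw [eq_top_iff, ← b.span_eq, Submodule.span_le]
    rintro _ ⟨i, rfl⟩
    exact Submodule.subset_span (hbL i)⟩
  let S' : Subalgebra O E :=
    { carrier := {x | ∀ l ∈ L, ρ x l ∈ L}
      mul_mem' := fun hx hy l hl => by
        rw [map_mul]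
        exact hx _ (hy _ hl)
      add_mem' := fun hx hy l hl => by
        rw [map_add]
        exact L.add_mem (hx _ hl) (hy _ hl)
      algebraMap_mem' := fun a l hl => by
        rw [IsScalarTower.algebraMap_apply O F E, AlgHom.commutes, Module.algebraMap_end_apply,
          algebraMap_smul]
        exact L.smul_mem a hl }
  have hS'S : S ≤ S' := fun x hx => hSL x hx
  -- An element of the stabiliser is determined by its values on the basis, which lie in `L`; so
  -- `S'` embeds in a finite power of `L`.
  have hS' : IsOrder F S' := by
    refine ⟨?_, ?_⟩
    · have : Module.Finite O L := Module.Finite.iff_fg.2 hLfg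
      let g : Subalgebra.toSubmodule S' →ₗ[O] (Fin (finrank F V) → L) :=
        LinearMap.pi fun i => (e i).restrict (p := Subalgebra.toSubmodule S') fun x hx => hx _ (hbL i)
      have hg : Function.Injective g := fun x y h => Subtype.ext <| hρ <| b.ext fun i =>
        congrArg Subtype.val (congrFun h i)
      exact Module.Finite.iff_fg.1 (Module.Finite.of_injective g hg)
    · rw [eq_top_iff, ← hSl.span_eq_top]
      exact Submodule.span_mono hS'S
  have hSS' : S' = S := le_antisymm (hS.2 hS' hS'S) hS'S
  exact ⟨L, hL, fun x => by rw [← hSS']; rfl⟩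

/-- All lattices in `V` are isomorphic. -/
theorem exists_equiv_lattice [IsPrincipalIdealRing O] (L L' : Submodule O V) (hL : L.IsLattice F)
    (hL' : L'.IsLattice F) : ∃ g : V ≃ₗ[F] V, ∀ l, l ∈ L' ↔ g l ∈ L := by
  have : IsTorsionFree O F := inferInstance
  let b := (Module.Free.chooseBasis O L)
  let b' := (Module.Free.chooseBasis O L')
  let c := b.extendOfIsLattice F
  let c' := b'.extendOfIsLattice F
  let g := c'.equiv c (Fintype.equivOfCardEq (by
    rw [← Module.finrank_eq_card_basis c, ← Module.finrank_eq_card_basis c']))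
  have key (N : Submodule O V) {ι : Type _} (d : Basis ι O N) :
      Submodule.span O (Set.range fun i => (d i : V)) = N := by
    have h := congrArg (Submodule.map N.subtype) d.span_eq
    rw [Submodule.map_span, ← Set.range_comp, Submodule.map_top, Submodule.range_subtype] at h
    exact h
  have h : L'.map (g.toLinearMap.restrictScalars O) = L := by
    rw [← key L' b', ← key L b, Submodule.map_span, ← Set.range_comp]
    congr 1
    have : (⇑(g.toLinearMap.restrictScalars O) ∘ fun i => (b' i : V)) = fun i =>
        (b (Fintype.equivOfCardEq (by
    rw [← Module.finrank_eq_card_basis c, ← Module.finrank_eq_card_basis c']) i) : V) := by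
      funext i
      rw [← b.extendOfIsLattice_apply F, Function.comp_apply, ← b'.extendOfIsLattice_apply F]
      exact c'.equiv_apply _ _ _
    rw [this]
    exact (Equiv.surjective _).range_comp (fun i => (b i : V))
  refine ⟨g, fun l => ?_⟩
  rw [← h, Submodule.mem_map]
  exact ⟨fun hl => ⟨l, hl, rfl⟩, fun ⟨m, hm, e⟩ => g.injective e ▸ hm⟩

theorem equiv_image_of_surjective {α β γ : Type*} {F : α → β} {E : Set α} (g : E → γ)
    (hg : Function.Surjective g) (h : ∀ a b : E, F a = F b ↔ g a = g b) :
    Nonempty (F '' E ≃ γ) := by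
  choose s hs using hg
  refine ⟨(Equiv.ofBijective (fun c => (⟨F (s c), _, (s c).2, rfl⟩ : F '' E)) ⟨?_, ?_⟩).symm⟩
  · intro c c' hcc
    rw [← hs c, ← hs c', ← h]
    exact congrArg Subtype.val hcc
  · rintro ⟨_, a, ha, rfl⟩
    exact ⟨g ⟨a, ha⟩, Subtype.ext ((h _ ⟨a, ha⟩).2 (hs _))⟩

theorem exists_unit_of_equiv {E : Type*} [Ring E] [Algebra F E] (ρ : E ≃ₐ[F] Module.End F V)
    (g : V ≃ₗ[F] V) : ∃ s : Eˣ, (∀ l, ρ s l = g l) ∧ ∀ l, ρ ↑s⁻¹ l = g.symm l := by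
  have h1 : (g.toLinearMap * g.symm.toLinearMap : Module.End F V) = 1 :=
    LinearMap.ext g.apply_symm_apply
  have h2 : (g.symm.toLinearMap * g.toLinearMap : Module.End F V) = 1 :=
    LinearMap.ext g.symm_apply_apply
  refine ⟨⟨ρ.symm g.toLinearMap, ρ.symm g.symm.toLinearMap, by rw [← map_mul, h1, map_one],
    by rw [← map_mul, h2, map_one]⟩, fun l => ?_, fun l => ?_⟩
  · exact LinearMap.congr_fun (ρ.apply_symm_apply _) l
  · exact LinearMap.congr_fun (ρ.apply_symm_apply _) l

end Lattices

/-! ### Split places: double cosets as classes of optimal lattices. -/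

section Split

open HeightOneSpectrum Module

variable {A k K D : Type*} [CommRing A] [IsDedekindDomain A] [Field k]
  [Algebra A k] [IsFractionRing A k] [Field K] [Algebra k K] [Algebra A K] [IsScalarTower A k K]
  [FiniteDimensional k K] [DivisionRing D] [Algebra k D] [Algebra A D] [IsScalarTower A k D]
  [FiniteDimensional k D]

/-- A larger order at $v$, together with $O_{D,w}$ at the other places, glues to a global order
containing $O_D$, which must equal $O_D$. -/
theorem isMaximalOrder_localOrder (v : HeightOneSpectrum A) (OD : Subalgebra A D)
    (hOD : IsMaximalOrder k OD) : IsMaximalOrder (v.adicCompletion k) (localOrder (k := k) v OD) := by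
  classical
  refine ⟨isOrder_localOrder v OD hOD.1, fun S hS hle => ?_⟩
  have h1 : (Subalgebra.toSubmodule OD).IsLattice k := hOD.1
  obtain ⟨M, hM, hMv, hMw, hMg⟩ := exists_globLat_single OD hOD.1 v (Subalgebra.toSubmodule S) hS
  have key (w : HeightOneSpectrum A) : ∃ S' : Subalgebra (w.adicCompletionIntegers k)
      (LocalAlg k w D), localOrder w OD ≤ S' ∧ Function.update
        (fun w => locSpan (k := k) w (Subalgebra.toSubmodule OD)) v (Subalgebra.toSubmodule S) w =
          Subalgebra.toSubmodule S' := by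
    by_cases hw : w = v
    · subst hw
      exact ⟨S, hle, Function.update_self _ _ _⟩
    · exact ⟨localOrder w OD, le_rfl,
        (Function.update_of_ne hw _ _).trans (toSubmodule_localOrder w OD).symm⟩
  choose S' hS'1 hS'2 using key
  have hmem (x : D) : x ∈ M ↔ ∀ w, (1 ⊗ₜ x : LocalAlg k w D) ∈ S' w := by
    rw [hMg, mem_globLat]
    refine forall_congr' fun w => ?_
    rw [hS'2, Subalgebra.mem_toSubmodule]
  have hone : (1 : D) ∈ M := (hmem _).2 fun w => (S' w).one_mem
  let S₁ : Subalgebra A D := M.toSubalgebra hone fun x y hx hy => (hmem _).2 fun w => by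
    have := (S' w).mul_mem ((hmem x).1 hx w) ((hmem y).1 hy w)
    rwa [Algebra.TensorProduct.tmul_mul_tmul, one_mul] at this
  have hS₁ : Subalgebra.toSubmodule S₁ = M := Submodule.toSubalgebra_toSubmodule _ _ _
  have h2 : OD ≤ S₁ := fun x hx => (hmem x).2 fun w =>
    hS'1 w ((mem_localOrder_iff _ _ _).2 (tmul_mem_locSpan w hx))
  have h3 : S₁ ≤ OD := hOD.2 (show IsOrder k S₁ by rw [IsOrder, hS₁]; exact hM) h2
  have h4 : M ≤ Subalgebra.toSubmodule OD := by
    rw [← hS₁]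
    exact h3
  intro x hx
  rw [mem_localOrder_iff]
  exact locSpan_mono v h4 (hMv ▸ hx)

variable {r : ℕ} {v : HeightOneSpectrum A}

/-- With $O_{D,v}$ the stabiliser of $L$, the classes $bO_{D,v}^*$ are the lattices $bL$, and $b$ is
optimal iff $bL$ is. An isomorphism of optimal lattices commutes with $K_v$, hence comes from
$K_v^*$. -/
theorem card_localCosets_of_split [Algebra.IsCentral k D] (hr : r.Prime) (hD : finrank k D = r ^ 2)
    (hK : finrank k K = r) (φ : K →ₐ[k] D) (OD : Subalgebra A D) (hOD : IsMaximalOrder k OD)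
    (R : Subalgebra A K)
    (θ : LocalAlg k v D ≃ₐ[v.adicCompletion k] Matrix (Fin r) (Fin r) (v.adicCompletion k)) :
    Nonempty (localCosets v φ OD R ≃ Quotient (latticeSetoid v φ R θ)) := by
  let ρ : LocalAlg k v D ≃ₐ[v.adicCompletion k]
      Module.End (v.adicCompletion k) (Fin r → v.adicCompletion k) :=
    θ.trans Matrix.toLinAlgEquiv'
  have hρ (x l) : (θ x).mulVec l = ρ x l := rfl
  obtain ⟨L, hL, hLS⟩ := exists_stable_lattice ρ.toAlgHom ρ.injective _
    (isMaximalOrder_localOrder v OD hOD)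
  change ∀ x, _ ↔ ∀ l ∈ L, ρ x l ∈ L at hLS
  have hρi (b : (LocalAlg k v D)ˣ) (l) : ρ ↑b⁻¹ (ρ b l) = l := by
    rw [← Module.End.mul_apply, ← map_mul, Units.inv_mul, map_one, Module.End.one_apply]
  have hρi' (b : (LocalAlg k v D)ˣ) (l) : ρ b (ρ ↑b⁻¹ l) = l := by
    rw [← Module.End.mul_apply, ← map_mul, Units.mul_inv, map_one, Module.End.one_apply]
  let lat (b : (LocalAlg k v D)ˣ) : Submodule (v.adicCompletionIntegers k)
      (Fin r → v.adicCompletion k) := L.comap ((ρ ↑b⁻¹).restrictScalars _)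
  have hlat (b l) : l ∈ lat b ↔ ρ ↑b⁻¹ l ∈ L := Iff.rfl
  have hlatL (b) : (lat b).IsLattice (v.adicCompletion k) :=
    isLattice_comap (A := v.adicCompletionIntegers k) _
      (Function.LeftInverse.injective (g := ρ b) (hρi' b)) L hL
  have hopt (b : (LocalAlg k v D)ˣ) : b ∈ localOptimal v φ OD R ↔ ∀ x : LocalAlg k v K,
      (∀ l ∈ lat b, (θ (localEmb v φ x)).mulVec l ∈ lat b) ↔ x ∈ localOrder v R := by
    refine forall_congr' fun x => ?_
    have : (∀ l ∈ lat b, (θ (localEmb v φ x)).mulVec l ∈ lat b) ↔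
        ↑b⁻¹ * localEmb v φ x * ↑b ∈ localOrder v OD := by
      rw [hLS]
      simp only [hρ, map_mul, Module.End.mul_apply]
      refine ⟨fun h l hl => ?_, fun h l hl => ?_⟩
      · exact h _ (by rwa [hlat, hρi])
      · have := h _ ((hlat b l).1 hl)
        rwa [hρi'] at this
    rw [this]
  let opt (b : localOptimal v φ OD R) : OptimalLattice v φ R θ :=
    ⟨lat b, hlatL b, (hopt b).1 b.2⟩
  refine equiv_image_of_surjective (fun b => Quotient.mk _ (opt b)) ?_ ?_
  · intro q
    induction q using Quotient.inductionOn with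
    | h N =>
    obtain ⟨N, hN, hNR⟩ := N
    obtain ⟨g, hg⟩ := exists_equiv_lattice (O := v.adicCompletionIntegers k) L N hL hN
    obtain ⟨b, -, hb'⟩ := exists_unit_of_equiv ρ g.symm
    have hb : lat b = N := by
      ext l
      rw [hlat, hg, hb', LinearEquiv.symm_symm]
    subst hb
    exact ⟨⟨b, (hopt b).2 hNR⟩, rfl⟩
  · rintro ⟨b, hb⟩ ⟨b', hb'⟩
    rw [doubleCoset_eq_iff]
    refine Iff.trans ?_ Quotient.eq.symm
    constructor
    · rintro ⟨_, ⟨t, rfl⟩, u, hu, e⟩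
      change b = _ at e
      change b = (localUnitsEmb v φ t) * b' * u at e
      obtain ⟨hu1, hu2⟩ := mem_localUnits.1 hu
      rw [hLS] at hu1 hu2
      let s := localUnitsEmb v φ t
      let g : (Fin r → v.adicCompletion k) ≃ₗ[v.adicCompletion k] (Fin r → v.adicCompletion k) :=
        LinearEquiv.ofLinearMap (ρ ↑s⁻¹) (ρ s) (LinearMap.ext fun l => hρi s l)
          (LinearMap.ext fun l => hρi' s l)
      refine ⟨g, fun l => ?_, fun α l _ => ?_⟩
      · change l ∈ lat b ↔ ρ ↑s⁻¹ l ∈ lat b'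
        have h1 : ρ ↑b⁻¹ l = ρ ↑u⁻¹ (ρ ↑b'⁻¹ (ρ ↑s⁻¹ l)) := by
          rw [e]
          simp only [mul_inv_rev, Units.val_mul, map_mul, Module.End.mul_apply]
          rfl
        rw [hlat, hlat, h1]
        refine ⟨fun h => ?_, hu2 _⟩
        have := hu1 _ h
        rwa [hρi'] at this
      · change ρ ↑s⁻¹ (ρ (localEmb v φ α) l) = ρ (localEmb v φ α) (ρ ↑s⁻¹ l)
        rw [← Module.End.mul_apply, ← Module.End.mul_apply, ← map_mul, ← map_mul]
        congr 2
        have : (↑s⁻¹ : LocalAlg k v D) = localEmb v φ ↑t⁻¹ := by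
          rw [← map_inv]
          rfl
        rw [this, ← map_mul, ← map_mul, mul_comm]
    · rintro ⟨g, hg1, hg2⟩
      obtain ⟨s, hs, -⟩ := exists_unit_of_equiv ρ g
      -- The commutation is given on the lattice only, but the lattice spans $V$. Then `s` and its
      -- inverse both lie in the commutant $\phi_v(K_v)$, and `s` comes from a unit of $K_v$.
      have hcomm (α : LocalAlg k v K) : localEmb v φ α * s = s * localEmb v φ α := by
        apply ρ.injective
        rw [map_mul, map_mul]
        refine LinearMap.ext_on (hlatL b).span_eq_top fun l hl => ?_
        rw [Module.End.mul_apply, Module.End.mul_apply, hs, hs]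
        exact (hg2 α l hl).symm
      obtain ⟨α, hα⟩ := exists_primitive hr hK
      have hrange (y : LocalAlg k v D) (hy : ∀ α, localEmb v φ α * y = y * localEmb v φ α) :
          ∃ t, localEmb v φ t = y := by
        refine mem_range_map_of_commute hr hD hK φ _ hα y ?_
        have := hy (1 ⊗ₜ α)
        rwa [localEmb, Algebra.TensorProduct.map_tmul, map_one] at this
      obtain ⟨t, ht⟩ := hrange s hcomm
      obtain ⟨t', ht'⟩ := hrange ↑s⁻¹ fun α => by
        rw [Units.eq_inv_mul_iff_mul_eq, ← mul_assoc, ← hcomm, mul_assoc, Units.mul_inv, mul_one]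
      let tu : (LocalAlg k v K)ˣ := Units.mk t t'
        (localEmb_injective v φ (by rw [map_mul, ht, ht', Units.mul_inv, map_one]))
        (localEmb_injective v φ (by rw [map_mul, ht, ht', Units.inv_mul, map_one]))
      have htu : localUnitsEmb v φ tu = s := Units.ext ht
      refine ⟨s⁻¹, inv_mem ⟨tu, htu⟩, b'⁻¹ * s * b, ?_, by group⟩
      have hgL (l) : ρ ↑b⁻¹ l ∈ L ↔ ρ ↑b'⁻¹ (ρ s l) ∈ L := by
        rw [← hlat, ← hlat, hs]
        exact hg1 l
      rw [mem_localUnits, hLS, hLS]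
      simp only [mul_inv_rev, inv_inv, Units.val_mul, map_mul, Module.End.mul_apply]
      constructor
      · intro l hl
        rw [← hgL, hρi]
        exact hl
      · intro l hl
        rw [hgL, hρi', hρi]
        exact hl

end Split

/-! ### Finiteness and generic triviality of the split local factors. -/

section SplitCount

open HeightOneSpectrum Module

variable {A k K D : Type*} [CommRing A] [IsDedekindDomain A] [Field k]
  [Algebra A k] [IsFractionRing A k] [Field K] [Algebra k K] [Algebra A K] [IsScalarTower A k K]
  [FiniteDimensional k K] [DivisionRing D] [Algebra k D] [Algebra A D] [IsScalarTower A k D]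
  [FiniteDimensional k D] {r : ℕ} {v : HeightOneSpectrum A}

/-- `k_v^r` is free of rank one over `K_v`. -/
theorem exists_equiv_of_split (hr : r.Prime) (hK : finrank k K = r) (φ : K →ₐ[k] D)
    (θ : LocalAlg k v D ≃ₐ[v.adicCompletion k] Matrix (Fin r) (Fin r) (v.adicCompletion k)) :
    ∃ ev : LocalAlg k v K ≃ₗ[v.adicCompletion k] (Fin r → v.adicCompletion k),
      ∀ x y, ev (x * y) = (θ (localEmb v φ x)).mulVec (ev y) := by
  let ψ : LocalAlg k v K →ₐ[v.adicCompletion k]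
      Module.End (v.adicCompletion k) (Fin r → v.adicCompletion k) :=
    (θ.trans Matrix.toLinAlgEquiv').toAlgHom.comp (localEmb v φ)
  have hψ : Function.Injective ψ :=
    (θ.trans Matrix.toLinAlgEquiv').injective.comp (localEmb_injective v φ)
  obtain ⟨α, hα⟩ := exists_primitive hr hK
  obtain ⟨e, he⟩ := exists_cyclic_vector ψ hψ (exists_aeval_tmul (v.adicCompletion k) hα)
  let f : LocalAlg k v K →ₗ[v.adicCompletion k] (Fin r → v.adicCompletion k) :=
    (LinearMap.applyₗ e).comp ψ.toLinearMap
  have hf : Function.Injective f := (injective_iff_map_eq_zero f).2 he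
  have hdim : finrank (v.adicCompletion k) (LocalAlg k v K) =
      finrank (v.adicCompletion k) (Fin r → v.adicCompletion k) := by
    rw [finrank_baseChange, hK, finrank_fin_fun]
  refine ⟨LinearMap.linearEquivOfInjective f hf hdim, fun x y => ?_⟩
  rw [LinearMap.linearEquivOfInjective_apply, LinearMap.linearEquivOfInjective_apply]
  change ψ (x * y) e = ψ x (ψ y e)
  rw [map_mul, Module.End.mul_apply]

variable {φ : K →ₐ[k] D} {R : Subalgebra A K}
  {θ : LocalAlg k v D ≃ₐ[v.adicCompletion k] Matrix (Fin r) (Fin r) (v.adicCompletion k)}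
  {ev : LocalAlg k v K ≃ₗ[v.adicCompletion k] (Fin r → v.adicCompletion k)}

/-- The lattice in `K_v` that corresponds to an optimal lattice. -/
def OptimalLattice.toField (ev : LocalAlg k v K ≃ₗ[v.adicCompletion k]
    (Fin r → v.adicCompletion k)) (L : OptimalLattice v φ R θ) :
    Submodule (v.adicCompletionIntegers k) (LocalAlg k v K) :=
  L.1.comap (ev.toLinearMap.restrictScalars (v.adicCompletionIntegers k))

theorem OptimalLattice.mem_toField {L : OptimalLattice v φ R θ} {x : LocalAlg k v K} :
    x ∈ L.toField ev ↔ ev x ∈ L.1 := Iff.rfl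

/-- Multiplication by `u⁻¹` is $K_v$-linear, so it is transported to an isomorphism of optimal
lattices. -/
theorem OptimalLattice.equiv_of_toField_eq
    (hev : ∀ x y, ev (x * y) = (θ (localEmb v φ x)).mulVec (ev y)) {L L' : OptimalLattice v φ R θ}
    {u : (LocalAlg k v K)ˣ} (h : L.toField ev = lmul u (L'.toField ev)) :
    latticeSetoid v φ R θ L L' := by
  have hmul (x l) : ev (x * ev.symm l) = (θ (localEmb v φ x)).mulVec l := by
    rw [hev, LinearEquiv.apply_symm_apply]
  let m : LocalAlg k v K ≃ₗ[v.adicCompletion k] LocalAlg k v K := LinearEquiv.ofLinearMap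
      (LinearMap.mulLeft _ (↑u⁻¹ : LocalAlg k v K)) (LinearMap.mulLeft _ (u : LocalAlg k v K))
      (LinearMap.ext fun y => Units.inv_mul_cancel_left u y)
      (LinearMap.ext fun y => Units.mul_inv_cancel_left u y)
  refine ⟨(ev.symm.trans m).trans ev, fun l => ?_, fun α l _ => ?_⟩
  · change l ∈ L.1 ↔ ev (↑u⁻¹ * ev.symm l) ∈ L'.1
    rw [← mem_toField (L := L'), ← mem_lmul, ← h, mem_toField, LinearEquiv.apply_symm_apply]
  · change ev (↑u⁻¹ * ev.symm _) = Matrix.mulVec _ (ev (↑u⁻¹ * ev.symm l))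
    rw [← hev, mul_left_comm, ← hmul α l, LinearEquiv.symm_apply_apply]

theorem OptimalLattice.isLattice_toField (L : OptimalLattice v φ R θ) :
    (L.toField ev).IsLattice (v.adicCompletion k) :=
  isLattice_comap (A := v.adicCompletionIntegers k) ev.toLinearMap ev.injective _ L.2.1

theorem OptimalLattice.mul_mem_toField
    (hev : ∀ x y, ev (x * y) = (θ (localEmb v φ x)).mulVec (ev y)) (L : OptimalLattice v φ R θ)
    (x : LocalAlg k v K) (hx : x ∈ localOrder v R) (y : LocalAlg k v K) (hy : y ∈ L.toField ev) :
    x * y ∈ L.toField ev := by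
  rw [mem_toField, hev]
  exact (L.2.2 x).2 hx _ hy

theorem finite_quotient_latticeSetoid (hr : r.Prime) (hK : finrank k K = r)
    (θ : LocalAlg k v D ≃ₐ[v.adicCompletion k] Matrix (Fin r) (Fin r) (v.adicCompletion k))
    {T : Set (Submodule A K)} (hT : T.Finite)
    (hTv : ∀ N : Submodule (v.adicCompletionIntegers k) (LocalAlg k v K),
        N.IsLattice (v.adicCompletion k) → (∀ x ∈ localOrder v R, ∀ y ∈ N, x * y ∈ N) →
        ∃ u : (LocalAlg k v K)ˣ, ∃ M' ∈ T, N = lmul u (locSpan v M')) :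
    Finite (Quotient (latticeSetoid v φ R θ)) := by
  obtain ⟨ev, hev⟩ := exists_equiv_of_split hr hK φ θ
  have h := finite_image_of_factor (F := Quotient.mk (latticeSetoid v φ R θ)) (E := Set.univ) hT
    (fun L M' => ∃ u : (LocalAlg k v K)ˣ, L.toField ev = lmul u (locSpan v M'))
    (fun L _ => by
      obtain ⟨u, M', hM', h⟩ := hTv _ (L.isLattice_toField (ev := ev)) (L.mul_mem_toField hev)
      exact ⟨M', hM', u, h⟩)
    (by
      rintro L - L' - M' ⟨u, hu⟩ ⟨u', hu'⟩
      refine Quotient.sound (OptimalLattice.equiv_of_toField_eq (u := u * u'⁻¹) hev ?_)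
      rw [hu, hu', ← lmul_mul, inv_mul_cancel_right])
  rw [Set.image_univ_of_surjective Quotient.mk_surjective] at h
  exact Set.finite_univ_iff.1 h

/-- When every representative localises to $R_v$, any two optimal lattices are unit multiples of
$R_v$. One exists, namely $R_v$ itself: its multiplier ring is $R_v$ because it contains $1$. -/
theorem card_quotient_latticeSetoid_eq_one (hr : r.Prime) (hK : finrank k K = r)
    (hR : IsOrder k R)
    (θ : LocalAlg k v D ≃ₐ[v.adicCompletion k] Matrix (Fin r) (Fin r) (v.adicCompletion k))
    {T : Set (Submodule A K)}
    (hTv : ∀ N : Submodule (v.adicCompletionIntegers k) (LocalAlg k v K),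
        N.IsLattice (v.adicCompletion k) → (∀ x ∈ localOrder v R, ∀ y ∈ N, x * y ∈ N) →
        ∃ u : (LocalAlg k v K)ˣ, ∃ M' ∈ T, N = lmul u (locSpan v M'))
    (hT1 : ∀ M' ∈ T, locSpan (k := k) v M' = locSpan v (Subalgebra.toSubmodule R)) :
    Nat.card (Quotient (latticeSetoid v φ R θ)) = 1 := by
  obtain ⟨ev, hev⟩ := exists_equiv_of_split hr hK φ θ
  have hRl : (Subalgebra.toSubmodule R).IsLattice k := hR
  rw [Nat.card_eq_one_iff_unique]
  constructor
  · constructor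
    intro q q'
    induction q using Quotient.inductionOn with
    | h L =>
    induction q' using Quotient.inductionOn with
    | h L' =>
    obtain ⟨u, M, hM, h⟩ := hTv _ (L.isLattice_toField (ev := ev)) (L.mul_mem_toField hev)
    obtain ⟨u', M', hM', h'⟩ := hTv _ (L'.isLattice_toField (ev := ev)) (L'.mul_mem_toField hev)
    refine Quotient.sound (OptimalLattice.equiv_of_toField_eq (u := u * u'⁻¹) hev ?_)
    rw [h, h', ← lmul_mul, inv_mul_cancel_right, hT1 M hM, hT1 M' hM']
  · let L : Submodule (v.adicCompletionIntegers k) (Fin r → v.adicCompletion k) :=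
      (locSpan (k := k) v (Subalgebra.toSubmodule R)).comap
        (ev.symm.toLinearMap.restrictScalars (v.adicCompletionIntegers k))
    refine ⟨Quotient.mk _ ⟨L, isLattice_comap (A := v.adicCompletionIntegers k)
      ev.symm.toLinearMap ev.symm.injective _ (isLattice_locSpan v _), fun x => ?_⟩⟩
    have h1 (x l) : ev.symm ((θ (localEmb v φ x)).mulVec l) = x * ev.symm l := by
      rw [LinearEquiv.symm_apply_eq, hev, LinearEquiv.apply_symm_apply]
    have h2 (l) : l ∈ L ↔ ev.symm l ∈ localOrder v R := (mem_localOrder_iff _ _ _).symm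
    simp only [h2, h1]
    refine ⟨fun h => ?_, fun h l hl => mul_mem h hl⟩
    have := h (ev 1) (by rw [LinearEquiv.symm_apply_apply]; exact one_mem _)
    rwa [LinearEquiv.symm_apply_apply, mul_one] at this

end SplitCount

/-! ### $D_v$ is a matrix algebra over $k_v$ or a division algebra. -/

section Dichotomy

open Module

variable {k F D : Type*} [Field k] [Field F] [Algebra k F] [DivisionRing D] [Algebra k D]

theorem repr_mul_tmul_one {ι : Type*} (b : Basis ι k F) (x : D ⊗[k] F) (e : D) (j : ι) :
    (Algebra.TensorProduct.basis D b).repr (x * (e ⊗ₜ 1)) j =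
      (Algebra.TensorProduct.basis D b).repr x j * e := by
  induction x using TensorProduct.induction_on with
  | zero => simp
  | add x y hx hy => simp [add_mul, hx, hy]
  | tmul d f =>
    rw [Algebra.TensorProduct.tmul_mul_tmul, mul_one, Algebra.TensorProduct.basis_repr_tmul,
      Algebra.TensorProduct.basis_repr_tmul, Finsupp.smul_apply, Finsupp.smul_apply,
      Finsupp.mapRange_apply, smul_eq_mul, smul_eq_mul, mul_assoc, mul_assoc,
      Algebra.commutes]

/-- A nonzero element of the ideal with fewest coordinates, scaled to have a coordinate $1$,
commutes with $D$, since the commutator is shorter. Its coordinates are then central, so it is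
$1\otimes f$ with $f\ne0$, a unit. -/
theorem isSimpleRing_tensor [Algebra.IsCentral k D] : IsSimpleRing (D ⊗[k] F) := by
  classical
  let b := Basis.ofVectorSpace k F
  let B := Algebra.TensorProduct.basis D b
  have hleft (e : D) (x : D ⊗[k] F) : (e ⊗ₜ 1) * x = e • x := by
    induction x using TensorProduct.induction_on with
    | zero => simp
    | add x y hx hy => simp [mul_add, hx, hy]
    | tmul d f => simp [TensorProduct.smul_tmul']
  have : Nontrivial (D ⊗[k] F) := inferInstance
  refine ⟨⟨fun I => ?_⟩⟩
  by_cases hI : ∃ x ∈ I, x ≠ 0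
  swap
  · left
    push Not at hI
    exact eq_bot_iff.2 fun x hx => (TwoSidedIdeal.mem_bot _).2 (hI x hx)
  right
  obtain ⟨x, ⟨hxI, hx0⟩, hmin⟩ := exists_minimalFor_of_wellFoundedLT
    (fun x : D ⊗[k] F => x ∈ I ∧ x ≠ 0) (fun x => (B.repr x).support.card) hI
  obtain ⟨i, hi⟩ : ∃ i, B.repr x i ≠ 0 := by
    by_contra! h
    exact hx0 (B.repr.map_eq_zero_iff.1 (Finsupp.ext h))
  let x' := ((B.repr x i)⁻¹ ⊗ₜ 1) * x
  have hx'I : x' ∈ I := I.mul_mem_left _ _ hxI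
  have hx'r (j) : B.repr x' j = (B.repr x i)⁻¹ * B.repr x j := by
    simp only [x', hleft, map_smul, Finsupp.smul_apply, smul_eq_mul]
  have hcomm (e : D) (j) : e * B.repr x' j = B.repr x' j * e := by
    let y := (e ⊗ₜ 1) * x' - x' * (e ⊗ₜ 1)
    have hyr (j) : B.repr y j = e * B.repr x' j - B.repr x' j * e := by
      simp only [y, map_sub, Finsupp.sub_apply, hleft, map_smul, Finsupp.smul_apply, smul_eq_mul]
      rw [repr_mul_tmul_one]
    have hy : y = 0 := by
      by_contra hy
      have hlt : (B.repr y).support.card < (B.repr x).support.card := by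
        refine Finset.card_lt_card (Finset.ssubset_iff_subset_ne.2 ⟨fun j hj => ?_, fun h => ?_⟩)
        · rw [Finsupp.mem_support_iff] at hj ⊢
          intro h
          rw [hyr, hx'r, h] at hj
          simp at hj
        · have : i ∈ (B.repr y).support := h ▸ Finsupp.mem_support_iff.2 hi
          rw [Finsupp.mem_support_iff, hyr, hx'r, inv_mul_cancel₀ hi] at this
          simp at this
      exact hlt.not_ge (hmin ⟨I.sub_mem (I.mul_mem_left _ _ hx'I) (I.mul_mem_right _ _ hx'I), hy⟩
        hlt.le)
    have := hyr j
    rw [hy, map_zero, Finsupp.zero_apply] at this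
    exact sub_eq_zero.1 this.symm
  have hc (j) : ∃ c : k, algebraMap k D c = B.repr x' j := by
    have : B.repr x' j ∈ Subalgebra.center k D := Subalgebra.mem_center_iff.2 fun e => hcomm e j
    rw [Algebra.IsCentral.center_eq_bot] at this
    exact this
  choose c hc using hc
  let f := (B.repr x').sum fun j _ => c j • b j
  have hx'f : x' = 1 ⊗ₜ f := by
    rw [← B.linearCombination_repr x', Finsupp.linearCombination_apply]
    simp only [f, Finsupp.sum, TensorProduct.tmul_sum]
    refine Finset.sum_congr rfl fun j _ => ?_
    rw [← hc, Algebra.TensorProduct.basis_apply, TensorProduct.smul_tmul', TensorProduct.tmul_smul,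
      TensorProduct.smul_tmul', Algebra.smul_def, smul_eq_mul]
  have hf : f ≠ 0 := by
    intro h
    have := hx'r i
    rw [hx'f, h, TensorProduct.tmul_zero, map_zero, inv_mul_cancel₀ hi] at this
    exact zero_ne_one this
  have h1 : (1 : D ⊗[k] F) ∈ I := by
    have := I.mul_mem_left (1 ⊗ₜ f⁻¹) _ hx'I
    rwa [hx'f, Algebra.TensorProduct.tmul_mul_tmul, inv_mul_cancel₀ hf, one_mul] at this
  exact I.one_mem_iff.1 h1

/-- By Wedderburn the algebra is $M_n(D')$ with $n^2\dim D'=r^2$, which leaves only $n=1$ and $n=r$.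
-/
theorem matrix_or_division [Algebra.IsCentral k D] [FiniteDimensional k D] {r : ℕ} (hr : r.Prime)
    (hD : finrank k D = r ^ 2) :
    Nonempty (F ⊗[k] D ≃ₐ[F] Matrix (Fin r) (Fin r) F) ∨ ∀ x : F ⊗[k] D, x ≠ 0 → IsUnit x := by
  have h1 : IsSimpleRing (D ⊗[k] F) := isSimpleRing_tensor
  have h2 : IsSimpleRing (F ⊗[k] D) :=
    IsSimpleRing.of_ringEquiv (Algebra.TensorProduct.comm k D F).toRingEquiv h1
  have : IsArtinianRing (F ⊗[k] D) := IsArtinianRing.of_finite F _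
  obtain ⟨n, hn, D', _, _, _, ⟨e⟩⟩ :=
    IsSimpleRing.exists_algEquiv_matrix_divisionRing_finite F (F ⊗[k] D)
  have hdim : n * n * finrank F D' = r ^ 2 := by
    rw [← hD, ← finrank_baseChange (R := F) (M' := D), e.toLinearEquiv.finrank_eq,
      Module.finrank_matrix]
    simp
  obtain ⟨i, hi, rfl⟩ := (Nat.dvd_prime_pow hr).1 (show n ∣ r ^ 2 from ⟨n * finrank F D', by rw [← hdim, mul_assoc]⟩)
  obtain rfl | rfl | rfl : i = 0 ∨ i = 1 ∨ i = 2 := by omega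
  · right
    rw [pow_zero] at e
    intro x hx
    let e' : Matrix (Fin 1) (Fin 1) D' ≃+* D' := Matrix.uniqueRingEquiv
    have h3 : e' (e x) ≠ 0 := by simpa using hx
    have h4 : IsUnit (e' (e x)) := h3.isUnit
    exact (MulEquiv.isUnit_map e).1 ((MulEquiv.isUnit_map e').1 h4)
  · left
    rw [pow_one, ← pow_two] at hdim
    have h3 : finrank F D' = 1 :=
      Nat.eq_of_mul_eq_mul_left (pow_pos hr.pos 2) (by rw [hdim, mul_one])
    have h4 : Function.Bijective (Algebra.ofId F D') :=
      ⟨(algebraMap F D').injective, fun y => by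
        obtain ⟨c, hc⟩ := (finrank_eq_one_iff_of_nonzero' (1 : D') one_ne_zero).1 h3 y
        exact ⟨c, by rw [← hc, Algebra.ofId_apply, Algebra.algebraMap_eq_smul_one]⟩⟩
    rw [pow_one] at e
    exact ⟨e.trans (AlgEquiv.ofBijective _ h4).symm.mapMatrix⟩
  · exfalso
    have h5 : finrank F D' ≠ 0 := fun h => by
      rw [h, mul_zero] at hdim
      exact (pow_pos hr.pos 2).ne hdim
    have h6 := hr.one_lt
    have : r ^ 2 * r ^ 2 ≤ r ^ 2 := by
      conv_rhs => rw [← hdim]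
      exact Nat.le_mul_of_pos_right _ (Nat.pos_of_ne_zero h5)
    nlinarith [pow_pos hr.pos 2]

end Dichotomy

/-! ### The norm as a valuation, and the unique maximal order. -/

section NormValuation

open HeightOneSpectrum Module
open scoped WithZero

variable {A : Type*} [CommRing A] [IsDedekindDomain A] {k : Type*} [Field k] [Algebra A k]
  [IsFractionRing A k] {B : Type*} [DivisionRing B] [Algebra k B] {v : HeightOneSpectrum A}

/-- The valuation of the norm of an element of `B_v`. -/
def nv : LocalAlg k v B →* ℤᵐ⁰ :=
  ((Valued.v : Valuation (v.adicCompletion k) ℤᵐ⁰) : v.adicCompletion k →* ℤᵐ⁰).comp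
    (Algebra.norm (v.adicCompletion k))

theorem nv_apply (x : LocalAlg k v B) : nv x = Valued.v (Algebra.norm (v.adicCompletion k) x) := rfl

theorem nv_algebraMap (a : v.adicCompletion k) :
    nv (algebraMap _ (LocalAlg k v B) a) = Valued.v a ^ finrank k B := by
  rw [nv_apply, Algebra.norm_algebraMap, map_pow, finrank_baseChange]

theorem nv_smul (a : v.adicCompletion k) (x : LocalAlg k v B) :
    nv (a • x) = Valued.v a ^ finrank k B * nv x := by
  rw [Algebra.smul_def, map_mul, nv_algebraMap]

theorem nv_unit_ne_zero (u : (LocalAlg k v B)ˣ) : nv (u : LocalAlg k v B) ≠ 0 :=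
  (u.isUnit.map nv).ne_zero

variable [FiniteDimensional k B]

theorem isUnit_of_ne_zero [IsDomain (LocalAlg k v B)] {x : LocalAlg k v B} (hx : x ≠ 0) :
    IsUnit x := by
  have hinj : Function.Injective (LinearMap.mulLeft (v.adicCompletion k) x) :=
    fun y z h => mul_left_cancel₀ hx h
  obtain ⟨y, hy⟩ := LinearMap.surjective_of_injective hinj 1
  have h1 : y * x = 1 := mul_left_cancel₀ hx (by
    rw [← mul_assoc, show x * y = 1 from hy, one_mul, mul_one])
  exact ⟨⟨x, y, hy, h1⟩, rfl⟩

theorem nv_ne_zero [IsDomain (LocalAlg k v B)] {x : LocalAlg k v B} (hx : x ≠ 0) : nv x ≠ 0 :=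
  ((isUnit_of_ne_zero hx).map nv).ne_zero

theorem nv_zero : nv (0 : LocalAlg k v B) = 0 := by
  have := nv_smul (0 : v.adicCompletion k) (1 : LocalAlg k v B)
  rwa [zero_smul, Valuation.map_zero, zero_pow finrank_pos.ne', zero_mul] at this

variable [Ring.HasFiniteQuotients A] {ι : Type*} [Finite ι] (b : Basis ι k B)

theorem continuous_norm_sum [Fintype ι] : Continuous fun c : ι → v.adicCompletion k =>
    Algebra.norm (v.adicCompletion k)
      (∑ i, c i • Algebra.TensorProduct.basis (v.adicCompletion k) b i) := by
  classical
  simp only [Algebra.norm_eq_matrix_det (Algebra.TensorProduct.basis (v.adicCompletion k) b),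
    map_sum, map_smul]
  exact Continuous.matrix_det (continuous_finsetSum _ fun i _ =>
    (continuous_apply i).smul continuous_const)

theorem isCompact_pi_integers : IsCompact {c : ι → v.adicCompletion k | ∀ i, Valued.v (c i) ≤ 1} := by
  have := isCompact_univ_pi fun _ : ι => isCompact_adicCompletionIntegers (k := k) v
  convert this using 1
  ext c
  simp [mem_adicCompletionIntegers]

theorem exists_valued_le_of_isCompact {s : Set (v.adicCompletion k)} (hs : IsCompact s) :
    ∃ γ : ℤᵐ⁰, γ ≠ 0 ∧ ∀ x ∈ s, Valued.v x ≤ γ := by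
  obtain ⟨t, -, ht⟩ := hs.elim_nhds_subcover (fun x => {y | Valued.v (y - x) < 1}) fun x _ =>
    ((isOpen_valued_lt v 1).preimage (continuous_id.sub continuous_const)).mem_nhds (by simp)
  refine ⟨t.sup (fun x => Valued.v x) ⊔ 1, (lt_of_lt_of_le zero_lt_one le_sup_right).ne',
    fun x hx => ?_⟩
  obtain ⟨y, hy, hxy⟩ := Set.mem_iUnion₂.1 (ht hx)
  rw [← sub_add_cancel x y]
  refine (Valued.v.map_add _ _).trans (max_le ?_ ?_)
  · exact le_sup_of_le_right (le_of_lt hxy)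
  · exact le_sup_of_le_left (Finset.le_sup (f := fun x => Valued.v x) hy)

/-- The norm is polynomial in the coordinates, hence bounded on the compact unit box; scaling gives
the other boxes. -/
theorem exists_nv_le_of_mem_box (γ : ℤᵐ⁰) :
    ∃ δ : ℤᵐ⁰, ∀ x ∈ box v b γ, nv x ≤ δ := by
  cases nonempty_fintype ι
  let bv := Algebra.TensorProduct.basis (v.adicCompletion k) b
  obtain ⟨δ, -, hδ⟩ := exists_valued_le_of_isCompact
    ((isCompact_pi_integers (k := k) (v := v) (ι := ι)).image (continuous_norm_sum b))
  obtain ⟨a, ha0, ha⟩ : ∃ a : v.adicCompletion k, a ≠ 0 ∧ γ ≤ Valued.v a := by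
    by_cases hγ : γ = 0
    · exact ⟨1, one_ne_zero, by simp [hγ]⟩
    · obtain ⟨a, ha⟩ := valuedAdicCompletion_surjective k v γ
      exact ⟨a, fun h => hγ (by rw [← ha, h, map_zero]), ha.ge⟩
  refine ⟨Valued.v a ^ finrank k B * δ, fun x hx => ?_⟩
  have h1 : x = a • a⁻¹ • x := by rw [smul_smul, mul_inv_cancel₀ ha0, one_smul]
  rw [h1, nv_smul]
  refine mul_le_mul_right ?_ _
  refine hδ _ ⟨fun i => bv.repr (a⁻¹ • x) i, fun i => ?_, ?_⟩
  · change Valued.v (bv.repr (a⁻¹ • x) i) ≤ 1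
    rw [map_smul, Finsupp.smul_apply, smul_eq_mul, map_mul, map_inv₀, mul_comm]
    have hva : Valued.v a ≠ 0 := by simpa using ha0
    exact mul_inv_le_one_of_le₀ ((hx i).trans ha) zero_le
  · exact congrArg _ (bv.sum_repr _)

theorem nv_le_one_of_pow_mem_box {γ : ℤᵐ⁰} {x : LocalAlg k v B} (hx : ∀ m : ℕ, x ^ m ∈ box v b γ) :
    nv x ≤ 1 := by
  obtain ⟨δ, hδ⟩ := exists_nv_le_of_mem_box (v := v) b γ
  by_contra! h
  obtain ⟨m, hm⟩ := MulArchimedean.arch δ h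
  have h1 := hδ _ (hx (m + 1))
  rw [map_pow] at h1
  exact (hm.trans_lt (pow_lt_pow_right₀ h (Nat.lt_succ_self m))).not_ge h1

variable [IsDomain (LocalAlg k v B)]

/-- On the compact set of coordinate vectors of maximum size exactly $1$ the norm has no zero, as
$B_v$ has no zero divisors. It is therefore bounded below there, and scaling by the largest
coordinate gives the general bound. -/
theorem exists_le_nv : ∃ ε : ℤᵐ⁰, ε ≠ 0 ∧ ∀ (x : LocalAlg k v B) (i : ι),
    ε * Valued.v ((Algebra.TensorProduct.basis (v.adicCompletion k) b).repr x i) ^ finrank k B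
      ≤ nv x := by
  cases nonempty_fintype ι
  let bv := Algebra.TensorProduct.basis (v.adicCompletion k) b
  let Z := {c : ι → v.adicCompletion k | ∀ i, Valued.v (c i) ≤ 1} ∩
    ⋃ i, {c : ι → v.adicCompletion k | Valued.v (c i) < 1}ᶜ
  have hZ : IsCompact Z := isCompact_pi_integers.inter_right
    (isClosed_iUnion_of_finite fun i => by
      have h := (isOpen_valued_lt v 1).preimage
        (continuous_apply (A := fun _ : ι => v.adicCompletion k) i)
      exact h.isClosed_compl)
  have hZ' := (hZ.image (continuous_norm_sum (v := v) b)).isClosed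
  obtain ⟨ε, hε0, hε⟩ := exists_valued_lt_subset v (hZ'.isOpen_compl.mem_nhds (x := 0) (by
    rintro ⟨c, ⟨-, hc⟩, h⟩
    obtain ⟨i, hi⟩ := Set.mem_iUnion.1 hc
    have h0 : ∑ i, c i • bv i = 0 := by
      by_contra h0
      refine nv_ne_zero h0 ?_
      rw [nv_apply]
      exact (congrArg _ h).trans (map_zero _)
    have h1 : c i = 0 := by
      have := congrFun (bv.repr_sum_self c) i
      rw [← this, h0, map_zero, Finsupp.zero_apply]
    exact hi (by simp [h1])))
  refine ⟨ε, hε0, fun x i => ?_⟩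
  obtain ⟨j, -, hj⟩ := Finset.exists_max_image Finset.univ (fun i => Valued.v (bv.repr x i))
    ⟨i, Finset.mem_univ i⟩
  refine (mul_le_mul_right (pow_le_pow_left₀ zero_le (hj i (Finset.mem_univ i)) _) _).trans ?_
  by_cases h0 : bv.repr x j = 0
  · rw [h0, map_zero, zero_pow finrank_pos.ne', mul_zero]
    exact zero_le
  have hv0 : Valued.v (bv.repr x j) ≠ 0 := by simpa using h0
  have h1 : x = bv.repr x j • (bv.repr x j)⁻¹ • x := by
    rw [smul_smul, mul_inv_cancel₀ h0, one_smul]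
  have h2 : ε ≤ nv ((bv.repr x j)⁻¹ • x) := by
    by_contra! h
    refine hε h ⟨fun i => bv.repr ((bv.repr x j)⁻¹ • x) i, ⟨fun i => ?_, ?_⟩, ?_⟩
    · change Valued.v (bv.repr ((bv.repr x j)⁻¹ • x) i) ≤ 1
      rw [map_smul, Finsupp.smul_apply, smul_eq_mul, map_mul, map_inv₀, mul_comm]
      exact mul_inv_le_one_of_le₀ (hj i (Finset.mem_univ i)) zero_le
    · refine Set.mem_iUnion.2 ⟨j, ?_⟩
      rw [Set.mem_compl_iff, Set.mem_ofPred_eq]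
      beta_reduce
      rw [map_smul, Finsupp.smul_apply, smul_eq_mul, inv_mul_cancel₀ h0, map_one]
      exact lt_irrefl _
    · exact congrArg _ (bv.sum_repr _)
  conv_rhs => rw [h1, nv_smul]
  rw [mul_comm]
  exact mul_le_mul_right h2 _

theorem exists_mem_box_of_nv_le_one :
    ∃ γ : ℤᵐ⁰, γ ≠ 0 ∧ ∀ x : LocalAlg k v B, nv x ≤ 1 → x ∈ box v b γ := by
  obtain ⟨ε, hε0, hε⟩ := exists_le_nv (v := v) b
  refine ⟨ε⁻¹ ⊔ 1, (lt_of_lt_of_le zero_lt_one le_sup_right).ne', fun x hx i => ?_⟩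
  have h := (hε x i).trans hx
  by_cases h1 : Valued.v ((Algebra.TensorProduct.basis (v.adicCompletion k) b).repr x i) ≤ 1
  · exact le_sup_of_le_right h1
  · refine le_sup_of_le_left ((le_self_pow₀ (not_le.1 h1).le (finrank_pos (R := k) (M := B)).ne').trans ?_)
    rwa [← mul_one ε⁻¹, le_inv_mul_iff₀ (zero_lt_iff.2 hε0)]

/-- All products $(1+x)^mx^j$ stay in one box: those with $m=0$ do because their norm is integral,
and raising $m$ adds two elements of the box. So the powers of $1+x$ are bounded, and
multiplicativity of the norm gives the claim. -/
theorem nv_one_add_le {x : LocalAlg k v B} (hx : nv x ≤ 1) : nv (1 + x) ≤ 1 := by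
  let b := Module.finBasis k B
  obtain ⟨γ, -, hγ⟩ := exists_mem_box_of_nv_le_one (v := v) b
  refine nv_le_one_of_pow_mem_box b (γ := γ) fun m => ?_
  have h : ∀ m j : ℕ, (1 + x) ^ m * x ^ j ∈ box v b γ := by
    intro m
    induction m with
    | zero =>
      intro j
      rw [pow_zero, one_mul]
      exact hγ _ (by rw [map_pow]; exact pow_le_one₀ zero_le hx)
    | succ m ih =>
      intro j
      rw [pow_succ, mul_assoc, add_mul, one_mul, mul_add, ← pow_succ']
      exact Submodule.add_mem _ (ih j) (ih (j + 1))
  simpa using h m 0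

theorem nv_add_le {x y : LocalAlg k v B} {γ : ℤᵐ⁰} (hx : nv x ≤ γ) (hy : nv y ≤ γ) :
    nv (x + y) ≤ γ := by
  wlog h : nv x ≤ nv y generalizing x y
  · rw [add_comm]
    exact this hy hx (not_le.1 h).le
  by_cases hy0 : y = 0
  · subst hy0
    rwa [add_zero]
  obtain ⟨u, rfl⟩ := isUnit_of_ne_zero hy0
  have h1 : x + u = u * (1 + (↑u⁻¹ : LocalAlg k v B) * x) := by
    rw [mul_add, mul_one, Units.mul_inv_cancel_left, add_comm]
  have hu := nv_unit_ne_zero u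
  have h2 : nv ((↑u⁻¹ : LocalAlg k v B) * x) ≤ 1 := by
    have h3 : nv (↑u⁻¹ : LocalAlg k v B) * nv (u : LocalAlg k v B) = 1 := by
      rw [← map_mul, Units.inv_mul, map_one]
    rw [map_mul, ← h3]
    exact mul_le_mul_right h _
  rw [h1, map_mul]
  exact (mul_le_of_le_one_right zero_le (nv_one_add_le h2)).trans hy

variable (k v B) in
/-- The elements of `B_v` of integral norm. -/
def maxOrder : Subalgebra (v.adicCompletionIntegers k) (LocalAlg k v B) where
  carrier := {x | nv x ≤ 1}
  mul_mem' hx hy := by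
    change nv _ ≤ 1
    rw [map_mul]
    exact mul_le_one' hx hy
  add_mem' hx hy := nv_add_le hx hy
  algebraMap_mem' a := by
    change nv _ ≤ 1
    rw [IsScalarTower.algebraMap_apply _ (v.adicCompletion k) (LocalAlg k v B), nv_algebraMap]
    exact pow_le_one₀ zero_le a.2

theorem mem_maxOrder {x : LocalAlg k v B} : x ∈ maxOrder k B v ↔ nv x ≤ 1 := Iff.rfl

theorem isOrder_maxOrder : IsOrder (v.adicCompletion k) (maxOrder k B v) := by
  let b := Module.finBasis k B
  obtain ⟨γ, hγ0, hγ⟩ := exists_mem_box_of_nv_le_one (v := v) b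
  obtain ⟨γ', hγ'0, hγ'⟩ := exists_box_le v b (N := Subalgebra.toSubmodule (maxOrder k B v)) (by
    rw [eq_top_iff]
    intro x _
    obtain ⟨a, ha0, ha⟩ : ∃ a : v.adicCompletion k, a ≠ 0 ∧ nv (a • x) ≤ 1 := by
      by_cases hx : nv x ≤ 1
      · exact ⟨1, one_ne_zero, by rwa [one_smul]⟩
      · obtain ⟨a, ha⟩ := valuedAdicCompletion_surjective k v (nv x)⁻¹
        have hx1 := not_le.1 hx
        have hx0 : nv x ≠ 0 := (zero_lt_one.trans hx1).ne'
        refine ⟨a, fun h => inv_ne_zero hx0 (by rw [← ha, h, map_zero]), ?_⟩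
        rw [nv_smul, ha]
        calc _ ≤ (nv x)⁻¹ * nv x := by
              refine mul_le_mul_left ?_ _
              exact pow_le_of_le_one zero_le (inv_le_one_of_one_le₀ hx1.le) finrank_pos.ne'
          _ = 1 := inv_mul_cancel₀ hx0
    have h1 : x = a⁻¹ • a • x := by rw [smul_smul, inv_mul_cancel₀ ha0, one_smul]
    rw [h1]
    exact Submodule.smul_mem _ _ (Submodule.subset_span ha))
  exact isLattice_of_box_le v b hγ'0 hγ' fun x hx => hγ x hx

/-- Integral norm is the same as bounded powers. This description involves no norm and makes
`maxOrder` contain every order. -/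
theorem mem_maxOrder_iff_isIntegral {x : LocalAlg k v B} :
    x ∈ maxOrder k B v ↔ IsIntegral (v.adicCompletionIntegers k) x := by
  constructor
  · intro hx
    exact IsIntegral.of_mem_of_fg _ isOrder_maxOrder.fg x hx
  · intro hx
    let b := Module.finBasis k B
    obtain ⟨γ, -, hγ⟩ := exists_le_box v b hx.fg_adjoin_singleton
    exact nv_le_one_of_pow_mem_box b fun m =>
      hγ (pow_mem (Algebra.self_mem_adjoin_singleton _ x) m)

theorem le_maxOrder {S : Subalgebra (v.adicCompletionIntegers k) (LocalAlg k v B)}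
    (hS : IsOrder (v.adicCompletion k) S) : S ≤ maxOrder k B v := fun x hx =>
  mem_maxOrder_iff_isIntegral.2 (IsIntegral.of_mem_of_fg _ hS.fg x hx)

theorem isMaximalOrder_iff {S : Subalgebra (v.adicCompletionIntegers k) (LocalAlg k v B)} :
    IsMaximalOrder (v.adicCompletion k) S ↔ S = maxOrder k B v := by
  constructor
  · exact fun h => le_antisymm (le_maxOrder h.1) (h.2 isOrder_maxOrder (le_maxOrder h.1))
  · rintro rfl
    exact ⟨isOrder_maxOrder, fun S hS _ => le_maxOrder hS⟩

end NormValuation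

/-! ### The order function and its uniformizers. -/

section Order

open HeightOneSpectrum Module
open scoped WithZero

variable {A : Type*} [CommRing A] [IsDedekindDomain A] {k : Type*} [Field k] [Algebra A k]
  [IsFractionRing A k] {B : Type*} [DivisionRing B] [Algebra k B] {v : HeightOneSpectrum A}

/-- The order of the norm of a unit of `B_v`. -/
def ord (u : (LocalAlg k v B)ˣ) : ℤ := -WithZero.log (nv (u : LocalAlg k v B))

theorem ord_mul (u w : (LocalAlg k v B)ˣ) : ord (u * w) = ord u + ord w := by
  rw [ord, ord, ord, Units.val_mul, map_mul,
    WithZero.log_mul (nv_unit_ne_zero u) (nv_unit_ne_zero w), neg_add]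

theorem ord_one : ord (1 : (LocalAlg k v B)ˣ) = 0 := by
  rw [ord, Units.val_one, map_one, WithZero.log_one, neg_zero]

theorem ord_inv (u : (LocalAlg k v B)ˣ) : ord u⁻¹ = -ord u := by
  have := ord_mul u u⁻¹
  rw [mul_inv_cancel, ord_one] at this
  omega

theorem ord_zpow (u : (LocalAlg k v B)ˣ) (j : ℤ) : ord (u ^ j) = j * ord u := by
  have := map_zpow (MonoidHom.mk' (fun u : (LocalAlg k v B)ˣ => Multiplicative.ofAdd (ord u))
    fun u w => by rw [ord_mul]; rfl) u j
  simpa using! congrArg Multiplicative.toAdd this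

theorem ord_pow (u : (LocalAlg k v B)ˣ) (j : ℕ) : ord (u ^ j) = j * ord u := by
  rw [← zpow_natCast, ord_zpow]

theorem nv_eq_exp (u : (LocalAlg k v B)ˣ) : nv (u : LocalAlg k v B) = WithZero.exp (-ord u) := by
  rw [ord, neg_neg, WithZero.exp_log (nv_unit_ne_zero u)]

theorem nv_le_one_iff (u : (LocalAlg k v B)ˣ) : nv (u : LocalAlg k v B) ≤ 1 ↔ 0 ≤ ord u := by
  rw [nv_eq_exp, ← WithZero.exp_zero, WithZero.exp_le_exp]
  omega

theorem nv_lt_one_iff (u : (LocalAlg k v B)ˣ) : nv (u : LocalAlg k v B) < 1 ↔ 0 < ord u := by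
  rw [nv_eq_exp, ← WithZero.exp_zero, WithZero.exp_lt_exp]
  omega

theorem nv_eq_one_iff (u : (LocalAlg k v B)ˣ) : nv (u : LocalAlg k v B) = 1 ↔ ord u = 0 := by
  rw [nv_eq_exp, ← WithZero.exp_zero, WithZero.exp_inj]
  omega

variable (k v) in
theorem exists_valued_eq_exp : ∃ a : v.adicCompletion k, a ≠ 0 ∧ Valued.v a = WithZero.exp (-1 : ℤ) := by
  obtain ⟨a, ha⟩ := valuedAdicCompletion_surjective k v (WithZero.exp (-1 : ℤ))
  exact ⟨a, fun h => WithZero.exp_ne_zero (by rw [← ha, h, map_zero]), ha⟩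

theorem valued_lt_one_iff_mem_maximalIdeal (x : v.adicCompletionIntegers k) :
    x ∈ IsLocalRing.maximalIdeal (v.adicCompletionIntegers k) ↔
      Valued.v (x : v.adicCompletion k) < 1 :=
  (Valuation.Integers.isUnit_iff_valuation_eq_one
    (Valuation.integer.integers Valued.v)).not.trans (lt_iff_le_and_ne.trans
      ⟨fun h => h.2, fun h => ⟨x.2, h⟩⟩).symm

/-- `ord` is the order of the norm, so a uniformizer of $k_v$ has order $\dim_kB$, not the
ramification index. -/
theorem ord_map_units (a : (v.adicCompletion k)ˣ) (ha : Valued.v (a : v.adicCompletion k) =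
    WithZero.exp (-1 : ℤ)) :
    ord (Units.map (algebraMap (v.adicCompletion k) (LocalAlg k v B)).toMonoidHom a) = finrank k B := by
  change -WithZero.log (nv (algebraMap _ (LocalAlg k v B) (a : v.adicCompletion k))) = _
  rw [nv_algebraMap, ha, WithZero.log_pow]
  simp

variable (k v) in
theorem exists_unit_valued_eq_exp :
    ∃ a : (v.adicCompletion k)ˣ, Valued.v (a : v.adicCompletion k) = WithZero.exp (-1 : ℤ) := by
  obtain ⟨c, hc0, hc⟩ := exists_valued_eq_exp k v
  exact ⟨Units.mk0 c hc0, hc⟩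

variable [FiniteDimensional k B]

theorem exists_uniformizer : ∃ p : (LocalAlg k v B)ˣ, 0 < ord p ∧ ∀ u : (LocalAlg k v B)ˣ,
    ord p ∣ ord u := by
  let f : Additive (LocalAlg k v B)ˣ →+ ℤ := AddMonoidHom.mk' (fun u => ord u.toMul)
    fun u w => ord_mul _ _
  obtain ⟨a, ha⟩ := Int.subgroup_cyclic f.range
  have hdvd (u : (LocalAlg k v B)ˣ) : a ∣ ord u := by
    have : ord u ∈ f.range := ⟨Additive.ofMul u, rfl⟩
    rw [ha, AddSubgroup.mem_closure_singleton] at this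
    obtain ⟨n, hn⟩ := this
    exact ⟨n, by rw [← hn, smul_eq_mul, mul_comm]⟩
  obtain ⟨p, hp⟩ : a ∈ f.range := ha ▸ AddSubgroup.subset_closure rfl
  replace hp : ord p.toMul = a := hp
  have ha0 : a ≠ 0 := by
    rintro rfl
    obtain ⟨c, hc⟩ := exists_unit_valued_eq_exp k v
    have h := ord_map_units (B := B) c hc
    have h1 := hdvd (Units.map (algebraMap (v.adicCompletion k) (LocalAlg k v B)).toMonoidHom c)
    rw [h, zero_dvd_iff] at h1
    have := finrank_pos (R := k) (M := B)
    omega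
  rcases lt_or_gt_of_ne ha0 with h | h
  · exact ⟨p.toMul⁻¹, by rw [ord_inv]; omega, fun u => by rw [ord_inv, hp, neg_dvd]; exact hdvd u⟩
  · exact ⟨p.toMul, by omega, fun u => hp ▸ hdvd u⟩

variable [Ring.HasFiniteQuotients A] [IsDomain (LocalAlg k v B)]

variable (k B v) in
/-- The norm valuation as a valuation. -/
def normValuation : Valuation (LocalAlg k v B) ℤᵐ⁰ where
  toFun := nv
  map_zero' := nv_zero
  map_one' := map_one nv
  map_mul' := map_mul nv
  map_add_le_max' _ _ := nv_add_le (le_max_left _ _) (le_max_right _ _)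

/-- If the norm valuation is surjective, `B_v` is commutative. -/
theorem commute_of_ord_eq_one {p : (LocalAlg k v B)ˣ} (hp : ord p = 1) (x y : LocalAlg k v B) :
    x * y = y * x := by
  -- With $n=\dim_kB$, the orders of nonzero terms $c_ip^i$ for $0\le i<n$ are distinct modulo $n$,
  -- so the term of largest norm cannot cancel. The powers form a basis, and $B_v=k_v[p]$ is
  -- commutative.
  have hlin : LinearIndependent (v.adicCompletion k)
      (fun i : Fin (finrank k B) => (p : LocalAlg k v B) ^ (i : ℕ)) := by
    rw [Fintype.linearIndependent_iff]
    intro c hc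
    by_contra! h
    obtain ⟨i₀, hi₀⟩ := h
    let val := fun i : Fin (finrank k B) => nv (c i • (p : LocalAlg k v B) ^ (i : ℕ))
    obtain ⟨j, -, hj⟩ := Finset.exists_max_image Finset.univ val ⟨i₀, Finset.mem_univ _⟩
    have hval (i) : val i = Valued.v (c i) ^ finrank k B * WithZero.exp (-(i : ℤ)) := by
      simp only [val]
      rw [nv_smul, ← Units.val_pow_eq_pow_val, nv_eq_exp, ord_pow, hp, mul_one]
    have hval0 (i) : val i = 0 ↔ c i = 0 := by
      rw [hval, mul_eq_zero, or_iff_left WithZero.exp_ne_zero,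
        pow_eq_zero_iff finrank_pos.ne', map_eq_zero]
    have hj0 : val j ≠ 0 := fun h => hi₀ ((hval0 _).1 (le_antisymm (h ▸ hj i₀ (Finset.mem_univ _))
      zero_le))
    have hlt (i) (hi : i ≠ j) : val i < val j := by
      refine lt_of_le_of_ne (hj i (Finset.mem_univ _)) fun h => hi ?_
      have hi0 : c i ≠ 0 := by rwa [ne_eq, ← hval0, h]
      have hj0' : c j ≠ 0 := by rwa [ne_eq, ← hval0]
      have h1 := congrArg WithZero.log h
      have hvi : Valued.v (c i) ≠ 0 := by simpa using hi0
      have hvj : Valued.v (c j) ≠ 0 := by simpa using hj0'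
      rw [hval, hval, WithZero.log_mul (pow_ne_zero _ hvi) WithZero.exp_ne_zero,
        WithZero.log_mul (pow_ne_zero _ hvj) WithZero.exp_ne_zero, WithZero.log_pow,
        WithZero.log_pow, WithZero.log_exp, WithZero.log_exp, nsmul_eq_mul, nsmul_eq_mul] at h1
      have h2 : ((i : ℕ) : ℤ) ≡ ((j : ℕ) : ℤ) [ZMOD (finrank k B : ℤ)] :=
        Int.modEq_iff_dvd.2 ⟨WithZero.log (Valued.v (c j)) - WithZero.log (Valued.v (c i)),
          by linarith⟩
      exact Fin.ext (Nat.ModEq.eq_of_lt_of_lt (Int.natCast_modEq_iff.1 h2) i.2 j.2)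
    have h1 := (normValuation k B v).map_sum_lt (s := Finset.univ.erase j)
      (f := fun i => c i • (p : LocalAlg k v B) ^ (i : ℕ)) hj0
      fun i hi => hlt i (Finset.ne_of_mem_erase hi)
    rw [← Finset.add_sum_erase _ _ (Finset.mem_univ j)] at hc
    rw [← neg_eq_of_add_eq_zero_right hc, Valuation.map_neg] at h1
    exact lt_irrefl _ h1
  have htop := hlin.span_eq_top_of_card_eq_finrank' (by
    rw [Fintype.card_fin, finrank_baseChange])
  have hmem (z : LocalAlg k v B) : z ∈ Algebra.adjoin (v.adicCompletion k) {(p : LocalAlg k v B)} := by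
    have h : Submodule.span (v.adicCompletion k) (Set.range fun i : Fin (finrank k B) =>
        (p : LocalAlg k v B) ^ (i : ℕ)) ≤
        Subalgebra.toSubmodule (Algebra.adjoin (v.adicCompletion k) {(p : LocalAlg k v B)}) := by
      rw [Submodule.span_le]
      rintro _ ⟨i, rfl⟩
      exact pow_mem (Algebra.self_mem_adjoin_singleton _ _) _
    exact h (htop ▸ Submodule.mem_top)
  obtain ⟨f, rfl⟩ := Algebra.adjoin_singleton_eq_range_aeval (v.adicCompletion k)
    (p : LocalAlg k v B) ▸ hmem x
  obtain ⟨g, rfl⟩ := Algebra.adjoin_singleton_eq_range_aeval (v.adicCompletion k)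
    (p : LocalAlg k v B) ▸ hmem y
  change Polynomial.aeval _ f * Polynomial.aeval _ g = Polynomial.aeval _ g * Polynomial.aeval _ f
  rw [← map_mul, mul_comm, map_mul]

end Order

/-! ### The residue ring of the maximal order. -/

section Residue

open HeightOneSpectrum Module
open scoped WithZero

variable {A : Type*} [CommRing A] [IsDedekindDomain A] {k : Type*} [Field k] [Algebra A k]
  [IsFractionRing A k] {B : Type*} [DivisionRing B] [Algebra k B] {v : HeightOneSpectrum A}
  [FiniteDimensional k B] [Ring.HasFiniteQuotients A] [IsDomain (LocalAlg k v B)]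

variable (k B v) in
/-- The ideal of elements of positive order in the maximal order of `B_v`. -/
def maxIdeal : Ideal (maxOrder k B v) where
  carrier := {x | nv (x : LocalAlg k v B) < 1}
  add_mem' hx hy := (normValuation k B v).map_add_lt hx hy
  zero_mem' := by
    change nv ((0 : maxOrder k B v) : LocalAlg k v B) < 1
    rw [ZeroMemClass.coe_zero, nv_zero]
    exact zero_lt_one
  smul_mem' x y hy := by
    change nv ((x * y : maxOrder k B v) : LocalAlg k v B) < 1
    rw [MulMemClass.coe_mul, map_mul]
    rw [mul_comm]
    exact mul_lt_one_of_lt_of_le hy x.2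

theorem mem_maxIdeal {x : maxOrder k B v} : x ∈ maxIdeal k B v ↔ nv (x : LocalAlg k v B) < 1 :=
  Iff.rfl

instance : (maxIdeal k B v).IsTwoSided where
  mul_mem_of_left {x} y hx := by
    rw [mem_maxIdeal, MulMemClass.coe_mul, map_mul]
    exact mul_lt_one_of_lt_of_le hx y.2

instance : IsDomain (maxOrder k B v ⧸ maxIdeal k B v) := by
  have : Nontrivial (maxOrder k B v ⧸ maxIdeal k B v) := Ideal.Quotient.nontrivial_iff.2 fun h => by
    have : (1 : maxOrder k B v) ∈ maxIdeal k B v := h ▸ Submodule.mem_top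
    rw [mem_maxIdeal, OneMemClass.coe_one, map_one] at this
    exact lt_irrefl _ this
  have : NoZeroDivisors (maxOrder k B v ⧸ maxIdeal k B v) := by
    refine ⟨fun {x y} h => ?_⟩
    obtain ⟨x, rfl⟩ := Ideal.Quotient.mk_surjective x
    obtain ⟨y, rfl⟩ := Ideal.Quotient.mk_surjective y
    rw [← map_mul, Ideal.Quotient.eq_zero_iff_mem, mem_maxIdeal, MulMemClass.coe_mul, map_mul] at h
    rw [Ideal.Quotient.eq_zero_iff_mem, Ideal.Quotient.eq_zero_iff_mem, mem_maxIdeal, mem_maxIdeal]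
    by_contra! h1
    exact h.not_ge (one_le_mul h1.1 h1.2)
  exact NoZeroDivisors.to_isDomain _

instance : Module.Finite (v.adicCompletionIntegers k) (maxOrder k B v) :=
  Module.Finite.iff_fg.2 isOrder_maxOrder.fg

instance : Finite (maxOrder k B v ⧸ maxIdeal k B v) := by
  have h0 := finite_residueField_adicCompletionIntegers (k := k) v
  have h1 : Finite (v.adicCompletionIntegers k ⧸
    IsLocalRing.maximalIdeal (v.adicCompletionIntegers k)) := h0
  have h2 : Finite ((maxOrder k B v) ⧸ (⊤ : Submodule (v.adicCompletionIntegers k) (maxOrder k B v))) :=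
    inferInstance
  have h3 := Submodule.finite_quotient_smul
    (IsLocalRing.maximalIdeal (v.adicCompletionIntegers k)) (N := (⊤ : Submodule _ (maxOrder k B v)))
    Module.Finite.fg_top
  have h4 : IsLocalRing.maximalIdeal (v.adicCompletionIntegers k) •
      (⊤ : Submodule (v.adicCompletionIntegers k) (maxOrder k B v)) ≤
      (maxIdeal k B v).restrictScalars (v.adicCompletionIntegers k) := by
    refine Submodule.smul_le.2 fun a ha x _ => ?_
    change nv ((a : v.adicCompletion k) • (x : LocalAlg k v B)) < 1
    rw [nv_smul]
    exact mul_lt_one_of_lt_of_le (pow_lt_one₀ zero_le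
      ((valued_lt_one_iff_mem_maximalIdeal _).1 ha) finrank_pos.ne') x.2
  exact Finite.of_surjective (Submodule.factor h4) (Submodule.factor_surjective h4)

/-- The residue ring is a finite domain, hence commutative by Wedderburn's little theorem. -/
theorem nv_mul_sub_mul_lt_one {x y : LocalAlg k v B} (hx : nv x ≤ 1) (hy : nv y ≤ 1) :
    nv (x * y - y * x) < 1 := by
  have h := (Finite.isDomain_to_isField (maxOrder k B v ⧸ maxIdeal k B v)).mul_comm
    (Ideal.Quotient.mk _ ⟨x, hx⟩) (Ideal.Quotient.mk _ ⟨y, hy⟩)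
  rw [← map_mul, ← map_mul, Ideal.Quotient.eq] at h
  exact h

theorem exists_residue_generator : ∃ z : LocalAlg k v B, nv z ≤ 1 ∧
    ∀ x : LocalAlg k v B, nv x = 1 → ∃ j : ℕ, nv (x - z ^ j) < 1 := by
  let _ : Field (maxOrder k B v ⧸ maxIdeal k B v) :=
    (Finite.isDomain_to_isField (maxOrder k B v ⧸ maxIdeal k B v)).toField
  obtain ⟨ζ, hζ⟩ := IsCyclic.exists_generator (α := (maxOrder k B v ⧸ maxIdeal k B v)ˣ)
  obtain ⟨z, hz⟩ := Ideal.Quotient.mk_surjective (ζ : maxOrder k B v ⧸ maxIdeal k B v)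
  refine ⟨z, z.2, fun x hx => ?_⟩
  have hx0 : Ideal.Quotient.mk (maxIdeal k B v) ⟨x, hx.le⟩ ≠ 0 := by
    rw [ne_eq, Ideal.Quotient.eq_zero_iff_mem, mem_maxIdeal]
    exact hx.not_lt
  obtain ⟨j, hj⟩ := (mem_powers_iff_mem_zpowers.2 (hζ (Units.mk0 _ hx0)))
  refine ⟨j, ?_⟩
  have h := congrArg Units.val hj
  change (ζ : maxOrder k B v ⧸ maxIdeal k B v) ^ j = Ideal.Quotient.mk (maxIdeal k B v) ⟨x, hx.le⟩ at h
  rw [← hz, ← map_pow, eq_comm, Ideal.Quotient.eq] at h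
  exact h

/-- If `k_v` has a uniformizer that remains one in `B_v`, then `B_v` is commutative. -/
theorem commute_of_finrank_dvd_ord (h : ∀ u : (LocalAlg k v B)ˣ, (finrank k B : ℤ) ∣ ord u)
    (x y : LocalAlg k v B) : x * y = y * x := by
  obtain ⟨z, hz, hgen⟩ := exists_residue_generator (k := k) (B := B) (v := v)
  obtain ⟨c, hc0, hc⟩ := exists_valued_eq_exp k v
  -- Units of the maximal order are powers of $z$ up to elements of positive order. Such an element
  -- has order at least $\dim_kB$, the order of $c$, hence is $c$ times an integral element.
  -- Nakayama's lemma then shows that $z$ generates the maximal order.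
  have hle : Subalgebra.toSubmodule (maxOrder k B v) ≤
      Subalgebra.toSubmodule (Algebra.adjoin (v.adicCompletionIntegers k) {z}) := by
    refine Submodule.le_of_le_smul_of_le_jacobson_bot isOrder_maxOrder.fg
      (IsLocalRing.maximalIdeal_le_jacobson _) fun w hw => ?_
    have key (w : LocalAlg k v B) (hw : nv w < 1) :
        w ∈ IsLocalRing.maximalIdeal (v.adicCompletionIntegers k) •
          Subalgebra.toSubmodule (maxOrder k B v) := by
      by_cases hw0 : w = 0
      · rw [hw0]; exact zero_mem _
      obtain ⟨u, rfl⟩ := isUnit_of_ne_zero hw0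
      rw [nv_lt_one_iff] at hw
      have hcm : c ∈ v.adicCompletionIntegers k := by
        rw [mem_adicCompletionIntegers, hc, ← WithZero.exp_zero, WithZero.exp_le_exp]
        omega
      have h1 : (u : LocalAlg k v B) = (⟨c, hcm⟩ : v.adicCompletionIntegers k) •
          c⁻¹ • (u : LocalAlg k v B) := by
        rw [mk_smul_eq, smul_smul, mul_inv_cancel₀ hc0, one_smul]
      rw [h1]
      refine Submodule.smul_mem_smul ((valued_lt_one_iff_mem_maximalIdeal _).2 ?_) ?_
      · change Valued.v c < 1
        rw [hc, ← WithZero.exp_zero, WithZero.exp_lt_exp]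
        omega
      · change nv _ ≤ 1
        have hle := Int.le_of_dvd hw (h u)
        rw [nv_smul, map_inv₀, hc, ← WithZero.exp_neg, ← WithZero.exp_nsmul, nv_eq_exp,
          ← WithZero.exp_add, ← WithZero.exp_zero, WithZero.exp_le_exp, nsmul_eq_mul]
        omega
    rcases lt_or_eq_of_le (show nv w ≤ 1 from hw) with hw | hw
    · exact Submodule.mem_sup_right (key w hw)
    · obtain ⟨j, hj⟩ := hgen w hw
      rw [← add_sub_cancel (z ^ j) w]
      exact Submodule.add_mem_sup (pow_mem (Algebra.self_mem_adjoin_singleton _ z) j) (key _ hj)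
  have hcomm (x y : LocalAlg k v B) (hx : x ∈ maxOrder k B v) (hy : y ∈ maxOrder k B v) :
      x * y = y * x := by
    obtain ⟨f, rfl⟩ := Algebra.adjoin_singleton_eq_range_aeval (v.adicCompletionIntegers k) z ▸ hle hx
    obtain ⟨g, rfl⟩ := Algebra.adjoin_singleton_eq_range_aeval (v.adicCompletionIntegers k) z ▸ hle hy
    change Polynomial.aeval _ f * Polynomial.aeval _ g = Polynomial.aeval _ g * Polynomial.aeval _ f
    rw [← map_mul, mul_comm, map_mul]
  obtain ⟨a, ha0, ha⟩ := exists_smul_mem_of_span_eq_top v isOrder_maxOrder.span_eq_top x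
  obtain ⟨b, hb0, hb⟩ := exists_smul_mem_of_span_eq_top v isOrder_maxOrder.span_eq_top y
  have h1 := hcomm _ _ ha hb
  rw [smul_mul_smul_comm, smul_mul_smul_comm, mul_comm b a] at h1
  exact smul_right_injective _ (mul_ne_zero ha0 hb0) h1

end Residue

/-! ### Division places: double cosets through the order. -/

section Division

open HeightOneSpectrum Module
open scoped WithZero

variable {A k K D : Type*} [CommRing A] [IsDedekindDomain A] [Field k]
  [Algebra A k] [IsFractionRing A k] [Field K] [Algebra k K] [Algebra A K] [IsScalarTower A k K]
  [FiniteDimensional k K] [DivisionRing D] [Algebra k D] [Algebra A D] [IsScalarTower A k D]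
  [FiniteDimensional k D] {r : ℕ} {v : HeightOneSpectrum A}

theorem exists_mul_ne_mul {k D : Type*} [Field k] [DivisionRing D] [Algebra k D]
    [Algebra.IsCentral k D] (h : finrank k D ≠ 1) : ∃ x y : D, x * y ≠ y * x := by
  by_contra! hc
  refine h ?_
  rw [← Subalgebra.bot_eq_top_iff_finrank_eq_one, ← Algebra.IsCentral.center_eq_bot k D, eq_top_iff]
  exact fun x _ => Subalgebra.mem_center_iff.2 fun y => (hc y x)

variable [Ring.HasFiniteQuotients A]

theorem isDomain_of_localEmb [IsDomain (LocalAlg k v D)] (φ : K →ₐ[k] D) :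
    IsDomain (LocalAlg k v K) :=
  (localEmb_injective v φ).isDomain (localEmb v φ).toRingHom

theorem exists_mul_ne_mul_local [Algebra.IsCentral k D] (hr : r.Prime) (hD : finrank k D = r ^ 2) :
    ∃ x y : LocalAlg k v D, x * y ≠ y * x := by
  obtain ⟨x, y, hxy⟩ := exists_mul_ne_mul (k := k) (D := D) (by
    rw [hD]; exact (Nat.one_lt_pow two_ne_zero hr.one_lt).ne')
  let f : D →ₐ[k] LocalAlg k v D := Algebra.TensorProduct.includeRight
  have hf : Function.Injective f := Algebra.TensorProduct.includeRight_injective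
    (algebraMap k (v.adicCompletion k)).injective
  exact ⟨f x, f y, fun h => hxy (hf (by rw [map_mul, map_mul, h]))⟩

theorem exists_ord_dvd (v : HeightOneSpectrum A) (k B : Type*) [Field k] [Algebra A k]
    [IsFractionRing A k] [DivisionRing B] [Algebra k B] [FiniteDimensional k B] :
    ∃ p : (LocalAlg k v B)ˣ, ∃ g : ℕ, ord p = g ∧ g ∣ finrank k B ∧
      ∀ u : (LocalAlg k v B)ˣ, (g : ℤ) ∣ ord u := by
  obtain ⟨p, hp0, hp⟩ := exists_uniformizer (k := k) (B := B) (v := v)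
  obtain ⟨c, hc⟩ := exists_unit_valued_eq_exp k v
  have h0 := ord_map_units (B := B) c hc
  have h := hp (Units.map (algebraMap (v.adicCompletion k) (LocalAlg k v B)).toMonoidHom c)
  rw [h0] at h
  obtain ⟨g, hg⟩ := Int.eq_ofNat_of_zero_le hp0.le
  rw [hg] at h hp
  exact ⟨p, g, hg, Int.natCast_dvd_natCast.1 h, hp⟩

/-- The generator of the orders divides $r^2$; the values $1$ and $r^2$ would each make $D_v$
commutative. -/
theorem exists_ord_eq_of_prime [Algebra.IsCentral k D] [IsDomain (LocalAlg k v D)] (hr : r.Prime)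
    (hD : finrank k D = r ^ 2) : ∃ p : (LocalAlg k v D)ˣ, ord p = r ∧
      ∀ u : (LocalAlg k v D)ˣ, (r : ℤ) ∣ ord u := by
  obtain ⟨x, y, hne⟩ := exists_mul_ne_mul_local (v := v) hr hD
  obtain ⟨p, g, hg, h, hp⟩ := exists_ord_dvd v k D
  rw [hD] at h
  obtain ⟨i, hi, e⟩ := (Nat.dvd_prime_pow hr).1 h
  obtain rfl | rfl | rfl : i = 0 ∨ i = 1 ∨ i = 2 := by omega
  · rw [e, pow_zero, Nat.cast_one] at hg
    exact absurd (commute_of_ord_eq_one hg x y) hne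
  · rw [e, pow_one] at hp hg
    exact ⟨p, hg, hp⟩
  · rw [e, ← hD] at hp
    exact absurd (commute_of_finrank_dvd_ord hp x y) hne

/-- Both sides express integrality over $\mathcal O_v$, which does not depend on the ambient
algebra. -/
theorem nv_localEmb_le_one_iff [IsDomain (LocalAlg k v D)] [IsDomain (LocalAlg k v K)]
    (φ : K →ₐ[k] D) (x : LocalAlg k v K) : nv (localEmb v φ x) ≤ 1 ↔ nv x ≤ 1 := by
  rw [← mem_maxOrder, ← mem_maxOrder, mem_maxOrder_iff_isIntegral, mem_maxOrder_iff_isIntegral]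
  exact isIntegral_algHom_iff ((localEmb v φ).restrictScalars (v.adicCompletionIntegers k))
    (localEmb_injective v φ)

theorem ord_localUnitsEmb_nonneg_iff [IsDomain (LocalAlg k v D)] [IsDomain (LocalAlg k v K)]
    (φ : K →ₐ[k] D) (u : (LocalAlg k v K)ˣ) : 0 ≤ ord (localUnitsEmb v φ u) ↔ 0 ≤ ord u := by
  rw [← nv_le_one_iff, ← nv_le_one_iff]
  rw [← nv_localEmb_le_one_iff φ]
  rfl

theorem ord_localUnitsEmb_eq_zero [IsDomain (LocalAlg k v D)] [IsDomain (LocalAlg k v K)]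
    (φ : K →ₐ[k] D) {u : (LocalAlg k v K)ˣ} (hu : ord u = 0) : ord (localUnitsEmb v φ u) = 0 := by
  have h1 := (ord_localUnitsEmb_nonneg_iff φ u).2 hu.ge
  have h2 := (ord_localUnitsEmb_nonneg_iff φ u⁻¹).2 (by rw [ord_inv, hu, neg_zero])
  rw [map_inv, ord_inv] at h2
  omega

theorem ord_localUnitsEmb [IsDomain (LocalAlg k v D)] [IsDomain (LocalAlg k v K)]
    (φ : K →ₐ[k] D) {p : (LocalAlg k v K)ˣ} {j : ℤ} {u : (LocalAlg k v K)ˣ}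
    (hu : ord u = j * ord p) : ord (localUnitsEmb v φ u) = j * ord (localUnitsEmb v φ p) := by
  have h := ord_localUnitsEmb_eq_zero φ (u := u * (p ^ j)⁻¹) (by
    rw [ord_mul, ord_inv, ord_zpow, hu, add_neg_cancel])
  rw [map_mul, ord_mul, map_inv, map_zpow, ord_inv, ord_zpow] at h
  omega

/-- A uniformizer of $k_v$ has order $r$ in $K_v$ and $r^2$ in $D_v$, which fixes the
proportionality factor. -/
theorem ord_localUnitsEmb_uniformizer [IsDomain (LocalAlg k v D)] [IsDomain (LocalAlg k v K)]
    (hr : r.Prime) (hD : finrank k D = r ^ 2) (hK : finrank k K = r)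
    (φ : K →ₐ[k] D) {p : (LocalAlg k v K)ˣ} (hp : ∀ u : (LocalAlg k v K)ˣ, ord p ∣ ord u) :
    ord (localUnitsEmb v φ p) = r * ord p := by
  obtain ⟨c, hc⟩ := exists_unit_valued_eq_exp k v
  have h1 := ord_map_units (B := K) c hc
  have h2 := ord_map_units (B := D) c hc
  obtain ⟨e, he⟩ := hp (Units.map (algebraMap (v.adicCompletion k) (LocalAlg k v K)).toMonoidHom
    c)
  have h3 := ord_localUnitsEmb φ (he.trans (mul_comm _ _))
  have h4 : localUnitsEmb v φ (Units.map
      (algebraMap (v.adicCompletion k) (LocalAlg k v K)).toMonoidHom c) =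
      Units.map (algebraMap (v.adicCompletion k) (LocalAlg k v D)).toMonoidHom c :=
    Units.ext ((localEmb v φ).commutes (c : v.adicCompletion k))
  rw [h4, h2, hD] at h3
  rw [he, hK] at h1
  have he0 : e ≠ 0 := by
    rintro rfl
    rw [mul_zero] at h1
    exact hr.ne_zero (by exact_mod_cast h1.symm)
  refine mul_left_cancel₀ he0 ?_
  rw [← h3]
  push_cast
  linear_combination (-r : ℤ) * h1

/-- $O_{D,v}^*$ is the kernel of `ord`, and `ord` divided by $r$ maps $D_v^*$ onto $\mathbb Z$ and
$\phi_v(K_v^*)$ onto $g\mathbb Z$. -/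
theorem card_doubleCosets_of_division [Algebra.IsCentral k D] [IsDomain (LocalAlg k v D)]
    [IsDomain (LocalAlg k v K)]
    (hr : r.Prime) (hD : finrank k D = r ^ 2) (hK : finrank k K = r)
    (φ : K →ₐ[k] D) {g : ℕ} {p : (LocalAlg k v K)ˣ} (hpg : ord p = g)
    (hp : ∀ u : (LocalAlg k v K)ˣ, ord p ∣ ord u) (OD : Subalgebra A D)
    (hOD : localOrder v OD = maxOrder k D v) :
    Nonempty (doubleCosets (localUnitsImage v φ) (localUnits v OD) Set.univ ≃ ZMod g) := by
  obtain ⟨q, hq, hqd⟩ := exists_ord_eq_of_prime (v := v) hr hD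
  have hr0 : (r : ℤ) ≠ 0 := by exact_mod_cast hr.ne_zero
  have hU (u : (LocalAlg k v D)ˣ) : u ∈ localUnits v OD ↔ ord u = 0 := by
    rw [mem_localUnits, hOD, mem_maxOrder, mem_maxOrder, nv_le_one_iff, nv_le_one_iff, ord_inv]
    omega
  have ht := ord_localUnitsEmb_uniformizer hr hD hK φ hp
  choose d hd using hqd
  refine equiv_image_of_surjective (fun b : (Set.univ : Set (LocalAlg k v D)ˣ) => (d b : ZMod g))
    (fun c => ?_) fun a b => ?_
  · refine ⟨⟨q ^ (c.cast : ℤ), trivial⟩, ?_⟩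
    have : (d (q ^ (c.cast : ℤ)) : ℤ) = c.cast := by
      have := hd (q ^ (c.cast : ℤ))
      rw [ord_zpow, hq, mul_comm] at this
      exact (mul_left_cancel₀ hr0 this).symm
    simp [this]
  · rw [doubleCoset_eq_iff, ZMod.intCast_eq_intCast_iff_dvd_sub]
    constructor
    · rintro ⟨_, ⟨t, rfl⟩, u, hu, e⟩
      change (a : (LocalAlg k v D)ˣ) = localUnitsEmb v φ t * b * u at e
      have h := congrArg ord e
      obtain ⟨j, hj⟩ := hp t
      rw [ord_mul, ord_mul, (hU u).1 hu, ord_localUnitsEmb φ (hj.trans (mul_comm _ _)), ht, hd, hd b,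
        hpg] at h
      refine ⟨-j, mul_left_cancel₀ hr0 ?_⟩
      linear_combination -h
    · rintro ⟨j, hj⟩
      refine ⟨localUnitsEmb v φ (p ^ (-j)), ⟨_, rfl⟩,
        (b : (LocalAlg k v D)ˣ)⁻¹ * (localUnitsEmb v φ (p ^ (-j)))⁻¹ * a, ?_, by group⟩
      rw [hU, ord_mul, ord_mul, ord_inv, ord_inv, map_zpow, ord_zpow, ht, hd a, hd b, hpg]
      linear_combination -(r : ℤ) * hj

/-- The norm is invariant under conjugation, so $b$ plays no role and the pullback of $O_{D,v}$ is
always the maximal order of $K_v$. -/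
theorem localOptimal_of_division [IsDomain (LocalAlg k v D)]
    [IsDomain (LocalAlg k v K)] (φ : K →ₐ[k] D) (OD : Subalgebra A D)
    (hOD : localOrder v OD = maxOrder k D v) (R : Subalgebra A K) (b : (LocalAlg k v D)ˣ) :
    b ∈ localOptimal v φ OD R ↔ localOrder v R = maxOrder k K v := by
  have h (x : LocalAlg k v K) : ↑b⁻¹ * localEmb v φ x * ↑b ∈ localOrder v OD ↔
      x ∈ maxOrder k K v := by
    rw [hOD, mem_maxOrder, mem_maxOrder, ← nv_localEmb_le_one_iff φ, map_mul, map_mul,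
      mul_right_comm, ← map_mul, Units.inv_mul, map_one, one_mul]
  simp only [localOptimal, Set.mem_ofPred_eq, h, SetLike.ext_iff]
  exact forall_congr' fun x => Iff.comm

end Division

/-! ### Ramification of $v$ in $K_v$ in terms of the order. -/

section Unramified

open HeightOneSpectrum Module IsLocalRing
open scoped WithZero

variable {A k K : Type*} [CommRing A] [IsDedekindDomain A] [Field k]
  [Algebra A k] [IsFractionRing A k] [Field K] [Algebra k K]
  [FiniteDimensional k K] {v : HeightOneSpectrum A}
  [Ring.HasFiniteQuotients A] [IsDomain (LocalAlg k v K)]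

theorem mem_integralClosure_iff {x : LocalAlg k v K} :
    x ∈ integralClosure (v.adicCompletionIntegers k) (LocalAlg k v K) ↔ nv x ≤ 1 :=
  mem_maxOrder_iff_isIntegral.symm

theorem isUnit_integralClosure_iff
    {x : integralClosure (v.adicCompletionIntegers k) (LocalAlg k v K)} :
    IsUnit x ↔ nv (x : LocalAlg k v K) = 1 := by
  constructor
  · rintro ⟨u, rfl⟩
    have h : (u : LocalAlg k v K) * ((↑u⁻¹ : integralClosure (v.adicCompletionIntegers k)
        (LocalAlg k v K)) : LocalAlg k v K) = 1 := by
      rw [← MulMemClass.coe_mul, Units.mul_inv, OneMemClass.coe_one]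
    have h1 := congrArg nv h
    rw [map_mul, map_one] at h1
    refine le_antisymm (mem_integralClosure_iff.1 u.1.2) ?_
    rw [← h1]
    exact mul_le_of_le_one_right zero_le (mem_integralClosure_iff.1 (Subtype.prop _))
  · intro hx
    have hx0 : (x : LocalAlg k v K) ≠ 0 := by
      intro h
      rw [h, nv_zero] at hx
      exact zero_ne_one hx
    obtain ⟨u, hu⟩ := isUnit_of_ne_zero hx0
    rw [← hu, nv_eq_one_iff] at hx
    have h1 : (↑u⁻¹ : LocalAlg k v K) ∈
        integralClosure (v.adicCompletionIntegers k) (LocalAlg k v K) := by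
      rw [mem_integralClosure_iff, nv_le_one_iff, ord_inv, hx, neg_zero]
    exact IsUnit.of_mul_eq_one ⟨_, h1⟩ (Subtype.ext (by
      rw [MulMemClass.coe_mul, ← hu, Units.mul_inv, OneMemClass.coe_one]))

instance : IsLocalRing (integralClosure (v.adicCompletionIntegers k) (LocalAlg k v K)) := by
  refine IsLocalRing.of_nonunits_add fun x y hx hy => ?_
  rw [mem_nonunits_iff, isUnit_integralClosure_iff] at *
  refine (lt_of_le_of_lt ((normValuation k K v).map_add _ _) (max_lt ?_ ?_)).ne
  · exact lt_of_le_of_ne (mem_integralClosure_iff.1 x.2) hx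
  · exact lt_of_le_of_ne (mem_integralClosure_iff.1 y.2) hy

theorem mem_maximalIdeal_integralClosure
    {x : integralClosure (v.adicCompletionIntegers k) (LocalAlg k v K)} :
    x ∈ maximalIdeal (integralClosure (v.adicCompletionIntegers k) (LocalAlg k v K)) ↔
      nv (x : LocalAlg k v K) < 1 := by
  rw [mem_maximalIdeal, mem_nonunits_iff, isUnit_integralClosure_iff]
  exact ⟨lt_of_le_of_ne (mem_integralClosure_iff.1 x.2), fun h => h.ne⟩

theorem coe_algebraMap_integralClosure (a : v.adicCompletionIntegers k) :
    ((algebraMap _ (integralClosure (v.adicCompletionIntegers k) (LocalAlg k v K)) a :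
      integralClosure (v.adicCompletionIntegers k) (LocalAlg k v K)) : LocalAlg k v K) =
      algebraMap (v.adicCompletion k) _ (a : v.adicCompletion k) := rfl

instance : IsLocalHom (algebraMap (v.adicCompletionIntegers k)
    (integralClosure (v.adicCompletionIntegers k) (LocalAlg k v K))) where
  map_nonunit a ha := by
    rw [isUnit_integralClosure_iff, coe_algebraMap_integralClosure, nv_algebraMap] at ha
    by_contra h
    exact (pow_lt_one₀ zero_le ((valued_lt_one_iff_mem_maximalIdeal a).1 h) finrank_pos.ne').ne ha

instance : Module.Finite (v.adicCompletionIntegers k)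
    (integralClosure (v.adicCompletionIntegers k) (LocalAlg k v K)) := by
  have h : Subalgebra.toSubmodule (integralClosure (v.adicCompletionIntegers k) (LocalAlg k v K)) =
      Subalgebra.toSubmodule (maxOrder k K v) :=
    SetLike.ext fun x => mem_maxOrder_iff_isIntegral.symm
  have h2 : (Subalgebra.toSubmodule
    (integralClosure (v.adicCompletionIntegers k) (LocalAlg k v K))).FG := h ▸ isOrder_maxOrder.fg
  exact Module.Finite.iff_fg.2 h2

/-- Finite residue fields are perfect, so separability of the residue extension is automatic. -/
theorem isUnramifiedPlace_iff_map : IsUnramifiedPlace v k K ↔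
    (maximalIdeal (v.adicCompletionIntegers k)).map (algebraMap _
      (integralClosure (v.adicCompletionIntegers k) (LocalAlg k v K))) = maximalIdeal _ := by
  have h0 := finite_residueField_adicCompletionIntegers (k := k) v
  rw [IsUnramifiedPlace, Algebra.FormallyUnramified.iff_map_maximalIdeal_eq]
  exact and_iff_right inferInstance

theorem isUnramifiedPlace_iff {p : (LocalAlg k v K)ˣ} {g : ℕ} (hg : ord p = g)
    (hp : ∀ u : (LocalAlg k v K)ˣ, (g : ℤ) ∣ ord u) :
    IsUnramifiedPlace v k K ↔ g = finrank k K := by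
  obtain ⟨c, hc⟩ := exists_unit_valued_eq_exp k v
  have hcK := ord_map_units (B := K) c hc
  have hgd : g ∣ finrank k K := by
    have := hp (Units.map (algebraMap (v.adicCompletion k) (LocalAlg k v K)).toMonoidHom c)
    rw [hcK] at this
    exact Int.natCast_dvd_natCast.1 this
  have hpos := finrank_pos (R := k) (M := K)
  have hg0 := Nat.pos_of_dvd_of_pos hgd hpos
  have hvlt (a : v.adicCompletion k) (ha : Valued.v a < 1) :
      Valued.v a ≤ WithZero.exp (-1 : ℤ) := by
    by_cases h0 : Valued.v a = 0
    · rw [h0]; exact zero_le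
    · rw [← WithZero.log_le_iff_le_exp h0]
      rw [← WithZero.exp_zero, ← WithZero.log_lt_iff_lt_exp h0] at ha
      omega
  rw [isUnramifiedPlace_iff_map]
  constructor
  · intro h
    -- The elements of order at least $[K:k]$, the order of a uniformizer of $k_v$. In the
    -- unramified case the maximal ideal, and with it `p`, lies in `J`, so $g\ge[K:k]$.
    let J : Ideal (integralClosure (v.adicCompletionIntegers k) (LocalAlg k v K)) :=
      { carrier := {x | nv (x : LocalAlg k v K) ≤ WithZero.exp (-(finrank k K : ℤ))}
        add_mem' := fun hx hy => nv_add_le hx hy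
        zero_mem' := by
          change nv (0 : LocalAlg k v K) ≤ _
          rw [nv_zero]
          exact zero_le
        smul_mem' := fun x y hy => by
          change nv ((x : LocalAlg k v K) * (y : LocalAlg k v K)) ≤ _
          rw [map_mul]
          exact (mul_le_of_le_one_left zero_le (mem_integralClosure_iff.1 x.2)).trans hy }
    have hJ : (maximalIdeal (v.adicCompletionIntegers k)).map (algebraMap _
      (integralClosure (v.adicCompletionIntegers k) (LocalAlg k v K))) ≤ J := by
      rw [Ideal.map_le_iff_le_comap]
      intro a ha
      change nv (algebraMap (v.adicCompletion k) (LocalAlg k v K) a) ≤ _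
      rw [nv_algebraMap]
      refine (pow_le_pow_left₀ zero_le
        (hvlt _ ((valued_lt_one_iff_mem_maximalIdeal a).1 ha)) _).trans ?_
      rw [← WithZero.exp_nsmul, WithZero.exp_le_exp, nsmul_eq_mul]
      omega
    rw [h] at hJ
    have hpS : (p : LocalAlg k v K) ∈
        integralClosure (v.adicCompletionIntegers k) (LocalAlg k v K) := by
      rw [mem_integralClosure_iff, nv_le_one_iff, hg]
      omega
    have h1 : nv (p : LocalAlg k v K) ≤ WithZero.exp (-(finrank k K : ℤ)) :=
      hJ (x := ⟨p, hpS⟩) (mem_maximalIdeal_integralClosure.2 (by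
        change nv (p : LocalAlg k v K) < 1
        rw [nv_lt_one_iff, hg]
        omega))
    rw [nv_eq_exp, WithZero.exp_le_exp, hg] at h1
    exact le_antisymm (Nat.le_of_dvd hpos hgd) (by omega)
  · rintro rfl
    refine le_antisymm (((local_hom_TFAE (algebraMap _ _)).out 0 2 rfl rfl).1 inferInstance) ?_
    intro x hx
    rw [mem_maximalIdeal_integralClosure] at hx
    by_cases hx0 : (x : LocalAlg k v K) = 0
    · rw [show x = 0 from Subtype.ext hx0]
      exact zero_mem _
    obtain ⟨u, hu⟩ := isUnit_of_ne_zero hx0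
    rw [← hu, nv_lt_one_iff] at hx
    have hle := Int.le_of_dvd hx (hp u)
    have hcm : (c : v.adicCompletion k) ∈ v.adicCompletionIntegers k := by
      rw [mem_adicCompletionIntegers, hc, ← WithZero.exp_zero, WithZero.exp_le_exp]
      omega
    let w := (Units.map (algebraMap (v.adicCompletion k) (LocalAlg k v K)).toMonoidHom c)
    have hy : (↑(w⁻¹ * u) : LocalAlg k v K) ∈
        integralClosure (v.adicCompletionIntegers k) (LocalAlg k v K) := by
      rw [mem_integralClosure_iff, nv_le_one_iff, ord_mul, ord_inv, hcK]
      omega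
    have hxe : x = algebraMap _ _ (⟨c, hcm⟩ : v.adicCompletionIntegers k) * ⟨_, hy⟩ := by
      refine Subtype.ext ?_
      change (x : LocalAlg k v K) = (w : LocalAlg k v K) * ↑(w⁻¹ * u)
      rw [Units.val_mul, Units.mul_inv_cancel_left, hu]
    rw [hxe]
    refine Ideal.mul_mem_right _ _ (Ideal.mem_map_of_mem _ ?_)
    rw [valued_lt_one_iff_mem_maximalIdeal]
    change Valued.v (c : v.adicCompletion k) < 1
    rw [hc, ← WithZero.exp_zero, WithZero.exp_lt_exp]
    omega

end Unramified

/-! ### The local factors and their finiteness. -/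

section LocalFactor

open HeightOneSpectrum Module
open scoped WithZero

variable {A k K D : Type*} [CommRing A] [IsDedekindDomain A] [Field k]
  [Algebra A k] [IsFractionRing A k] [Field K] [Algebra k K] [Algebra A K] [IsScalarTower A k K]
  [FiniteDimensional k K] [DivisionRing D] [Algebra k D] [Algebra A D] [IsScalarTower A k D]
  [FiniteDimensional k D] {r : ℕ} {v : HeightOneSpectrum A}

theorem isEmpty_algEquiv_matrix [IsDomain (LocalAlg k v D)] (hr : r.Prime) :
    IsEmpty (LocalAlg k v D ≃ₐ[v.adicCompletion k] Matrix (Fin r) (Fin r) (v.adicCompletion k)) := by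
  refine ⟨fun θ => ?_⟩
  have : IsDomain (Matrix (Fin r) (Fin r) (v.adicCompletion k)) := θ.symm.toMulEquiv.isDomain _
  obtain ⟨i, j, hij⟩ : ∃ i j : Fin r, i ≠ j := ⟨⟨0, hr.pos⟩, ⟨1, hr.one_lt⟩, by simp⟩
  have h : Matrix.single i j (1 : v.adicCompletion k) * Matrix.single i j 1 = 0 :=
    Matrix.single_mul_single_of_ne _ _ _ _ hij.symm _
  have h1 : Matrix.single i j (1 : v.adicCompletion k) i j = 0 := by
    rw [mul_self_eq_zero.1 h, Matrix.zero_apply]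
  rw [Matrix.single_apply_same] at h1
  exact one_ne_zero h1

variable [Ring.HasFiniteQuotients A] [Algebra.IsCentral k D]

theorem card_localCosets_of_division [IsDomain (LocalAlg k v D)] (hr : r.Prime)
    (hD : finrank k D = r ^ 2) (hK : finrank k K = r) (φ : K →ₐ[k] D) (OD : Subalgebra A D)
    (hOD : IsMaximalOrder k OD) (R : Subalgebra A K) :
    (localCosets v φ OD R).Finite ∧ (localCosets v φ OD R).ncard = localFactor r v φ R := by
  have hDK := isDomain_of_localEmb (v := v) φ
  have hθ := isEmpty_algEquiv_matrix (k := k) (v := v) (D := D) hr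
  have hmax := isMaximalOrder_iff.1 (isMaximalOrder_localOrder v OD hOD)
  rw [localFactor, dif_neg (not_nonempty_iff.2 hθ), isMaximalOrder_iff]
  split_ifs with h1 h2
  all_goals obtain ⟨p, g, hg, hgd, hp⟩ := exists_ord_dvd v k K
  · have huniv : localOptimal v φ OD R = Set.univ :=
      Set.eq_univ_of_forall fun b => (localOptimal_of_division φ OD hmax R b).2 h1
    obtain ⟨e⟩ := card_doubleCosets_of_division hr hD hK φ hg (hg ▸ hp) OD hmax
    rw [isUnramifiedPlace_iff hg hp, hK] at h2
    subst h2
    have : NeZero g := ⟨hr.ne_zero⟩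
    rw [localCosets, huniv]
    exact ⟨Finite.of_equiv _ e.symm,
      (Nat.card_congr e).trans (Nat.card_zmod g)⟩
  · have huniv : localOptimal v φ OD R = Set.univ :=
      Set.eq_univ_of_forall fun b => (localOptimal_of_division φ OD hmax R b).2 h1
    obtain ⟨e⟩ := card_doubleCosets_of_division hr hD hK φ hg (hg ▸ hp) OD hmax
    rw [isUnramifiedPlace_iff hg hp, hK] at h2
    rw [hK] at hgd
    obtain rfl := (hr.eq_one_or_self_of_dvd g hgd).resolve_right h2
    rw [localCosets, huniv]
    exact ⟨Finite.of_equiv _ e.symm, (Nat.card_congr e).trans (Nat.card_zmod 1)⟩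
  · have hempty : localOptimal v φ OD R = ∅ :=
      Set.eq_empty_of_forall_notMem fun b hb => h1 ((localOptimal_of_division φ OD hmax R b).1 hb)
    rw [localCosets, hempty, doubleCosets, Set.image_empty]
    exact ⟨Set.finite_empty, Set.ncard_empty _⟩

/-- The number of lattice classes is independent of `θ`, because for each choice it equals the
number of local double cosets. -/
theorem card_quotient_latticeSetoid (hr : r.Prime)
    (hD : finrank k D = r ^ 2) (hK : finrank k K = r) (φ : K →ₐ[k] D) (OD : Subalgebra A D)
    (hOD : IsMaximalOrder k OD) (R : Subalgebra A K)
    (θ : LocalAlg k v D ≃ₐ[v.adicCompletion k] Matrix (Fin r) (Fin r) (v.adicCompletion k)) :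
    Nat.card (Quotient (latticeSetoid v φ R θ)) = localFactor r v φ R ∧
      (localCosets v φ OD R).ncard = localFactor r v φ R := by
  have h : Nonempty (LocalAlg k v D ≃ₐ[v.adicCompletion k]
      Matrix (Fin r) (Fin r) (v.adicCompletion k)) := ⟨θ⟩
  obtain ⟨e⟩ := card_localCosets_of_split hr hD hK φ OD hOD R θ
  obtain ⟨e'⟩ := card_localCosets_of_split hr hD hK φ OD hOD R h.some
  rw [localFactor, dif_pos h]
  exact ⟨Nat.card_congr (e.symm.trans e'), Nat.card_congr e'⟩

variable (k D) in
theorem nonempty_algEquiv_or_isDomain (v : HeightOneSpectrum A) (hr : r.Prime)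
    (hD : finrank k D = r ^ 2) :
    Nonempty (LocalAlg k v D ≃ₐ[v.adicCompletion k]
      Matrix (Fin r) (Fin r) (v.adicCompletion k)) ∨ IsDomain (LocalAlg k v D) := by
  refine (matrix_or_division hr hD).imp_right fun h => ?_
  have : NoZeroDivisors (LocalAlg k v D) := ⟨fun {x y} hxy => by
    by_cases hx : x = 0
    · exact Or.inl hx
    · exact Or.inr ((h x hx).mul_right_eq_zero.1 hxy)⟩
  exact NoZeroDivisors.to_isDomain _

/-- `D` splits at almost all places. -/
theorem finite_isDomain_localAlg (hr : r.Prime) (hD : finrank k D = r ^ 2)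
    (OD : Subalgebra A D) (hOD : IsMaximalOrder k OD) :
    {v : HeightOneSpectrum A | IsDomain (LocalAlg k v D)}.Finite := by
  have hl : (Subalgebra.toSubmodule OD).IsLattice k := hOD.1
  -- Two non-commuting elements, scaled into $O_D$, have a nonzero commutator, which is a unit of
  -- $O_{D,v}$ at almost all $v$. Where $D_v$ is a division algebra the residue ring is commutative,
  -- so there the commutator has positive order.
  obtain ⟨x, y, hxy⟩ := exists_mul_ne_mul (k := k) (D := D) (by
    rw [hD]; exact (Nat.one_lt_pow two_ne_zero hr.one_lt).ne')
  obtain ⟨a, ha0, ha⟩ := exists_smul_mem_of_isLattice (k := k) (Subalgebra.toSubmodule OD) x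
  obtain ⟨b, hb0, hb⟩ := exists_smul_mem_of_isLattice (k := k) (Subalgebra.toSubmodule OD) y
  rw [Subalgebra.mem_toSubmodule] at ha hb
  have hc0 : (a • x) * (b • y) - (b • y) * (a • x) ≠ 0 := by
    rw [smul_mul_smul_comm, smul_mul_smul_comm, mul_comm b a, ← smul_sub, ← algebraMap_smul k]
    exact smul_ne_zero (by simpa using ⟨ha0, hb0⟩) (sub_ne_zero.2 hxy)
  generalize a • x = x at ha hc0
  generalize b • y = y at hb hc0
  let u : (AdelicAlg A k D)ˣ := Units.map
    (Algebra.TensorProduct.includeRight : D →ₐ[k] AdelicAlg A k D).toRingHom.toMonoidHom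
    (Units.mk0 _ hc0)
  refine (finite_unitComponent_notMem OD hOD.1 u).subset fun v hv hmem => ?_
  have hv : IsDomain (LocalAlg k v D) := hv
  have hmax := isMaximalOrder_iff.1 (isMaximalOrder_localOrder v OD hOD)
  have hle (z : D) (hz : z ∈ OD) : nv (1 ⊗ₜ[k] z : LocalAlg k v D) ≤ 1 := by
    rw [← mem_maxOrder, ← hmax, mem_localOrder_iff]
    exact tmul_mem_locSpan v hz
  have h1 : (unitComponent v u : LocalAlg k v D) =
      1 ⊗ₜ[k] x * 1 ⊗ₜ[k] y - 1 ⊗ₜ[k] y * 1 ⊗ₜ[k] x := by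
    change component k v D (1 ⊗ₜ[k] (x * y - y * x)) = _
    rw [component, Algebra.TensorProduct.map_tmul, map_one, AlgHom.id_apply,
      Algebra.TensorProduct.tmul_mul_tmul, Algebra.TensorProduct.tmul_mul_tmul, mul_one,
      TensorProduct.tmul_sub]
  have h2 := nv_mul_sub_mul_lt_one (hle x ha) (hle y hb)
  rw [← h1, nv_lt_one_iff] at h2
  rw [mem_localUnits, hmax, mem_maxOrder, mem_maxOrder, nv_le_one_iff, nv_le_one_iff, ord_inv] at hmem
  omega

variable {F : Type*} [Field F] [Finite F]

theorem localFactor_spec {f : Polynomial F →+* A} (hfi : Function.Injective f)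
    (hff : f.Finite) (hr : r.Prime) (hD : finrank k D = r ^ 2) (hK : finrank k K = r)
    (φ : K →ₐ[k] D) (OD : Subalgebra A D) (hOD : IsMaximalOrder k OD) (R : Subalgebra A K)
    (hR : IsOrder k R) :
    (∀ (v : HeightOneSpectrum A)
      (θ : LocalAlg k v D ≃ₐ[v.adicCompletion k] Matrix (Fin r) (Fin r) (v.adicCompletion k)),
      Finite (Quotient (latticeSetoid v φ R θ)) ∧
      Nat.card (Quotient (latticeSetoid v φ R θ)) = localFactor r v φ R) ∧
    (Function.mulSupport fun v : HeightOneSpectrum A => localFactor r v φ R).Finite ∧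
    ∀ v : HeightOneSpectrum A, (localCosets v φ OD R).Finite ∧
      (localCosets v φ OD R).ncard = localFactor r v φ R := by
  obtain ⟨T, hT, hTl, hTv⟩ := exists_finite_lattices_local (k := k) hfi hff R hR
  have hRl : (Subalgebra.toSubmodule R).IsLattice k := hR
  let b := Module.finBasis k K
  have hθ (v : HeightOneSpectrum A)
      (θ : LocalAlg k v D ≃ₐ[v.adicCompletion k] Matrix (Fin r) (Fin r) (v.adicCompletion k)) :
      Finite (Quotient (latticeSetoid v φ R θ)) :=
    finite_quotient_latticeSetoid hr hK θ hT (hTv v)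
  refine ⟨fun v θ => ⟨hθ v θ, (card_quotient_latticeSetoid hr hD hK φ OD hOD R θ).1⟩, ?_,
    fun v => ?_⟩
  -- The places where $D$ does not split, or where $R$ or one of the finitely many representatives
  -- differs from the unit box, are finite in number; elsewhere `card_quotient_latticeSetoid_eq_one`
  -- applies.
  · have hT1 : (⋃ M ∈ T, {v : HeightOneSpectrum A | locSpan v M ≠ box v b 1}).Finite :=
      hT.biUnion fun M hM => by
        have := hTl M hM
        exact finite_locSpan_ne_box b M
    refine (((finite_isDomain_localAlg hr hD OD hOD).union hT1).union
      (finite_locSpan_ne_box b (Subalgebra.toSubmodule R))).subset fun v hv => ?_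
    by_contra h
    simp only [Set.mem_union, Set.mem_iUnion, Set.mem_ofPred_eq, not_or, not_exists,
      not_not] at h
    obtain ⟨θ⟩ := (nonempty_algEquiv_or_isDomain k D v hr hD).resolve_right h.1.1
    refine hv (?_ : localFactor r v φ R = 1)
    rw [← (card_quotient_latticeSetoid hr hD hK φ OD hOD R θ).1]
    exact card_quotient_latticeSetoid_eq_one hr hK hR θ (hTv v) fun M hM => by
      rw [h.1.2 M hM, h.2]
  · rcases nonempty_algEquiv_or_isDomain k D v hr hD with ⟨⟨θ⟩⟩ | h
    · obtain ⟨e⟩ := card_localCosets_of_split hr hD hK φ OD hOD R θ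
      have := hθ v θ
      exact ⟨Finite.of_equiv _ e.symm, (card_quotient_latticeSetoid hr hD hK φ OD hOD R θ).2⟩
    · exact card_localCosets_of_division hr hD hK φ OD hOD R

end LocalFactor
end OptEmb

end

/-! ### Assembly of the global count. -/

theorem mainTheorem8
    (Fq : Type*) [Field Fq] [Finite Fq]
    (k : Type*) [Field k] [Algebra Fq⟮X⟯ k] [FunctionField Fq k]
    (A : Type*) [CommRing A] [IsDedekindDomain A] [Algebra A k] [IsFractionRing A k]
    (P : ValuationSubring k) (hP : OptEmb.IsAwayFrom A P)
    (r : ℕ) (hr : r.Prime)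
    (D : Type*) [DivisionRing D] [Algebra k D] [Algebra A D] [IsScalarTower A k D]
    [Algebra.IsCentral k D] (hD : Module.finrank k D = r ^ 2)
    (OD : Subalgebra A D) (hOD : OptEmb.IsMaximalOrder k OD)
    (K : Type*) [Field K] [Algebra k K] [Algebra A K] [IsScalarTower A k K]
    (hK : Module.finrank k K = r) (hKim : OptEmb.IsImaginary P K)
    (φ : K →ₐ[k] D)
    (R : Subalgebra A K) (hR : OptEmb.IsOrder k R) :
    -- the class number and the local factors are well defined: they count finite sets,
    -- and almost all local factors are equal to `1`
    (OptEmb.classSet k R).Finite ∧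
    (∀ (v : HeightOneSpectrum A)
      (θ : OptEmb.LocalAlg k v D ≃ₐ[v.adicCompletion k]
        Matrix (Fin r) (Fin r) (v.adicCompletion k)),
      Finite (Quotient (OptEmb.latticeSetoid v φ R θ)) ∧
      Nat.card (Quotient (OptEmb.latticeSetoid v φ R θ)) = OptEmb.localFactor r v φ R) ∧
    (Function.mulSupport fun v : HeightOneSpectrum A => OptEmb.localFactor r v φ R).Finite ∧
    -- the local factors count the local optimal embeddings
    (∀ v : HeightOneSpectrum A,
      (OptEmb.doubleCosets (OptEmb.localUnitsImage v φ) (OptEmb.localUnits v OD)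
        (OptEmb.localOptimal v φ OD R)).Finite ∧
      (OptEmb.doubleCosets (OptEmb.localUnitsImage v φ) (OptEmb.localUnits v OD)
        (OptEmb.localOptimal v φ OD R)).ncard = OptEmb.localFactor r v φ R) ∧
    -- the double coset space of optimal embeddings is finite, of cardinality `h^D(R)`
    (OptEmb.doubleCosets (OptEmb.globalUnitsImage A φ) (OptEmb.adelicUnits OD)
      (OptEmb.optimalEmbeddings φ OD R)).Finite ∧
    (OptEmb.doubleCosets (OptEmb.globalUnitsImage A φ) (OptEmb.adelicUnits OD)
      (OptEmb.optimalEmbeddings φ OD R)).ncard = OptEmb.modifiedClassNumber r φ R := by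
  obtain ⟨f, hfi, hff⟩ := hP.exists_finite_polynomial (Fq := Fq)
  have hfA : Ring.HasFiniteQuotients A := by
    let _ := f.toAlgebra
    have : Module.Finite (Polynomial Fq) A := hff
    exact Ring.HasFiniteQuotients.of_module_finite (R := Polynomial Fq) A
  have hfK : FiniteDimensional k K := FiniteDimensional.of_finrank_pos (hK ▸ hr.pos)
  have hfD : FiniteDimensional k D :=
    FiniteDimensional.of_finrank_pos (by rw [hD]; exact pow_pos hr.pos 2)
  have hcl := OptEmb.finite_classSet (k := k) hfi hff R hR
  obtain ⟨h1, h2, h3⟩ := OptEmb.localFactor_spec hfi hff hr hD hK φ OD hOD R hR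
  have h4 (v : HeightOneSpectrum A) :
      (OptEmb.localCosets v φ OD R).ncard = OptEmb.localFactor r v φ R := (h3 v).2
  obtain ⟨h5, h6⟩ := OptEmb.finite_optimalCosets φ OD hOD.1 R hR hcl (fun v => (h3 v).1)
    (by simp only [h4]; exact h2)
  refine ⟨hcl, h1, h2, h3, h5, h6.trans ?_⟩
  rw [OptEmb.modifiedClassNumber, finprod_congr h4]
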